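/- Let $d\ge 0$ and let $\beta$ be the standard Gaussian measure on $\mathbb R^d$. Let $\nabla$ denote the weak gradient and let $\mathbb D_{2,1}$ be the Gaussian Sobolev space of all $u\in L^2(\beta)$ with $\nabla u\in L^2(\beta,\mathbb R^d)$, normed by $\|u\|_{L^2(\beta)}+\|\nabla u\|_{L^2(\beta)}$. Let $$Q_tg(x)=\int_{\mathbb R^d} g\bigl(e^{-t}x+\sqrt{1-e^{-2t}}\,y\bigr)\,\beta(dy)$$ be the Ornstein–Uhlenbeck semigroup, acting on scalar or vector valued functions. For probability measures $\mu,\nu$ on $\mathbb R^d$ let $\Sigma(\mu,\nu)$ be the set of measures on $\mathbb R^d\times\mathbb R^d$ with first marginal $\mu$ and second marginal $\nu$. A pair of measurable functions $\varphi,\psi:\mathbb R^d\to\mathbb R$ is called a pair of (forward, backward) Monge potentials for $\Sigma(\mu,\nu)$ if $$\varphi(x)+\psi(y)+\tfrac12|x-y|^2\ge 0\quad\text{for all }x,y\in\mathbb R^d,$$ with equality $\gamma$-almost surely for some $\gamma$ that minimizes $\int|x-y|^2\,d\gamma$ over $\Sigma(\mu,\nu)$. Let $f\in\mathbb D_{2,1}$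 satisfy $\int|\nabla f|^2e^{-f}\,d\beta<\infty$, and put $d\nu=c\,e^{-f}d\beta$ with $c=\bigl(\int e^{-f}d\beta\bigr)^{-1}$. For $n\ge1$ define $f_n$ by $e^{-f_n}=Q_{1/n}e^{-f}$ and put $d\nu_n=c\,e^{-f_n}d\beta$. Let $(\varphi,\psi)$ and $(\varphi_n,\psi_n)$ be Monge potentials for $\Sigma(\beta,\nu)$ and $\Sigma(\beta,\nu_n)$ respectively, with the additive constants fixed by $\int\varphi\,d\beta=\int\varphi_n\,d\beta=0$. Then: 1. $\varphi$ and all $\varphi_n$ belong to $\mathbb D_{2,1}$, and $\varphi_n\to\varphi$ in $\mathbb D_{2,1}$. 2. $\psi\in L^1(\nu)$; for every $n\ge1$ the integral defining $Q_{1/n}\psi_n$ converges absolutely $\nu$-a.e. and $Q_{1/n}\psi_n\in L^1(\nu)$; and $Q_{1/n}\psi_n\to\psi$ in $L^1(\nu)$. 3. $\psi$ and all $\psi_n$ have weak gradients, $\nabla\psi\in L^2(\nu,\mathbb R^d)$; for every $n\ge1$ the integral defining $Q_{1/n}\nabla\psi_n$ converges absolutely $\nu$-a.e. and $Q_{1/n}\nabla\psi_n\in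 L^2(\nu,\mathbb R^d)$; and $Q_{1/n}\nabla\psi_n\to\nabla\psi$ in $L^2(\nu,\mathbb R^d)$. -/

import Mathlib

open MeasureTheory ProbabilityTheory Filter Topology
open scoped ENNReal ContDiff

/-- The Euclidean space `ℝ^d`. -/
abbrev Euc (d : ℕ) : Type := EuclideanSpace ℝ (Fin d)

/-- `β`: the standard Gaussian measure on `ℝ^d`. -/
noncomputable abbrev gaussBeta (d : ℕ) : Measure (Euc d) := stdGaussian (Euc d)

/-- `G` is the weak (distributional) gradient of `u` on `ℝ^d`:
`∫ η G dx = - ∫ u ∇η dx` for all `η ∈ C_c^∞(ℝ^d)`. -/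
def HasWeakGrad {d : ℕ} (u : Euc d → ℝ) (G : Euc d → Euc d) : Prop :=
  LocallyIntegrable u volume ∧ LocallyIntegrable G volume ∧
    ∀ η : Euc d → ℝ, ContDiff ℝ ∞ η → HasCompactSupport η →
      ∫ x, η x • G x = - ∫ x, u x • gradient η x

/-- The weak gradient is unique up to null sets. -/
theorem HasWeakGrad.ae_eq {d : ℕ} {u : Euc d → ℝ} {G G' : Euc d → Euc d}
    (h : HasWeakGrad u G) (h' : HasWeakGrad u G') : G =ᵐ[volume] G' :=
  ae_eq_of_integral_contDiff_smul_eq h.2.1 h'.2.1 fun η hη hc =>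
    (h.2.2 η hη hc).trans (h'.2.2 η hη hc).symm

open Classical in
/-- A version of the weak gradient `∇u` (and `0` if `u` has none). -/
noncomputable def weakGrad {d : ℕ} (u : Euc d → ℝ) : Euc d → Euc d :=
  if h : ∃ G, HasWeakGrad u G then h.choose else 0

theorem HasWeakGrad.weakGrad {d : ℕ} {u : Euc d → ℝ} {G : Euc d → Euc d}
    (h : HasWeakGrad u G) : HasWeakGrad u (weakGrad u) := by
  have h₁ : ∃ G, HasWeakGrad u G := ⟨G, h⟩
  rw [_root_.weakGrad, dif_pos h₁]
  exact h₁.choose_spec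

/-- Membership in the Gaussian Sobolev space `𝔻_{2,1}` over `(ℝ^d, β)`: `u ∈ L²(β)` with weak
gradient in `L²(β)`. -/
def MemD21 {d : ℕ} (u : Euc d → ℝ) : Prop :=
  MemLp u 2 (gaussBeta d) ∧ HasWeakGrad u (weakGrad u) ∧ MemLp (weakGrad u) 2 (gaussBeta d)

/-- The norm `‖u‖_{L²(β)} + ‖∇u‖_{L²(β)}` of `𝔻_{2,1}`; only meaningful when `MemD21 u`. -/
noncomputable def d21Norm {d : ℕ} (u : Euc d → ℝ) : ℝ≥0∞ :=
  eLpNorm u 2 (gaussBeta d) + eLpNorm (weakGrad u) 2 (gaussBeta d)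

/-- Mehler's integrand `y ↦ g(e^{-t} x + √(1 - e^{-2t}) y)`. -/
noncomputable def mehler {d : ℕ} {F : Type*} (t : ℝ) (g : Euc d → F) (x : Euc d) : Euc d → F :=
  fun y => g (Real.exp (-t) • x + Real.sqrt (1 - Real.exp (-2 * t)) • y)

/-- The Ornstein–Uhlenbeck semigroup
`Q_t g(x) = ∫ g(e^{-t} x + √(1 - e^{-2t}) y) β(dy)`, for scalar or vector valued `g`; only
meaningful at `x` when `mehler t g x` is `β`-integrable. -/
noncomputable def ouSemigroup {d : ℕ} {F : Type*} [NormedAddCommGroup F] [NormedSpace ℝ F]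
    (t : ℝ) (g : Euc d → F) (x : Euc d) : F :=
  ∫ y, mehler t g x y ∂(gaussBeta d)

/-- The measure `c e^{-g} dβ`. -/
noncomputable def gibbsMeasure {d : ℕ} (c : ℝ) (g : Euc d → ℝ) : Measure (Euc d) :=
  (gaussBeta d).withDensity fun x => ENNReal.ofReal (c * Real.exp (-g x))

/-- `Σ(μ, ν)`: the measures on `ℝ^d × ℝ^d` with first marginal `μ` and second marginal `ν`. -/
def couplings {d : ℕ} (μ ν : Measure (Euc d)) : Set (Measure (Euc d × Euc d)) :=
  {γ | γ.map Prod.fst = μ ∧ γ.map Prod.snd = ν}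

/-- The quadratic transport cost `∫ |x - y|² dγ(x, y)`. -/
noncomputable def transportCost {d : ℕ} (γ : Measure (Euc d × Euc d)) : ℝ≥0∞ :=
  ∫⁻ p, ‖p.1 - p.2‖ₑ ^ 2 ∂γ

/-- `γ` solves the Monge–Kantorovich problem `Σ(μ, ν)`. -/
def IsOptimalPlan {d : ℕ} (μ ν : Measure (Euc d)) (γ : Measure (Euc d × Euc d)) : Prop :=
  γ ∈ couplings μ ν ∧ ∀ γ' ∈ couplings μ ν, transportCost γ ≤ transportCost γ'

/-- `(φ, ψ)` are Monge potentials (forward, backward) of the Monge–Kantorovich problem `Σ(μ, ν)`: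
measurable functions such that `φ(x) + ψ(y) + |x - y|²/2` is nonnegative everywhere and vanishes almost surely under a solution
of the problem. -/
def IsMongePotentials {d : ℕ} (μ ν : Measure (Euc d)) (φ ψ : Euc d → ℝ) : Prop :=
  AEMeasurable φ μ ∧ AEMeasurable ψ ν ∧ (∀ x y, 0 ≤ φ x + ψ y + ‖x - y‖ ^ 2 / 2) ∧
    ∃ γ, IsOptimalPlan μ ν γ ∧ ∀ᵐ p ∂γ, φ p.1 + ψ p.2 + ‖p.1 - p.2‖ ^ 2 / 2 = 0

/-!
The statement is a stability result for optimal transport from the Gaussian measure `β`, and the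
proof rests on one estimate.

*Convex potentials.* Replacing `φ, ψ` by `a = φ + |x|²/2`, `b = ψ + |y|²/2` and taking a double
Legendre transform, Monge potentials are almost everywhere given by finite convex functions with
`⟪x, y⟫ ≤ a(x) + b(y)` and equality under an optimal plan
(`IsMongePotentials.exists_isConvexPair`). Such functions are locally Lipschitz, so by Rademacher's
theorem their pointwise gradients are weak gradients, and `∇a`, `∇b` are the transport maps from `β`
to `ν` and back. Hence `∇φ = ∇a - x ∈ L²(β)` and `∇ψ = ∇b - y ∈ L²(ν)`, provided that `ν` has a
finite second moment. The latter follows from `∫ |∇f|² e^{-f} dβ < ∞` by testing the weak gradient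
of a truncation of `e^{-f}` against `xᵢ e^{-|x|²/2}`
(`HasWeakGrad.lintegral_norm_sq_mul_exp_ne_top`).

*Regularisation.* By the rotation invariance of `β ⊗ β`, the measure `ν_n` is the law of
`w = e^{-t} y + √(1 - e^{-2t}) z` with `t = 1/n` and `(y, z)` distributed as `ν ⊗ β`
(`gibbsMeasure_eq_map_ouMap`). So, if `γ` is an optimal plan for `(β, ν)` and `(x, y, z)` is
distributed as `γ ⊗ β`, then `(x, w)` is a coupling of `β` and `ν_n`. The optimal costs for `ν` and
`ν_n` differ by little, as `w - y → 0` in `L²`, and therefore this coupling is almost optimal: the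
duality gap `a_n(x) + b_n(w) - ⟪x, w⟫ ≥ 0` tends to `0` in `L¹`
(`IsOUFamily.tendsto_lintegral_ouGap`).

*Convergence of the gradients.* Along a subsequence the gap tends to `0` almost everywhere. At such
points `y` is almost a subgradient of `a_n` at `x`, and `x` one of `b_n` at `w`; since these points
are dense, monotonicity of subgradients forces `∇a_n → ∇a` and `∇b_n(w) → ∇b(y)` almost everywhere
(`tendsto_of_subgradient_bounds`). The `L²` norms converge as well, because the maps are transport
maps, so that the convergence holds in `L²` (`tendsto_lintegral_enorm_sub_pow`).

*Convergence of the potentials.* With the normalisation `∫ φ dβ = ∫ φ_n dβ = 0`, the Gaussian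
Poincaré inequality gives `φ_n → φ` in `L²(β)`. For the backward potentials,
`ψ_n(w) - ψ(y)` is the duality gap, minus `(φ_n - φ)(x)`, plus terms controlled by `w - y`
(`IsOUFamily.tendsto_backward_potential`). Integrating out `z` yields the claims about
`Q_{1/n} ψ_n` and `Q_{1/n} ∇ψ_n`, since averaging is a contraction in `L^p`.
-/

/-! ### Integration lemmas and gluing of plans -/

/-- Almost everywhere convergence together with convergence of the norms implies convergence in
`L^p`; only an upper bound `A n` on the norms with the right limit is needed. Fatou's lemma is
applied to `2^p (|uₙ|^p + |v|^p) - |uₙ - v|^p ≥ 0`. -/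
theorem tendsto_lintegral_enorm_sub_pow {α F : Type*} {m : MeasurableSpace α} {μ : Measure α}
    [NormedAddCommGroup F] (p : ℕ) {u : ℕ → α → F} {v : α → F}
    (hu : ∀ n, AEStronglyMeasurable (u n) μ) (hv : AEStronglyMeasurable v μ)
    (hlim : ∀ᵐ x ∂μ, Tendsto (fun n => u n x) atTop (𝓝 (v x)))
    (hfin : ∫⁻ x, ‖v x‖ₑ ^ p ∂μ ≠ ⊤) {A : ℕ → ℝ≥0∞}
    (hA : ∀ n, ∫⁻ x, ‖u n x‖ₑ ^ p ∂μ ≤ A n)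
    (hAlim : Tendsto A atTop (𝓝 (∫⁻ x, ‖v x‖ₑ ^ p ∂μ))) (hp : p ≠ 0) :
    Tendsto (fun n => ∫⁻ x, ‖u n x - v x‖ₑ ^ p ∂μ) atTop (𝓝 0) := by
  set I := ∫⁻ x, ‖v x‖ₑ ^ p ∂μ
  have hle : ∀ n x, ‖u n x - v x‖ₑ ^ p ≤ 2 ^ p * (‖u n x‖ₑ ^ p + ‖v x‖ₑ ^ p) := by
    intro n x
    calc ‖u n x - v x‖ₑ ^ p ≤ (2 * max ‖u n x‖ₑ ‖v x‖ₑ) ^ p := by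
          gcongr
          refine enorm_sub_le.trans ?_
          rw [two_mul]
          exact add_le_add (le_max_left _ _) (le_max_right _ _)
      _ ≤ _ := by
          rw [mul_pow]
          gcongr
          rcases le_total ‖u n x‖ₑ ‖v x‖ₑ with h | h
          · rw [max_eq_right h]; exact le_add_self
          · rw [max_eq_left h]; exact le_self_add
  -- the nonnegative functions to which Fatou's lemma is applied
  set g : ℕ → α → ℝ≥0∞ := fun n x => 2 ^ p * (‖u n x‖ₑ ^ p + ‖v x‖ₑ ^ p) - ‖u n x - v x‖ₑ ^ p
  have hgm : ∀ n, AEMeasurable (g n) μ := fun n => by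
    have h1 := (hu n).enorm
    have h2 := hv.enorm
    have h3 := ((hu n).sub hv).enorm
    exact (((h1.pow_const p).add (h2.pow_const p)).const_mul _).sub (h3.pow_const p)
  have hglim : ∀ᵐ x ∂μ, liminf (fun n => g n x) atTop = 2 ^ p * (2 * ‖v x‖ₑ ^ p) := by
    filter_upwards [hlim] with x hx
    apply Tendsto.liminf_eq
    have h1 : Tendsto (fun n => ‖u n x‖ₑ ^ p) atTop (𝓝 (‖v x‖ₑ ^ p)) :=
      ((ENNReal.continuous_pow p).tendsto _).comp ((continuous_enorm.tendsto _).comp hx)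
    have h2 : Tendsto (fun n => ‖u n x - v x‖ₑ ^ p) atTop (𝓝 0) := by
      have : Tendsto (fun n => u n x - v x) atTop (𝓝 0) := by
        simpa using hx.sub_const (v x)
      have := ((ENNReal.continuous_pow p).tendsto _).comp ((continuous_enorm.tendsto _).comp this)
      simpa [hp, Function.comp_def] using this
    have h3 := ENNReal.Tendsto.sub
      (ENNReal.Tendsto.const_mul (a := 2 ^ p) (h1.add_const (‖v x‖ₑ ^ p)) 
        (Or.inr (by finiteness))) h2
      (Or.inr (by simp))
    simpa [two_mul] using h3
  have hF : 2 ^ p * (2 * I) ≤ liminf (fun n => ∫⁻ x, g n x ∂μ) atTop := by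
    calc 2 ^ p * (2 * I) = ∫⁻ x, liminf (fun n => g n x) atTop ∂μ := by
          rw [lintegral_congr_ae hglim, lintegral_const_mul' _ _ (by finiteness),
            lintegral_const_mul' _ _ (by finiteness)]
      _ ≤ _ := lintegral_liminf_le' hgm
  have hsum : ∀ n, ∫⁻ x, g n x ∂μ + ∫⁻ x, ‖u n x - v x‖ₑ ^ p ∂μ ≤ 2 ^ p * (A n + I) := by
    intro n
    rw [← lintegral_add_left' (hgm n)]
    calc _ = ∫⁻ x, 2 ^ p * (‖u n x‖ₑ ^ p + ‖v x‖ₑ ^ p) ∂μ :=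
          lintegral_congr fun x => tsub_add_cancel_of_le (hle n x)
      _ = 2 ^ p * (∫⁻ x, ‖u n x‖ₑ ^ p ∂μ + I) := by
          rw [lintegral_const_mul' _ _ (by finiteness),
            lintegral_add_right' _ (hv.enorm.pow_const p)]
      _ ≤ _ := by gcongr; exact hA n
  have hlims : Tendsto (fun n => 2 ^ p * (A n + I)) atTop (𝓝 (2 ^ p * (2 * I))) := by
    rw [two_mul]
    exact ENNReal.Tendsto.const_mul (hAlim.add_const I) (Or.inr (by finiteness))
  have hfin' : 2 ^ p * (2 * I) ≠ ⊤ := by finiteness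
  rw [ENNReal.tendsto_nhds_zero]
  intro ε hε
  by_cases hεt : ε = ⊤
  · simp [hεt]
  -- eventually `∫ g_n ≥ 2^p 2 I - ε/2` and `2^p (A_n + I) ≤ 2^p 2 I + ε/2`
  have hε2 : ε / 2 ≠ 0 := (ENNReal.half_pos hε.ne').ne'
  have e2 : ∀ᶠ n in atTop, 2 ^ p * (A n + I) ≤ 2 ^ p * (2 * I) + ε / 2 :=
    hlims.eventually (Iic_mem_nhds (ENNReal.lt_add_right hfin' hε2))
  have e1 : ∀ᶠ n in atTop, 2 ^ p * (2 * I) ≤ ∫⁻ x, g n x ∂μ + ε / 2 := by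
    by_cases h0 : 2 ^ p * (2 * I) = 0
    · simp [h0]
    have : 2 ^ p * (2 * I) - ε / 2 < liminf (fun n => ∫⁻ x, g n x ∂μ) atTop :=
      (ENNReal.sub_lt_self hfin' h0 hε2).trans_le hF
    filter_upwards [eventually_lt_of_lt_liminf this] with n hn
    exact tsub_le_iff_right.1 hn.le
  filter_upwards [e1, e2] with n h1 h2
  have h3 := (hsum n).trans h2
  have hgfin : ∫⁻ x, g n x ∂μ ≠ ⊤ := by
    refine ne_top_of_le_ne_top ?_ (le_self_add.trans h3)
    finiteness
  have h4 : ∫⁻ x, g n x ∂μ + ∫⁻ x, ‖u n x - v x‖ₑ ^ p ∂μ ≤ ∫⁻ x, g n x ∂μ + ε := by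
    calc _ ≤ 2 ^ p * (2 * I) + ε / 2 := h3
      _ ≤ ∫⁻ x, g n x ∂μ + ε / 2 + ε / 2 := by gcongr
      _ = _ := by rw [add_assoc, ENNReal.add_halves]
  exact (ENNReal.add_le_add_iff_left hgfin).1 h4

theorem eLpNorm_two_sq {α F : Type*} {m : MeasurableSpace α} {μ : Measure α}
    [NormedAddCommGroup F] (g : α → F) : eLpNorm g 2 μ ^ 2 = ∫⁻ x, ‖g x‖ₑ ^ 2 ∂μ := by
  have h := eLpNorm_nnreal_pow_eq_lintegral (f := g) (μ := μ) (p := 2) (by norm_num)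
  norm_num at h
  exact h

/-- Jensen's inequality for the square. -/
theorem enorm_integral_sq_le {α F : Type*} {m : MeasurableSpace α} {μ : Measure α}
    [IsProbabilityMeasure μ] [NormedAddCommGroup F] [NormedSpace ℝ F] {g : α → F}
    (hg : AEStronglyMeasurable g μ) :
    ‖∫ x, g x ∂μ‖ₑ ^ 2 ≤ ∫⁻ x, ‖g x‖ₑ ^ 2 ∂μ := by
  have h := eLpNorm_le_eLpNorm_of_exponent_le (p := 1) (q := 2) one_le_two hg
  calc ‖∫ x, g x ∂μ‖ₑ ^ 2 ≤ (eLpNorm g 1 μ) ^ 2 := by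
        gcongr
        rw [eLpNorm_one_eq_lintegral_enorm]
        exact enorm_integral_le_lintegral_enorm g
    _ ≤ (eLpNorm g 2 μ) ^ 2 := by gcongr
    _ = _ := eLpNorm_two_sq g

theorem tendsto_eLpNorm_two_iff {α F : Type*} {m : MeasurableSpace α} {μ : Measure α}
    [NormedAddCommGroup F] {g : ℕ → α → F} :
    Tendsto (fun n => eLpNorm (g n) 2 μ) atTop (𝓝 0) ↔
      Tendsto (fun n => ∫⁻ x, ‖g n x‖ₑ ^ 2 ∂μ) atTop (𝓝 0) := by
  simp_rw [← eLpNorm_two_sq]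
  constructor
  · intro h
    simpa [Function.comp_def] using ((ENNReal.continuous_pow 2).tendsto _).comp h
  · intro h
    have := (ENNReal.continuous_rpow_const (y := (1 / 2 : ℝ))).tendsto 0 |>.comp h
    simp only [Function.comp_def] at this
    rw [ENNReal.zero_rpow_of_pos (by norm_num)] at this
    refine this.congr fun n => ?_
    rw [← ENNReal.rpow_natCast, ← ENNReal.rpow_mul]
    norm_num

theorem memLp_two_iff_lintegral {α F : Type*} {m : MeasurableSpace α} {μ : Measure α}
    [NormedAddCommGroup F] {g : α → F} (hg : AEStronglyMeasurable g μ) :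
    MemLp g 2 μ ↔ ∫⁻ x, ‖g x‖ₑ ^ 2 ∂μ ≠ ⊤ := by
  rw [← eLpNorm_two_sq]
  constructor
  · intro h
    have := h.eLpNorm_ne_top
    finiteness
  · intro h
    refine ⟨hg, lt_top_iff_ne_top.2 fun h' => h ?_⟩
    rw [h']; simp

theorem integral_norm_sq_eq {α F : Type*} {m : MeasurableSpace α} {μ : Measure α}
    [NormedAddCommGroup F] {g : α → F} (hg : AEStronglyMeasurable g μ) :
    ∫ x, ‖g x‖ ^ 2 ∂μ = (eLpNorm g 2 μ).toReal ^ 2 := by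
  rw [← ENNReal.toReal_pow, eLpNorm_two_sq,
    integral_eq_lintegral_of_nonneg_ae (ae_of_all _ fun x => by positivity)
      (by exact hg.norm.pow 2)]
  congr 1
  refine lintegral_congr fun x => ?_
  rw [ENNReal.ofReal_pow (norm_nonneg _), ofReal_norm]

/-- Gluing of two plans along a common marginal, by disintegration of the second one. -/
theorem exists_glued_plan {X Y Z : Type*} [MeasurableSpace X] [MeasurableSpace Y]
    [MeasurableSpace Z] [StandardBorelSpace Z] [Nonempty Z]
    {γ : Measure (X × Y)} {η : Measure (Y × Z)} [IsProbabilityMeasure γ] [IsProbabilityMeasure η]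
    (h : γ.map Prod.snd = η.map Prod.fst) :
    ∃ π : Measure ((X × Y) × Z), IsProbabilityMeasure π ∧ π.map Prod.fst = γ ∧
      π.map (fun q => (q.1.2, q.2)) = η := by
  refine ⟨γ ⊗ₘ (η.condKernel.comap Prod.snd measurable_snd), inferInstance, ?_, ?_⟩
  · exact Measure.fst_compProd γ _
  · ext s hs
    rw [Measure.map_apply (by fun_prop) hs, Measure.compProd_apply (hs.preimage (by fun_prop))]
    conv_rhs => rw [← η.disintegrate η.condKernel, Measure.compProd_apply hs, Measure.fst, ← h]
    rw [lintegral_map (Kernel.measurable_kernel_prodMk_left hs) measurable_snd]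
    rfl

/-! ### The Gaussian measure and Mehler's formula -/

/-- The density of the standard Gaussian measure with respect to Lebesgue measure. -/
theorem gaussBeta_eq_withDensity (d : ℕ) :
    gaussBeta d = (volume : Measure (Euc d)).withDensity fun x =>
      ENNReal.ofReal ((2 * Real.pi) ^ (-(d / 2 : ℝ)) * Real.exp (-(‖x‖ ^ 2 / 2))) := by
  set K : ℝ := (2 * Real.pi) ^ (-(d / 2 : ℝ)) with hK
  have hKpos : 0 < K := Real.rpow_pos_of_pos (by positivity) _
  -- the Fourier transform of the density
  have hF : ∀ t : Euc d, ∫ x : Euc d, Complex.exp (inner ℝ x t * Complex.I) *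
      ((K * Real.exp (-(‖x‖ ^ 2 / 2)) : ℝ) : ℂ) = Complex.exp (-‖t‖ ^ 2 / 2) := by
    intro t
    have h := GaussianFourier.integral_cexp_neg_mul_sq_norm_add (V := Euc d) (b := 1 / 2)
      (by norm_num) Complex.I t
    have e : ∀ x : Euc d, Complex.exp (inner ℝ x t * Complex.I) *
        ((K * Real.exp (-(‖x‖ ^ 2 / 2)) : ℝ) : ℂ) =
        K * Complex.exp (-(1 / 2) * ‖x‖ ^ 2 + Complex.I * (inner ℝ t x : ℝ)) := by
      intro x
      rw [real_inner_comm]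
      push_cast
      rw [mul_left_comm, ← Complex.exp_add]
      congr 2
      ring
    simp_rw [e]
    rw [integral_const_mul, h]
    have h2 : ((K : ℝ) : ℂ) * (Real.pi / (1 / 2 : ℂ)) ^ ((Module.finrank ℝ (Euc d) : ℂ) / 2) =
        1 := by
      have : (Real.pi / (1 / 2 : ℂ)) ^ ((Module.finrank ℝ (Euc d) : ℂ) / 2) =
          (((2 * Real.pi) ^ (d / 2 : ℝ) : ℝ) : ℂ) := by
        rw [Complex.ofReal_cpow (by positivity)]
        congr 1
        · push_cast; ring
        · simp
      rw [this, hK, ← Complex.ofReal_mul, ← Real.rpow_add (by positivity)]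
      simp
    rw [← mul_assoc, h2, one_mul]
    congr 1
    rw [Complex.I_sq]
    ring
  -- integrability comes for free: otherwise the integral `hF 0` would vanish
  have hint : Integrable fun x : Euc d => K * Real.exp (-(‖x‖ ^ 2 / 2)) := by
    by_contra hni
    have h0 := hF 0
    simp only [inner_zero_right, Complex.ofReal_zero, zero_mul, Complex.exp_zero, one_mul] at h0
    rw [integral_complex_ofReal, integral_undef hni] at h0
    simp at h0
  have hfin : IsFiniteMeasure ((volume : Measure (Euc d)).withDensity fun x =>
      ENNReal.ofReal (K * Real.exp (-(‖x‖ ^ 2 / 2)))) := by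
    refine isFiniteMeasure_withDensity_ofReal hint.2
  refine Measure.ext_of_charFun (funext fun t => ?_)
  rw [charFun_stdGaussian, charFun_apply,
    integral_withDensity_eq_integral_toReal_smul (by fun_prop) (by simp)]
  rw [← hF t]
  refine integral_congr_ae (ae_of_all _ fun x => ?_)
  simp only
  rw [ENNReal.toReal_ofReal (by positivity), Complex.real_smul, mul_comm]

theorem gaussBeta_absolutelyContinuous (d : ℕ) : gaussBeta d ≪ volume := by
  rw [gaussBeta_eq_withDensity]; exact withDensity_absolutelyContinuous _ _

theorem absolutelyContinuous_gaussBeta (d : ℕ) : (volume : Measure (Euc d)) ≪ gaussBeta d := by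
  rw [gaussBeta_eq_withDensity]
  refine withDensity_absolutelyContinuous' (by fun_prop) (ae_of_all _ fun x => ?_)
  simp only [ne_eq, ENNReal.ofReal_eq_zero, not_le]
  have : 0 < (2 * Real.pi) ^ (-(d / 2 : ℝ)) := Real.rpow_pos_of_pos (by positivity) _
  positivity

/-- The linear reflection `(x, y) ↦ (c x + s y, s x - c y)`; an involution when `c² + s² = 1`. -/
noncomputable def gaussReflect (d : ℕ) (c s : ℝ) : Euc d × Euc d →L[ℝ] Euc d × Euc d :=
  ContinuousLinearMap.prod
    (c • ContinuousLinearMap.fst ℝ (Euc d) (Euc d) + s • ContinuousLinearMap.snd ℝ (Euc d) (Euc d))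
    (s • ContinuousLinearMap.fst ℝ (Euc d) (Euc d) - c • ContinuousLinearMap.snd ℝ (Euc d) (Euc d))

theorem gaussReflect_apply {d : ℕ} (c s : ℝ) (p : Euc d × Euc d) :
    gaussReflect d c s p = (c • p.1 + s • p.2, s • p.1 - c • p.2) := rfl

theorem gaussReflect_involutive {d : ℕ} {c s : ℝ} (h : c ^ 2 + s ^ 2 = 1) (p : Euc d × Euc d) :
    gaussReflect d c s (gaussReflect d c s p) = p := by
  have h1 : ∀ u v : Euc d, c • (c • u + s • v) + s • (s • u - c • v) = (c ^ 2 + s ^ 2) • u := by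
    intro u v; module
  have h2 : ∀ u v : Euc d, s • (c • u + s • v) - c • (s • u - c • v) = (c ^ 2 + s ^ 2) • v := by
    intro u v; module
  simp only [gaussReflect_apply, h1, h2, h, one_smul]

/-- Rotation invariance of the product of two standard Gaussian measures. -/
theorem map_gaussReflect {d : ℕ} {c s : ℝ} (h : c ^ 2 + s ^ 2 = 1) :
    ((gaussBeta d).prod (gaussBeta d)).map (gaussReflect d c s) =
      (gaussBeta d).prod (gaussBeta d) := by
  have : IsProbabilityMeasure (((gaussBeta d).prod (gaussBeta d)).map (gaussReflect d c s)) :=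
    Measure.isProbabilityMeasure_map (by fun_prop)
  refine Measure.ext_of_charFunDual (funext fun L => ?_)
  rw [charFunDual_map, charFunDual_prod, charFunDual_prod]
  simp only [charFunDual_stdGaussian]
  rw [← Complex.exp_add, ← Complex.exp_add]
  set u := (InnerProductSpace.toDual ℝ (Euc d)).symm (L ∘SL ContinuousLinearMap.inl ℝ _ _) with hu
  set v := (InnerProductSpace.toDual ℝ (Euc d)).symm (L ∘SL ContinuousLinearMap.inr ℝ _ _) with hv
  have eu : L ∘SL ContinuousLinearMap.inl ℝ _ _ = InnerProductSpace.toDual ℝ (Euc d) u := by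
    simp [hu]
  have ev : L ∘SL ContinuousLinearMap.inr ℝ _ _ = InnerProductSpace.toDual ℝ (Euc d) v := by
    simp [hv]
  have hL : ∀ p : Euc d × Euc d, L p = inner ℝ u p.1 + inner ℝ v p.2 := by
    intro p
    have h1 := DFunLike.congr_fun eu p.1
    have h2 := DFunLike.congr_fun ev p.2
    simp only [ContinuousLinearMap.comp_apply, ContinuousLinearMap.inl_apply,
      ContinuousLinearMap.inr_apply, InnerProductSpace.toDual_apply_apply] at h1 h2
    rw [← h1, ← h2, ← map_add]
    simp
  have e1 : (L ∘SL gaussReflect d c s) ∘SL ContinuousLinearMap.inl ℝ _ _ =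
      InnerProductSpace.toDual ℝ (Euc d) (c • u + s • v) := by
    ext x
    simp [gaussReflect_apply, hL, inner_smul_right]
  have e2 : (L ∘SL gaussReflect d c s) ∘SL ContinuousLinearMap.inr ℝ _ _ =
      InnerProductSpace.toDual ℝ (Euc d) (s • u - c • v) := by
    ext x
    simp [gaussReflect_apply, hL, inner_smul_right]
    ring
  rw [e1, e2, eu, ev]
  simp only [LinearIsometryEquiv.norm_map]
  have key : ‖c • u + s • v‖ ^ 2 + ‖s • u - c • v‖ ^ 2 = ‖u‖ ^ 2 + ‖v‖ ^ 2 := by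
    rw [norm_add_sq_real, norm_sub_sq_real]
    simp only [norm_smul, inner_smul_left, inner_smul_right, mul_pow, Real.norm_eq_abs, sq_abs]
    simp
    linear_combination (‖u‖ ^ 2 + ‖v‖ ^ 2) * h
  congr 1
  have key' := congrArg (fun r : ℝ => (r : ℂ)) key
  push_cast at key'
  linear_combination (-1 / 2 : ℂ) * key'

theorem map_rotation_fst {d : ℕ} {c s : ℝ} (h : c ^ 2 + s ^ 2 = 1) :
    ((gaussBeta d).prod (gaussBeta d)).map (fun p => c • p.1 + s • p.2) = gaussBeta d := by
  have h1 := congrArg (Measure.map Prod.fst) (map_gaussReflect (d := d) h)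
  rw [Measure.map_map (by fun_prop) (by fun_prop)] at h1
  simpa [Function.comp_def, gaussReflect_apply, Measure.map_fst_prod] using h1

theorem memLp_id_gaussBeta (d : ℕ) : MemLp (fun x : Euc d => x) 2 (gaussBeta d) :=
  IsGaussian.memLp_id (gaussBeta d) 2 (by simp)

/-- The map `(y, z) ↦ e^{-t} y + √(1 - e^{-2t}) z` underlying Mehler's formula. -/
noncomputable def ouMap {d : ℕ} (t : ℝ) (p : Euc d × Euc d) : Euc d :=
  Real.exp (-t) • p.1 + Real.sqrt (1 - Real.exp (-2 * t)) • p.2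

theorem continuous_ouMap {d : ℕ} (t : ℝ) : Continuous (ouMap (d := d) t) := by
  unfold ouMap; fun_prop

theorem measurable_ouMap {d : ℕ} (t : ℝ) : Measurable (ouMap (d := d) t) :=
  (continuous_ouMap t).measurable

theorem mehler_eq {d : ℕ} {F : Type*} (t : ℝ) (g : Euc d → F) (x : Euc d) :
    mehler t g x = fun y => g (ouMap t (x, y)) := rfl

theorem exp_sq_add_sqrt_sq {t : ℝ} (ht : 0 ≤ t) :
    Real.exp (-t) ^ 2 + Real.sqrt (1 - Real.exp (-2 * t)) ^ 2 = 1 := by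
  have h1 : Real.exp (-2 * t) ≤ 1 := Real.exp_le_one_iff.2 (by linarith)
  rw [Real.sq_sqrt (by linarith), ← Real.exp_nat_mul]
  norm_num

theorem tendsto_ouMap {d : ℕ} {t : ℕ → ℝ} (ht : Tendsto t atTop (𝓝 0)) (p : Euc d × Euc d) :
    Tendsto (fun n => ouMap (t n) p) atTop (𝓝 p.1) := by
  have : Continuous fun t : ℝ => ouMap t p := by unfold ouMap; fun_prop
  have h := (this.tendsto 0).comp ht
  simpa [ouMap, Function.comp_def] using h

/-- Symmetry of the Ornstein–Uhlenbeck semigroup: the measure with density `Q_t ρ` with respect to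
`β` is the image of `ρ β ⊗ β` under `(y, z) ↦ e^{-t} y + √(1 - e^{-2t}) z`. -/
theorem lintegral_mul_comp_ouMap {d : ℕ} {t : ℝ} (ht : 0 ≤ t) {g ρ : Euc d → ℝ≥0∞}
    (hg : Measurable g) (hρ : Measurable ρ) :
    ∫⁻ p, g (ouMap t p) * ρ p.1 ∂((gaussBeta d).prod (gaussBeta d)) =
      ∫⁻ x, g x * ∫⁻ z, ρ (ouMap t (x, z)) ∂(gaussBeta d) ∂(gaussBeta d) := by
  have h := exp_sq_add_sqrt_sq ht
  have hm := measurable_ouMap (d := d) t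
  have hF : Measurable fun p : Euc d × Euc d => g p.1 * ρ (ouMap t p) := by fun_prop
  have e : ∀ p : Euc d × Euc d, g (ouMap t p) * ρ p.1 =
      (fun p : Euc d × Euc d => g p.1 * ρ (ouMap t p))
        (gaussReflect d (Real.exp (-t)) (Real.sqrt (1 - Real.exp (-2 * t))) p) := by
    intro p
    have h2 := congrArg Prod.fst (gaussReflect_involutive h p)
    rw [gaussReflect_apply] at h2
    simp only
    rw [show ouMap t (gaussReflect d _ _ p) = p.1 from h2]
    rfl
  simp_rw [e]
  rw [← lintegral_map hF (by fun_prop), map_gaussReflect h, lintegral_prod _ hF.aemeasurable]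
  refine lintegral_congr fun x => ?_
  exact lintegral_const_mul (g x) (hρ.comp (hm.comp measurable_prodMk_left))

/-- If `ν = c e^{-f} β` is finite and `e^{-h} = Q_t e^{-f}`, then `c e^{-h} β` is the law of
`e^{-t} Y + √(1 - e^{-2t}) Z` with `Y ∼ ν` and `Z ∼ β` independent. -/
theorem gibbsMeasure_eq_map_ouMap {d : ℕ} {t c : ℝ} (ht : 0 ≤ t) (hc : 0 < c) {f h : Euc d → ℝ}
    (hf : AEMeasurable f (gaussBeta d)) (hfi : Integrable (fun x => Real.exp (-f x)) (gaussBeta d))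
    (hh : ∀ᵐ x ∂(gaussBeta d), Real.exp (-h x) = ouSemigroup t (fun z => Real.exp (-f z)) x) :
    gibbsMeasure c h = ((gibbsMeasure c f).prod (gaussBeta d)).map (ouMap t) := by
  have hm := measurable_ouMap (d := d) t
  have hq := exp_sq_add_sqrt_sq ht
  have hmap : ((gaussBeta d).prod (gaussBeta d)).map (ouMap t) = gaussBeta d := map_rotation_fst hq
  set f' := hf.mk f with hf'
  have hf'm : Measurable f' := hf.measurable_mk
  have hff : f =ᵐ[gaussBeta d] f' := hf.ae_eq_mk
  set ρ : Euc d → ℝ≥0∞ := fun x => ENNReal.ofReal (c * Real.exp (-f' x)) with hρ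
  have hρm : Measurable ρ := by fun_prop
  have e1 : gibbsMeasure c f = (gaussBeta d).withDensity ρ := by
    refine withDensity_congr_ae ?_
    filter_upwards [hff] with x hx
    rw [hx]
  have hi : Integrable (fun p => Real.exp (-f (ouMap t p))) ((gaussBeta d).prod (gaussBeta d)) := by
    rw [← hmap] at hfi
    exact hfi.comp_measurable hm
  have hffp : ∀ᵐ x ∂(gaussBeta d), ∀ᵐ z ∂(gaussBeta d),
      f (ouMap t (x, z)) = f' (ouMap t (x, z)) := by
    have : ∀ᵐ p ∂((gaussBeta d).prod (gaussBeta d)), f (ouMap t p) = f' (ouMap t p) := by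
      have h' := hff
      rw [← hmap] at h'
      exact ae_of_ae_map hm.aemeasurable h'
    exact Measure.ae_ae_of_ae_prod this
  have e2 : gibbsMeasure c h = (gaussBeta d).withDensity
      fun x => ∫⁻ z, ρ (ouMap t (x, z)) ∂(gaussBeta d) := by
    refine withDensity_congr_ae ?_
    filter_upwards [hh, hi.prod_right_ae, hffp] with x hx hix hfx
    rw [hx, ouSemigroup, mehler_eq, ← integral_const_mul,
      ofReal_integral_eq_lintegral_ofReal (hix.const_mul c) (ae_of_all _ fun z => by positivity)]
    refine lintegral_congr_ae ?_
    filter_upwards [hfx] with z hz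
    rw [hρ, hz]
  have : SFinite (gibbsMeasure c f) := by rw [e1]; infer_instance
  ext s hs
  rw [Measure.map_apply hm hs, e2, withDensity_apply _ hs, e1]
  have hg : Measurable (s.indicator (1 : Euc d → ℝ≥0∞)) := measurable_one.indicator hs
  have key := lintegral_mul_comp_ouMap ht hg hρm
  have h3 : ∀ x, s.indicator (1 : Euc d → ℝ≥0∞) x * ∫⁻ z, ρ (ouMap t (x, z)) ∂(gaussBeta d) =
      s.indicator (fun x => ∫⁻ z, ρ (ouMap t (x, z)) ∂(gaussBeta d)) x := by
    intro x; by_cases hx : x ∈ s <;> simp [hx]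
  simp_rw [h3] at key
  rw [lintegral_indicator hs] at key
  rw [← key]
  have h4 : ((gaussBeta d).withDensity ρ).prod (gaussBeta d) =
      ((gaussBeta d).prod (gaussBeta d)).withDensity fun p => ρ p.1 := prod_withDensity_left hρm
  rw [h4, withDensity_apply _ (hm hs), ← lintegral_indicator (hm hs)]
  refine lintegral_congr fun p => ?_
  by_cases hx : ouMap t p ∈ s
  · have hx' : p ∈ ouMap t ⁻¹' s := hx
    simp [hx, hx']
  · have hx' : p ∉ ouMap t ⁻¹' s := hx
    simp [hx, hx']

/-! ### Convex potentials of an optimal plan -/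

theorem IsOptimalPlan.isProbabilityMeasure {d : ℕ} {μ ν : Measure (Euc d)} [IsProbabilityMeasure μ]
    {γ : Measure (Euc d × Euc d)} (h : IsOptimalPlan μ ν γ) : IsProbabilityMeasure γ := by
  refine ⟨?_⟩
  have h1 := congrArg (fun m => m Set.univ) h.1.1
  simpa [Measure.map_apply measurable_fst] using h1

/-- A coupling attached to convex Kantorovich potentials: `a`, `b` are finite convex functions with
`⟪x, y⟫ ≤ a x + b y`, and equality holds `γ`-almost surely. -/
structure IsConvexPair {d : ℕ} (a b : Euc d → ℝ) (γ : Measure (Euc d × Euc d)) : Prop where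
  convex_fst : ConvexOn ℝ Set.univ a
  convex_snd : ConvexOn ℝ Set.univ b
  inner_le : ∀ x y, inner ℝ x y ≤ a x + b y
  ae_eq : ∀ᵐ p ∂γ, a p.1 + b p.2 = inner ℝ p.1 p.2

theorem ae_map_of_nullMeasurableSet {α β : Type*} [MeasurableSpace α] [MeasurableSpace β]
    {μ : Measure α} {f : α → β} (hf : AEMeasurable f μ) {P : β → Prop}
    (hP : NullMeasurableSet {y | P y} (μ.map f)) (h : ∀ᵐ x ∂μ, P (f x)) :
    ∀ᵐ y ∂(μ.map f), P y := by
  rw [ae_iff, ← Set.compl_ofPred, Measure.map_apply₀ hf hP.compl]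
  exact h

/-- The Legendre transform of `g` is convex. The bound by a real-valued `h` ensures that the
supremum is a genuine one. -/
theorem convexOn_ciSup_inner_sub {d : ℕ} {g h : Euc d → ℝ}
    (hg : ∀ x y, inner ℝ x y - g y ≤ h x) :
    ConvexOn ℝ Set.univ fun x : Euc d => ⨆ y, (inner ℝ x y - g y) := by
  have hb : ∀ x, BddAbove (Set.range fun y => (inner ℝ x y - g y)) := fun x =>
    ⟨h x, by rintro _ ⟨y, rfl⟩; exact hg x y⟩
  refine ⟨convex_univ, fun x _ x' _ s t hs ht hst => ciSup_le fun y => ?_⟩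
  have h1 := le_ciSup (hb x) y
  have h2 := le_ciSup (hb x') y
  have h3 := mul_le_mul_of_nonneg_left h1 hs
  have h4 := mul_le_mul_of_nonneg_left h2 ht
  simp only [inner_add_left, inner_smul_left, smul_eq_mul, conj_trivial] at h3 h4 ⊢
  have : g y = s * g y + t * g y := by rw [← add_mul, hst, one_mul]
  linarith

/-- Monge potentials agree almost everywhere with the ones coming from a pair of finite convex
functions, namely the double Legendre transforms. -/
theorem IsMongePotentials.exists_isConvexPair {d : ℕ} {μ ν : Measure (Euc d)} {φ ψ : Euc d → ℝ}
    (h : IsMongePotentials μ ν φ ψ) :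
    ∃ a b γ, IsConvexPair a b γ ∧ IsOptimalPlan μ ν γ ∧
      (φ =ᵐ[μ] fun x => a x - ‖x‖ ^ 2 / 2) ∧ (ψ =ᵐ[ν] fun y => b y - ‖y‖ ^ 2 / 2) := by
  obtain ⟨hφ, hψ, hpos, γ, hγ, heq⟩ := h
  set p : Euc d → ℝ := fun x => φ x + ‖x‖ ^ 2 / 2 with hp
  set q : Euc d → ℝ := fun y => ψ y + ‖y‖ ^ 2 / 2 with hq
  have hpq : ∀ x y, inner ℝ x y ≤ p x + q y := by
    intro x y
    have h1 := hpos x y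
    have h2 := norm_sub_sq_real x y
    simp only [hp, hq]
    linarith
  set a : Euc d → ℝ := fun x => ⨆ y, (inner ℝ x y - q y)
  have hab : ∀ x, BddAbove (Set.range fun y => (inner ℝ x y - q y)) := fun x =>
    ⟨p x, by rintro _ ⟨y, rfl⟩; linarith [hpq x y]⟩
  have hap : ∀ x, a x ≤ p x := fun x => ciSup_le fun y => by linarith [hpq x y]
  have haq : ∀ x y, inner ℝ x y ≤ a x + q y := fun x y => by linarith [le_ciSup (hab x) y]
  set b : Euc d → ℝ := fun y => ⨆ x, (inner ℝ y x - a x)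
  have hbb : ∀ y, BddAbove (Set.range fun x => (inner ℝ y x - a x)) := fun y =>
    ⟨q y, by rintro _ ⟨x, rfl⟩; linarith [haq x y, real_inner_comm x y]⟩
  have hbq : ∀ y, b y ≤ q y := fun y =>
    ciSup_le fun x => by linarith [haq x y, real_inner_comm x y]
  have hle : ∀ x y, inner ℝ x y ≤ a x + b y := fun x y => by
    linarith [le_ciSup (hbb y) x, real_inner_comm x y]
  have hac : ConvexOn ℝ Set.univ a :=
    convexOn_ciSup_inner_sub (h := p) fun x y => by linarith [hpq x y]
  have hbc : ConvexOn ℝ Set.univ b :=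
    convexOn_ciSup_inner_sub (h := q) fun y x => by linarith [haq x y, real_inner_comm x y]
  have hpe : ∀ᵐ z ∂γ, p z.1 + q z.2 = inner ℝ z.1 z.2 := by
    filter_upwards [heq] with z hz
    have h2 := norm_sub_sq_real z.1 z.2
    simp only [hp, hq]
    linarith
  refine ⟨a, b, γ, ⟨hac, hbc, hle, ?_⟩, hγ, ?_, ?_⟩
  · filter_upwards [hpe] with z hz
    linarith [hle z.1 z.2, hap z.1, hbq z.2]
  · have h1 : ∀ᵐ z ∂γ, φ z.1 = a z.1 - ‖z.1‖ ^ 2 / 2 := by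
      filter_upwards [hpe] with z hz
      have : p z.1 = a z.1 := by linarith [hle z.1 z.2, hap z.1, hbq z.2]
      rw [← this]; simp [hp]
    have hm : AEMeasurable (fun x => a x - ‖x‖ ^ 2 / 2) μ := by
      have := hac.locallyLipschitz.continuous.measurable
      fun_prop
    have h2 : NullMeasurableSet {x | φ x = a x - ‖x‖ ^ 2 / 2} μ := nullMeasurableSet_eq_fun hφ hm
    rw [← hγ.1.1] at h2
    have h3 := ae_map_of_nullMeasurableSet measurable_fst.aemeasurable h2 h1
    rwa [hγ.1.1] at h3
  · have h1 : ∀ᵐ z ∂γ, ψ z.2 = b z.2 - ‖z.2‖ ^ 2 / 2 := by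
      filter_upwards [hpe] with z hz
      have : q z.2 = b z.2 := by linarith [hle z.1 z.2, hap z.1, hbq z.2]
      rw [← this]; simp [hq]
    have hm : AEMeasurable (fun x => b x - ‖x‖ ^ 2 / 2) ν := by
      have := hbc.locallyLipschitz.continuous.measurable
      fun_prop
    have h2 : NullMeasurableSet {x | ψ x = b x - ‖x‖ ^ 2 / 2} ν := nullMeasurableSet_eq_fun hψ hm
    rw [← hγ.1.2] at h2
    have h3 := ae_map_of_nullMeasurableSet measurable_snd.aemeasurable h2 h1
    rwa [hγ.1.2] at h3

/-- Rademacher's theorem for locally Lipschitz functions. -/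
theorem LocallyLipschitz.ae_differentiableAt_real {d : ℕ} {u : Euc d → ℝ}
    (hu : LocallyLipschitz u) :
    ∀ᵐ x : Euc d, DifferentiableAt ℝ u x := by
  have h : ∀ n : ℕ, ∀ᵐ x : Euc d, x ∈ Metric.closedBall (0 : Euc d) n →
      DifferentiableWithinAt ℝ u (Metric.closedBall 0 n) x := by
    intro n
    obtain ⟨K, hK⟩ := (hu.locallyLipschitzOn
      (s := Metric.closedBall (0 : Euc d) n)).exists_lipschitzOnWith_of_compact
      (isCompact_closedBall _ _)
    exact hK.ae_differentiableWithinAt_of_mem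
  filter_upwards [ae_all_iff.2 h] with x hx
  obtain ⟨n, hn⟩ := exists_nat_gt ‖x‖
  refine (hx n (by simpa using hn.le)).differentiableAt ?_
  exact mem_of_superset (Metric.isOpen_ball.mem_nhds (by simpa using hn))
    Metric.ball_subset_closedBall

/-- Equality in the Fenchel–Young inequality determines the gradient. -/
theorem gradient_eq_of_inner_le {d : ℕ} {a b : Euc d → ℝ} (h : ∀ x y, inner ℝ x y ≤ a x + b y)
    {x y : Euc d} (hxy : a x + b y = inner ℝ x y) (ha : DifferentiableAt ℝ a x) :
    gradient a x = y := by
  have h1 : HasFDerivAt (fun z => a z - inner ℝ y z)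
      (fderiv ℝ a x - innerSL ℝ y) x := ha.hasFDerivAt.sub (innerSL ℝ y).hasFDerivAt
  have h2 : IsLocalMin (fun z => a z - inner ℝ y z) x := by
    refine Eventually.of_forall fun z => ?_
    simp only
    linarith [h z y, real_inner_comm z y, real_inner_comm x y]
  have h3 := h2.hasFDerivAt_eq_zero h1
  have h4 := ha.hasGradientAt.hasFDerivAt.unique ha.hasFDerivAt
  have h5 : InnerProductSpace.toDual ℝ (Euc d) (gradient a x) =
      InnerProductSpace.toDual ℝ (Euc d) y := by
    rw [h4, sub_eq_zero.1 h3]; rfl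
  exact (InnerProductSpace.toDual ℝ (Euc d)).injective h5

theorem measurable_gradient {d : ℕ} (u : Euc d → ℝ) : Measurable (gradient u) := by
  unfold gradient
  exact (InnerProductSpace.toDual ℝ (Euc d)).symm.continuous.measurable.comp (measurable_fderiv ℝ u)

namespace IsConvexPair

variable {d : ℕ} {a b : Euc d → ℝ} {γ : Measure (Euc d × Euc d)}

theorem continuous_fst (h : IsConvexPair a b γ) : Continuous a :=
  h.convex_fst.locallyLipschitz.continuous

theorem continuous_snd (h : IsConvexPair a b γ) : Continuous b :=
  h.convex_snd.locallyLipschitz.continuous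

theorem swap (h : IsConvexPair a b γ) : IsConvexPair b a (γ.map Prod.swap) where
  convex_fst := h.convex_snd
  convex_snd := h.convex_fst
  inner_le x y := by linarith [h.inner_le y x, real_inner_comm x y]
  ae_eq := by
    have hm : MeasurableSet {p : Euc d × Euc d | b p.1 + a p.2 = inner ℝ p.1 p.2} := by
      have := h.continuous_fst
      have := h.continuous_snd
      exact (isClosed_eq (by fun_prop) (by fun_prop)).measurableSet
    rw [ae_map_iff measurable_swap.aemeasurable hm]
    filter_upwards [h.ae_eq] with p hp
    simp only [Prod.fst_swap, Prod.snd_swap]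
    linarith [real_inner_comm p.1 p.2]

theorem ae_gradient_fst (h : IsConvexPair a b γ) (hγ : γ.map Prod.fst ≪ volume) :
    ∀ᵐ p ∂γ, DifferentiableAt ℝ a p.1 ∧ gradient a p.1 = p.2 := by
  have h1 : ∀ᵐ p ∂γ, DifferentiableAt ℝ a p.1 :=
    ae_of_ae_map measurable_fst.aemeasurable
      (hγ.ae_le h.convex_fst.locallyLipschitz.ae_differentiableAt_real)
  filter_upwards [h1, h.ae_eq] with p hp he
  exact ⟨hp, gradient_eq_of_inner_le h.inner_le he hp⟩

theorem ae_gradient_snd (h : IsConvexPair a b γ) (hγ : γ.map Prod.snd ≪ volume) :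
    ∀ᵐ p ∂γ, DifferentiableAt ℝ b p.2 ∧ gradient b p.2 = p.1 := by
  have h1 : (γ.map Prod.swap).map Prod.fst ≪ volume := by
    rwa [Measure.map_map measurable_fst measurable_swap]
  exact ae_of_ae_map measurable_swap.aemeasurable (h.swap.ae_gradient_fst h1)

/-- The first marginal is carried by points at which the gradient of `a` realises the equality in
the Fenchel–Young inequality. -/
theorem ae_fst (h : IsConvexPair a b γ) (hγ : γ.map Prod.fst ≪ volume) :
    ∀ᵐ x ∂(γ.map Prod.fst), DifferentiableAt ℝ a x ∧
      a x + b (gradient a x) = inner ℝ x (gradient a x) := by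
  have hm : MeasurableSet {x : Euc d | DifferentiableAt ℝ a x ∧
      a x + b (gradient a x) = inner ℝ x (gradient a x)} := by
    have h1 := h.continuous_fst.measurable
    have h2 := h.continuous_snd.measurable
    have h3 := measurable_gradient a
    exact (measurableSet_of_differentiableAt ℝ a).inter
      (measurableSet_eq_fun (by fun_prop) (by fun_prop))
  rw [ae_map_iff measurable_fst.aemeasurable hm]
  filter_upwards [h.ae_gradient_fst hγ, h.ae_eq] with p hp he
  refine ⟨hp.1, ?_⟩
  rw [hp.2, he]

theorem ae_snd (h : IsConvexPair a b γ) (hγ : γ.map Prod.snd ≪ volume) :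
    ∀ᵐ y ∂(γ.map Prod.snd), DifferentiableAt ℝ b y ∧
      a (gradient b y) + b y = inner ℝ (gradient b y) y := by
  have h0 : (γ.map Prod.swap).map Prod.fst = γ.map Prod.snd := by
    rw [Measure.map_map measurable_fst measurable_swap]; rfl
  have h1 := h.swap.ae_fst (h0 ▸ hγ)
  rw [h0] at h1
  filter_upwards [h1] with y hy
  exact ⟨hy.1, by rw [add_comm, hy.2, real_inner_comm]⟩

end IsConvexPair

/-- A convergence criterion for approximate subgradients: if `b` is differentiable at `y`, and the
vectors `v n` satisfy, asymptotically and against a dense set of directions `y' - y`, the upper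
bound `⟪y' - y, x'⟫` given by a subgradient `x'` of `b` at `y'`, then `v n → ∇ b y`. -/
theorem tendsto_of_subgradient_bounds {d : ℕ} {b : Euc d → ℝ} {y p : Euc d}
    (hb : HasGradientAt b p y) {v : ℕ → Euc d}
    (h : ∀ U : Set (Euc d), IsOpen U → U.Nonempty → ∃ y' ∈ U, ∃ x',
      (∀ z, b y' + inner ℝ (z - y') x' ≤ b z) ∧ ∃ (u : ℕ → Euc d) (r : ℕ → ℝ),
        Tendsto u atTop (𝓝 (y' - y)) ∧ Tendsto r atTop (𝓝 (inner ℝ (y' - y) x')) ∧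
        ∀ n, inner ℝ (u n) (v n) ≤ r n) :
    Tendsto v atTop (𝓝 p) := by
  -- the estimate in one direction `e`
  have key : ∀ e : Euc d, ‖e‖ = 1 → ∀ η : ℝ, 0 < η → η ≤ 1 → ∀ᶠ n in atTop,
      inner ℝ e (v n - p) ≤ (10 + ‖p‖) * η + 2 * η * ‖v n - p‖ := by
    intro e he η hη hη1
    have hb' := hb.hasFDerivAt
    rw [hasFDerivAt_iff_isLittleO_nhds_zero] at hb'
    have hb'' := hb'.def hη
    obtain ⟨ρ, hρ, hball⟩ := Metric.eventually_nhds_iff_ball.1 hb''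
    have hexp : ∀ w : Euc d, ‖w‖ < ρ → |b (y + w) - b y - inner ℝ p w| ≤ η * ‖w‖ := by
      intro w hw
      have := hball w (by simpa using hw)
      simpa using this
    -- a step small enough for `y + 2 w` to stay in the ball where the expansion holds
    set s : ℝ := ρ / 6 with hs
    have hspos : 0 < s := by positivity
    obtain ⟨y', hy', x', hx', u, r, hu, hr, hur⟩ := h (Metric.ball (y + s • e) (η * s))
      Metric.isOpen_ball ⟨_, Metric.mem_ball_self (by positivity)⟩
    set w : Euc d := y' - y with hw
    have hwe : ‖w - s • e‖ < η * s := by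
      rw [mem_ball_iff_norm] at hy'
      rwa [hw, sub_sub]
    have hwn : ‖w‖ ≤ 2 * s := by
      have h1 : ‖s • e‖ = s := by rw [norm_smul, he, mul_one, Real.norm_of_nonneg hspos.le]
      have h2 := norm_add_le (w - s • e) (s • e)
      rw [sub_add_cancel, h1] at h2
      nlinarith
    -- the subgradient inequality at `y'` tested at `y + 2 w`
    have hwx : inner ℝ w x' ≤ inner ℝ p w + 6 * η * s := by
      have h1 := hx' (y + (2 : ℝ) • w)
      have h2 := abs_le.1 (hexp w (by linarith))
      have h3 := abs_le.1 (hexp ((2 : ℝ) • w) (by rw [norm_smul]; norm_num; linarith))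
      have e1 : y + (2 : ℝ) • w - y' = w := by rw [hw]; module
      have e2 : y + w = y' := by rw [hw]; abel
      rw [e1] at h1
      rw [e2] at h2
      rw [inner_smul_right, norm_smul, Real.norm_of_nonneg (by norm_num : (0 : ℝ) ≤ 2)] at h3
      nlinarith [h2.1, h3.2]
    have hr' : ∀ᶠ n in atTop, r n < inner ℝ w x' + η * s :=
      hr.eventually_lt_const (by linarith [mul_pos hη hspos])
    have hu' : ∀ᶠ n in atTop, ‖u n - w‖ < η * s := by
      have := (hu.sub_const w).norm
      rw [hw, sub_self, norm_zero] at this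
      exact this.eventually_lt_const (by positivity)
    filter_upwards [hr', hu'] with n h1 h2
    have h3 : ‖s • e - u n‖ ≤ 2 * (η * s) := by
      have := norm_add_le (s • e - w) (w - u n)
      rw [sub_add_sub_cancel, norm_sub_rev (s • e) w, norm_sub_rev w (u n)] at this
      linarith
    have h4 : ‖u n - w‖ ≤ η * s := h2.le
    have h5 : s * inner ℝ e (v n - p) =
        inner ℝ (s • e - u n) (v n - p) + inner ℝ (u n) (v n) - inner ℝ w p -
          inner ℝ (u n - w) p := by
      simp only [inner_sub_left, inner_sub_right, inner_smul_left, conj_trivial]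
      ring
    have h6 : inner ℝ (s • e - u n) (v n - p) ≤ 2 * (η * s) * ‖v n - p‖ :=
      (real_inner_le_norm _ _).trans (by gcongr)
    have h7 : -inner ℝ (u n - w) p ≤ η * s * ‖p‖ := by
      have := (abs_le.1 (abs_real_inner_le_norm (u n - w) p)).1
      have := mul_le_mul_of_nonneg_right h4 (norm_nonneg p)
      linarith
    have h8 := hur n
    have h9 := real_inner_comm w p
    have h10 : s * inner ℝ e (v n - p) ≤ s * ((10 + ‖p‖) * η + 2 * η * ‖v n - p‖) := by
      nlinarith [mul_pos hη hspos]
    exact le_of_mul_le_mul_left h10 hspos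
  -- sum over the coordinate directions
  rw [tendsto_iff_norm_sub_tendsto_zero, Metric.tendsto_atTop']
  intro ε hε
  set D : ℝ := d + 1 with hD
  have hDpos : 0 < D := by positivity
  set η : ℝ := min 1 (min (1 / (4 * D)) (ε / (4 * D * (10 + ‖p‖)))) with hη
  have hηpos : 0 < η := by
    simp only [hη, lt_min_iff]; exact ⟨one_pos, by positivity, by positivity⟩
  have hη1 : η ≤ 1 := min_le_left _ _
  have hη2 : 2 * D * η ≤ 1 / 2 := by
    have : η ≤ 1 / (4 * D) := (min_le_right _ _).trans (min_le_left _ _)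
    rw [le_div_iff₀ (by positivity)] at this
    linarith
  have hη3 : D * ((10 + ‖p‖) * η) ≤ ε / 4 := by
    have : η ≤ ε / (4 * D * (10 + ‖p‖)) := (min_le_right _ _).trans (min_le_right _ _)
    rw [le_div_iff₀ (by positivity)] at this
    linarith
  have hall : ∀ᶠ n in atTop, ∀ i : Fin d,
      |(v n - p) i| ≤ (10 + ‖p‖) * η + 2 * η * ‖v n - p‖ := by
    rw [eventually_all]
    intro i
    have h1 := key (EuclideanSpace.single i 1) (by simp) η hηpos hη1
    have h2 := key (-EuclideanSpace.single i 1) (by simp) η hηpos hη1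
    filter_upwards [h1, h2] with n h1 h2
    rw [inner_neg_left] at h2
    simp only [EuclideanSpace.inner_single_left, conj_trivial, one_mul] at h1 h2
    exact abs_le.2 ⟨by linarith, h1⟩
  obtain ⟨N, hN⟩ := eventually_atTop.1 hall
  refine ⟨N, fun n hn => ?_⟩
  have h1 := hN n hn.le
  set V := ‖v n - p‖ with hV
  have h2 : V ≤ ∑ i : Fin d, |(v n - p) i| := by
    have : v n - p = ∑ i : Fin d, (v n - p) i • EuclideanSpace.single i (1 : ℝ) := by
      ext j; simp [Pi.single_apply]
    calc V = ‖∑ i : Fin d, (v n - p) i • EuclideanSpace.single i (1 : ℝ)‖ := by rw [hV, ← this]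
      _ ≤ ∑ i : Fin d, ‖(v n - p) i • EuclideanSpace.single i (1 : ℝ)‖ := norm_sum_le _ _
      _ = _ := by
        refine Finset.sum_congr rfl fun i _ => ?_
        rw [norm_smul, PiLp.norm_single, norm_one, mul_one, Real.norm_eq_abs]
  have h3 : V ≤ d * ((10 + ‖p‖) * η + 2 * η * V) := by
    refine h2.trans ((Finset.sum_le_sum fun i _ => h1 i).trans ?_)
    rw [Finset.sum_const, Finset.card_univ, Fintype.card_fin, nsmul_eq_mul]
  have hV0 : 0 ≤ V := norm_nonneg _
  have h4 : V ≤ D * ((10 + ‖p‖) * η + 2 * η * V) := by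
    refine h3.trans (mul_le_mul_of_nonneg_right (by rw [hD]; linarith) (by positivity))
  have h5 : V ≤ ε / 4 + 1 / 2 * V := by nlinarith
  simp only [Real.dist_eq, sub_zero, abs_of_nonneg hV0]
  linarith

/-! ### Weak gradients of locally Lipschitz functions -/

theorem lineDeriv_eq_inner_gradient {d : ℕ} {u : Euc d → ℝ} {x : Euc d}
    (h : DifferentiableAt ℝ u x) (v : Euc d) : lineDeriv ℝ u x v = inner ℝ (gradient u x) v := by
  rw [h.lineDeriv_eq_fderiv, h.hasGradientAt.hasFDerivAt.fderiv,
    InnerProductSpace.toDual_apply_apply]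

theorem norm_gradient {d : ℕ} (u : Euc d → ℝ) (x : Euc d) : ‖gradient u x‖ = ‖fderiv ℝ u x‖ := by
  rw [gradient, LinearIsometryEquiv.norm_map]

theorem LocallyLipschitz.locallyIntegrable_gradient {d : ℕ} {u : Euc d → ℝ}
    (hu : LocallyLipschitz u) : LocallyIntegrable (gradient u) volume := by
  intro x
  obtain ⟨K, s, hs, hK⟩ := hu x
  obtain ⟨r, hr, hrs⟩ := Metric.mem_nhds_iff.1 hs
  refine ⟨Metric.ball x r, Metric.ball_mem_nhds x hr, ?_⟩
  refine Measure.integrableOn_of_bounded (M := K) measure_ball_lt_top.ne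
    (measurable_gradient u).aestronglyMeasurable ?_
  refine (ae_restrict_iff' measurableSet_ball).2 (ae_of_all _ fun y hy => ?_)
  rw [norm_gradient]
  exact norm_fderiv_le_of_lipschitzOn ℝ (Metric.isOpen_ball.mem_nhds hy) (hK.mono hrs)

theorem continuous_gradient {d : ℕ} {u : Euc d → ℝ} (hu : ContDiff ℝ 1 u) :
    Continuous (gradient u) := by
  unfold gradient
  exact (InnerProductSpace.toDual ℝ (Euc d)).symm.continuous.comp
    (hu.continuous_fderiv one_ne_zero)

theorem hasCompactSupport_gradient {d : ℕ} {u : Euc d → ℝ} (hu : HasCompactSupport u) :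
    HasCompactSupport (gradient u) := by
  unfold gradient
  exact (hu.fderiv ℝ).comp_left (g := (InnerProductSpace.toDual ℝ (Euc d)).symm) (map_zero _)

/-- By Rademacher's theorem a locally Lipschitz function has its pointwise gradient as a weak
gradient. -/
theorem LocallyLipschitz.hasWeakGrad {d : ℕ} {u : Euc d → ℝ} (hu : LocallyLipschitz u) :
    HasWeakGrad u (gradient u) := by
  refine ⟨hu.continuous.locallyIntegrable, hu.locallyIntegrable_gradient, fun η hη hc => ?_⟩
  obtain ⟨R, hR⟩ := hc.isCompact.isBounded.subset_ball (0 : Euc d)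
  obtain ⟨K, hK⟩ := (hu.locallyLipschitzOn
    (s := Metric.closedBall (0 : Euc d) R)).exists_lipschitzOnWith_of_compact
      (isCompact_closedBall _ _)
  obtain ⟨w, hw, hwu⟩ := hK.extend_real
  have hη1 : ContDiff ℝ 1 η := hη.of_le (by exact_mod_cast le_top)
  obtain ⟨D, hD⟩ := hη1.lipschitzWith_of_hasCompactSupport hc one_ne_zero
  -- `u` may be replaced by the global Lipschitz function `w` on the support of `η`
  have hgrad : ∀ x, η x • gradient u x = η x • gradient w x := by
    intro x
    by_cases hx : x ∈ Metric.ball (0 : Euc d) R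
    · have : u =ᶠ[𝓝 x] w := by
        filter_upwards [Metric.isOpen_ball.mem_nhds hx] with y hy
        exact hwu (Metric.ball_subset_closedBall hy)
      rw [gradient, gradient, this.fderiv_eq]
    · rw [image_eq_zero_of_notMem_tsupport fun h => hx (hR h), zero_smul, zero_smul]
  have hval : ∀ x, u x • gradient η x = w x • gradient η x := by
    intro x
    by_cases hx : x ∈ Metric.ball (0 : Euc d) R
    · rw [hwu (Metric.ball_subset_closedBall hx)]
    · have : gradient η x = 0 := by
        rw [gradient, image_eq_zero_of_notMem_tsupport
          (fun h => hx (hR (tsupport_fderiv_subset ℝ h))), map_zero]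
      rw [this, smul_zero, smul_zero]
  simp_rw [hgrad, hval]
  have hηd : Differentiable ℝ η := hη1.differentiable one_ne_zero
  have hηg : Continuous (gradient η) := continuous_gradient hη1
  have hηgc : HasCompactSupport (gradient η) := hasCompactSupport_gradient hc
  have i1 : Integrable fun x => η x • gradient w x := by
    have hwl : LocallyLipschitz w := hw.locallyLipschitz
    exact hwl.locallyIntegrable_gradient.integrable_smul_left_of_hasCompactSupport
      hη.continuous hc
  have i2 : Integrable fun x => w x • gradient η x :=
    (hw.continuous.smul hηg).integrable_of_hasCompactSupport hηgc.smul_left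
  refine ext_inner_right ℝ fun v => ?_
  rw [inner_neg_left, real_inner_comm, ← integral_inner i1, real_inner_comm, ← integral_inner i2]
  have h := LipschitzWith.integral_lineDeriv_mul_eq (μ := volume) hw hD hc v
  calc ∫ x, inner ℝ v (η x • gradient w x) = ∫ x, lineDeriv ℝ w x v * η x := by
        refine integral_congr_ae ?_
        filter_upwards [hw.ae_differentiableAt] with x hx
        rw [lineDeriv_eq_inner_gradient hx, inner_smul_right, real_inner_comm, mul_comm]
    _ = ∫ x, lineDeriv ℝ η x (-v) * w x := h
    _ = _ := by
        rw [← integral_neg]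
        refine integral_congr_ae (ae_of_all _ fun x => ?_)
        simp only
        rw [lineDeriv_eq_inner_gradient (hηd x), inner_smul_right, inner_neg_right,
          real_inner_comm]
        ring

theorem HasWeakGrad.congr {d : ℕ} {u u' : Euc d → ℝ} {G : Euc d → Euc d} (h : HasWeakGrad u G)
    (hu : u =ᵐ[volume] u') : HasWeakGrad u' G := by
  refine ⟨h.1.congr hu, h.2.1, fun η hη hc => ?_⟩
  rw [h.2.2 η hη hc]
  congr 1
  refine integral_congr_ae ?_
  filter_upwards [hu] with x hx
  rw [hx]

/-- A function which is almost everywhere equal to a locally Lipschitz function has a weak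
gradient, namely the pointwise gradient of that function. -/
theorem weakGrad_of_ae_eq {d : ℕ} {u w : Euc d → ℝ} (hw : LocallyLipschitz w)
    (h : u =ᵐ[volume] w) : HasWeakGrad u (weakGrad u) ∧ weakGrad u =ᵐ[volume] gradient w := by
  have h1 : HasWeakGrad u (gradient w) := hw.hasWeakGrad.congr h.symm
  exact ⟨h1.weakGrad, h1.weakGrad.ae_eq h1⟩

theorem locallyLipschitz_half_norm_sq {d : ℕ} : LocallyLipschitz fun x : Euc d => ‖x‖ ^ 2 / 2 := by
  have : ContDiff ℝ 1 fun x : Euc d => ‖x‖ ^ 2 / 2 := (contDiff_norm_sq ℝ).div_const 2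
  exact this.locallyLipschitz

theorem hasGradientAt_half_norm_sq {d : ℕ} (x : Euc d) :
    HasGradientAt (fun x : Euc d => ‖x‖ ^ 2 / 2) x x := by
  have h := (hasStrictFDerivAt_norm_sq x).hasFDerivAt.mul_const (1 / 2 : ℝ)
  rw [hasGradientAt_iff_hasFDerivAt]
  have e : (1 / 2 : ℝ) • (2 • (innerSL ℝ) x) = InnerProductSpace.toDual ℝ (Euc d) x := by
    ext v
    simp
  rw [e] at h
  refine h.congr_of_eventuallyEq (Eventually.of_forall fun y => ?_)
  simp only
  ring

theorem gradient_sub_half_norm_sq {d : ℕ} {a : Euc d → ℝ} {x : Euc d}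
    (h : DifferentiableAt ℝ a x) : gradient (fun x => a x - ‖x‖ ^ 2 / 2) x = gradient a x - x := by
  refine HasGradientAt.gradient ?_
  have h1 := h.hasGradientAt.hasFDerivAt.sub (hasGradientAt_half_norm_sq x).hasFDerivAt
  rw [hasGradientAt_iff_hasFDerivAt, map_sub]
  exact h1

/-! ### The Gaussian Poincaré inequality -/

theorem LocallyLipschitz.enorm_sub_sq_le_lintegral_deriv {h : ℝ → ℝ} (hh : LocallyLipschitz h) :
    ‖h 1 - h 0‖ₑ ^ 2 ≤ ∫⁻ θ in Set.Ioc (0 : ℝ) 1, ‖deriv h θ‖ₑ ^ 2 := by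
  obtain ⟨K, hK⟩ := (hh.locallyLipschitzOn
    (s := Set.uIcc (0 : ℝ) 1)).exists_lipschitzOnWith_of_compact
    isCompact_uIcc
  have h1 := hK.absolutelyContinuousOnInterval.integral_deriv_eq_sub
  rw [intervalIntegral.integral_of_le zero_le_one] at h1
  have : IsProbabilityMeasure ((volume : Measure ℝ).restrict (Set.Ioc 0 1)) := ⟨by simp⟩
  rw [← h1]
  exact enorm_integral_sq_le (measurable_deriv h).aestronglyMeasurable

theorem enorm_inner_le {E : Type*} [NormedAddCommGroup E] [InnerProductSpace ℝ E] (x y : E) :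
    ‖(inner ℝ x y : ℝ)‖ₑ ≤ ‖x‖ₑ * ‖y‖ₑ := by
  simp only [enorm_eq_nnnorm]
  exact_mod_cast nnnorm_inner_le_nnnorm x y

/-- Poincaré inequality for the standard Gaussian measure, with a non-optimal constant. It is
obtained by integrating `d/dθ u(cos θ x + sin θ y)` and using the rotation invariance of `β ⊗ β`. -/
theorem gaussBeta_poincare {d : ℕ} {u : Euc d → ℝ} (hu : LocallyLipschitz u) :
    ∫⁻ p, ‖u p.2 - u p.1‖ₑ ^ 2 ∂((gaussBeta d).prod (gaussBeta d)) ≤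
      ENNReal.ofReal (Real.pi / 2) ^ 2 * (∫⁻ y : Euc d, ‖y‖ₑ ^ 2 ∂(gaussBeta d)) *
        ∫⁻ x, ‖gradient u x‖ₑ ^ 2 ∂(gaussBeta d) := by
  set B := (gaussBeta d).prod (gaussBeta d) with hB
  set k : ℝ := Real.pi / 2 with hk
  have hk0 : 0 ≤ k := by positivity
  set X : ℝ → Euc d × Euc d → Euc d := fun θ p => Real.cos (k * θ) • p.1 + Real.sin (k * θ) • p.2
    with hX
  set Y : ℝ → Euc d × Euc d → Euc d := fun θ p => Real.sin (k * θ) • p.1 - Real.cos (k * θ) • p.2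
    with hY
  have hXc : Continuous fun q : (Euc d × Euc d) × ℝ => X q.2 q.1 := by simp only [hX]; fun_prop
  have hYc : Continuous fun q : (Euc d × Euc d) × ℝ => Y q.2 q.1 := by simp only [hY]; fun_prop
  have hXd : ∀ p θ, HasDerivAt (fun θ => X θ p) ((-k) • Y θ p) θ := by
    intro p θ
    have h0 : HasDerivAt (fun θ : ℝ => k * θ) k θ := by simpa using (hasDerivAt_id θ).const_mul k
    have h1 := (h0.cos.smul_const p.1).add (h0.sin.smul_const p.2)
    refine h1.congr_deriv ?_
    simp only [hY]
    module
  have hlip : ∀ p, LocallyLipschitz fun θ => u (X θ p) := by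
    intro p
    have h1 : ContDiff ℝ 1 fun θ => X θ p := by
      simp only [hX]
      exact ((Real.contDiff_cos.comp (contDiff_const.mul contDiff_id)).smul contDiff_const).add
        ((Real.contDiff_sin.comp (contDiff_const.mul contDiff_id)).smul contDiff_const)
    exact hu.comp h1.locallyLipschitz
  have hrot : ∀ θ, B.map (fun p => (X θ p, Y θ p)) = B := fun θ =>
    map_gaussReflect (d := d) (Real.cos_sq_add_sin_sq (k * θ))
  have hdiff : ∀ᵐ p ∂B, ∀ᵐ θ ∂(volume.restrict (Set.Ioc (0 : ℝ) 1)),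
      DifferentiableAt ℝ u (X θ p) := by
    have hm : MeasurableSet {q : (Euc d × Euc d) × ℝ | DifferentiableAt ℝ u (X q.2 q.1)} :=
      (measurableSet_of_differentiableAt ℝ u).preimage hXc.measurable
    rw [Measure.ae_ae_comm hm]
    refine ae_of_all _ fun θ => ?_
    have h1 : B.map (X θ) = gaussBeta d :=
      map_rotation_fst (Real.cos_sq_add_sin_sq (k * θ))
    have h2 : ∀ᵐ x ∂(B.map (X θ)), DifferentiableAt ℝ u x := by
      rw [h1]
      exact (gaussBeta_absolutelyContinuous d).ae_le hu.ae_differentiableAt_real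
    refine ae_of_ae_map ?_ h2
    exact (hXc.comp (by fun_prop : Continuous fun p : Euc d × Euc d => (p, θ))).aemeasurable
  have hg := measurable_gradient u
  have hpt : ∀ᵐ p ∂B, ‖u p.2 - u p.1‖ₑ ^ 2 ≤
      ∫⁻ θ in Set.Ioc (0 : ℝ) 1, ENNReal.ofReal k ^ 2 *
        (‖gradient u (X θ p)‖ₑ ^ 2 * ‖Y θ p‖ₑ ^ 2) := by
    filter_upwards [hdiff] with p hp
    have h1 := (hlip p).enorm_sub_sq_le_lintegral_deriv
    have e1 : X 1 p = p.2 := by simp [hX, hk]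
    have e0 : X 0 p = p.1 := by simp [hX]
    simp only [e1, e0] at h1
    refine h1.trans (lintegral_mono_ae ?_)
    filter_upwards [hp] with θ hθ
    have h2 : HasDerivAt (fun θ => u (X θ p))
        (InnerProductSpace.toDual ℝ (Euc d) (gradient u (X θ p)) ((-k) • Y θ p)) θ :=
      HasFDerivAt.comp_hasDerivAt (l := u) θ hθ.hasGradientAt.hasFDerivAt (hXd p θ)
    rw [InnerProductSpace.toDual_apply_apply] at h2
    rw [h2.deriv, ← mul_pow, ← mul_pow]
    gcongr
    refine (enorm_inner_le _ _).trans ?_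
    rw [enorm_smul, enorm_neg, Real.enorm_of_nonneg hk0, mul_left_comm]
  calc ∫⁻ p, ‖u p.2 - u p.1‖ₑ ^ 2 ∂B
      ≤ ∫⁻ p, (∫⁻ θ in Set.Ioc (0 : ℝ) 1, ENNReal.ofReal k ^ 2 *
        (‖gradient u (X θ p)‖ₑ ^ 2 * ‖Y θ p‖ₑ ^ 2)) ∂B := lintegral_mono_ae hpt
    _ = ∫⁻ θ in Set.Ioc (0 : ℝ) 1, (∫⁻ p, ENNReal.ofReal k ^ 2 *
        (‖gradient u (X θ p)‖ₑ ^ 2 * ‖Y θ p‖ₑ ^ 2) ∂B) := by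
        refine lintegral_lintegral_swap ?_
        have h1 := hXc.measurable
        have h2 := hYc.measurable
        refine Measurable.aemeasurable ?_
        simp only [Function.uncurry_def]
        fun_prop
    _ = ∫⁻ _ in Set.Ioc (0 : ℝ) 1, ENNReal.ofReal k ^ 2 *
          ((∫⁻ x, ‖gradient u x‖ₑ ^ 2 ∂(gaussBeta d)) * ∫⁻ y : Euc d, ‖y‖ₑ ^ 2 ∂(gaussBeta d)) := by
        refine lintegral_congr fun θ => ?_
        rw [lintegral_const_mul' _ _ (by finiteness)]
        congr 1
        have hm : Measurable fun p : Euc d × Euc d => ‖gradient u p.1‖ₑ ^ 2 * ‖p.2‖ₑ ^ 2 := by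
          fun_prop
        have hXY : Measurable fun p : Euc d × Euc d => (X θ p, Y θ p) := by
          simp only [hX, hY]; fun_prop
        rw [← lintegral_prod_mul (by fun_prop) (by fun_prop)]
        conv_rhs => rw [← hB, ← hrot θ, lintegral_map hm hXY]
    _ = _ := by
        simp only [lintegral_const, MeasurableSet.univ, Measure.restrict_apply, Set.univ_inter,
          Real.volume_Ioc, sub_zero, ENNReal.ofReal_one, mul_one]
        ring

theorem lintegral_enorm_sq_gaussBeta_ne_top (d : ℕ) :
    ∫⁻ y : Euc d, ‖y‖ₑ ^ 2 ∂(gaussBeta d) ≠ ⊤ :=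
  (memLp_two_iff_lintegral (memLp_id_gaussBeta d).1).1 (memLp_id_gaussBeta d)

/-- A locally Lipschitz function with gradient in `L²(β)` is itself in `L²(β)`; no integrability is
assumed beforehand. -/
theorem LocallyLipschitz.memLp_two_of_gradient {d : ℕ} {u : Euc d → ℝ} (hu : LocallyLipschitz u)
    (hg : MemLp (gradient u) 2 (gaussBeta d)) : MemLp u 2 (gaussBeta d) := by
  have h1 := gaussBeta_poincare hu
  have h2 := (memLp_two_iff_lintegral hg.1).1 hg
  have h3 := lintegral_enorm_sq_gaussBeta_ne_top d
  have h4 : ∫⁻ p, ‖u p.2 - u p.1‖ₑ ^ 2 ∂((gaussBeta d).prod (gaussBeta d)) ≠ ⊤ :=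
    ne_top_of_le_ne_top (by finiteness) h1
  have hum := hu.continuous.measurable
  rw [lintegral_prod _ (by fun_prop)] at h4
  obtain ⟨x, hx⟩ := (ae_lt_top' (by fun_prop) h4).exists
  have h5 : MemLp (fun y => u y - u x) 2 (gaussBeta d) :=
    (memLp_two_iff_lintegral (by fun_prop)).2 hx.ne
  refine (h5.add (memLp_const (u x))).congr_norm hum.aestronglyMeasurable (ae_of_all _ fun y => ?_)
  simp

/-- The Poincaré inequality for functions of mean zero. -/
theorem LocallyLipschitz.lintegral_sq_le_of_integral_eq_zero {d : ℕ} {u : Euc d → ℝ}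
    (hu : LocallyLipschitz u) (hi : Integrable u (gaussBeta d)) (h0 : ∫ x, u x ∂(gaussBeta d) = 0) :
    ∫⁻ x, ‖u x‖ₑ ^ 2 ∂(gaussBeta d) ≤
      ENNReal.ofReal (Real.pi / 2) ^ 2 * (∫⁻ y : Euc d, ‖y‖ₑ ^ 2 ∂(gaussBeta d)) *
        ∫⁻ x, ‖gradient u x‖ₑ ^ 2 ∂(gaussBeta d) := by
  refine le_trans ?_ (gaussBeta_poincare hu)
  have hum := hu.continuous.measurable
  rw [lintegral_prod _ (by fun_prop)]
  refine lintegral_mono fun x => ?_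
  have h1 : ∫ y, (u y - u x) ∂(gaussBeta d) = -u x := by
    rw [integral_sub hi (integrable_const _), h0]; simp
  calc ‖u x‖ₑ ^ 2 = ‖∫ y, (u y - u x) ∂(gaussBeta d)‖ₑ ^ 2 := by rw [h1, enorm_neg]
    _ ≤ _ := enorm_integral_sq_le (by fun_prop)

/-! ### Mollification and weak gradients -/

/-- The mollification of `g` by a bump function. -/
noncomputable def mollify {d : ℕ} {F : Type*} [NormedAddCommGroup F] [NormedSpace ℝ F]
    (ρ : ContDiffBump (0 : Euc d)) (g : Euc d → F) : Euc d → F :=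
  convolution (ρ.normed volume) g (ContinuousLinearMap.lsmul ℝ ℝ) volume

theorem mollify_eq_integral {d : ℕ} {F : Type*} [NormedAddCommGroup F] [NormedSpace ℝ F]
    (ρ : ContDiffBump (0 : Euc d)) (g : Euc d → F) (x : Euc d) :
    mollify ρ g x = ∫ t, ρ.normed volume (x - t) • g t :=
  convolution_lsmul_swap

/-- Mollification does not increase the `L¹` norm, up to enlarging the ball by the radius of the
bump function. -/
theorem lintegral_closedBall_mollify_le {d : ℕ} {F : Type*} [NormedAddCommGroup F]
    [NormedSpace ℝ F] (ρ : ContDiffBump (0 : Euc d)) {g : Euc d → F}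
    (hg : AEStronglyMeasurable g volume) (R : ℝ) :
    ∫⁻ x in Metric.closedBall 0 R, ‖mollify ρ g x‖ₑ ≤
      ∫⁻ x in Metric.cthickening ρ.rOut (Metric.closedBall 0 R), ‖g x‖ₑ := by
  obtain ⟨g', hg', hgg'⟩ := hg
  have e1 : mollify ρ g = mollify ρ g' := by
    funext x
    rw [mollify_eq_integral, mollify_eq_integral]
    refine integral_congr_ae ?_
    filter_upwards [hgg'] with t ht
    rw [ht]
  have e2 : ∫⁻ x in Metric.cthickening ρ.rOut (Metric.closedBall 0 R), ‖g x‖ₑ =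
      ∫⁻ x in Metric.cthickening ρ.rOut (Metric.closedBall 0 R), ‖g' x‖ₑ := by
    refine setLIntegral_congr_fun_ae (Metric.isClosed_cthickening.measurableSet) ?_
    filter_upwards [hgg'] with t ht _
    rw [ht]
  rw [e1, e2]
  set S : Set (Euc d) := Metric.closedBall 0 R
  set S' := Metric.cthickening ρ.rOut S
  have hS' : MeasurableSet S' := Metric.isClosed_cthickening.measurableSet
  have hS : MeasurableSet S := measurableSet_closedBall
  have hρc : Continuous (ρ.normed (volume : Measure (Euc d))) := ρ.continuous_normed
  have hgm : Measurable fun x => ‖g' x‖ₑ := hg'.enorm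
  have hρ1 : ∫⁻ t, ‖ρ.normed (volume : Measure (Euc d)) t‖ₑ = 1 := by
    have h1 := ρ.integral_normed (μ := (volume : Measure (Euc d)))
    have h2 := ofReal_integral_eq_lintegral_ofReal
      (ρ.integrable_normed (μ := (volume : Measure (Euc d))))
      (ae_of_all _ fun x => ρ.nonneg_normed x)
    rw [h1, ENNReal.ofReal_one] at h2
    rw [h2]
    exact lintegral_congr fun t => Real.enorm_of_nonneg (ρ.nonneg_normed t)
  calc ∫⁻ x in S, ‖mollify ρ g' x‖ₑ
      ≤ ∫⁻ x in S, ∫⁻ t, ‖ρ.normed (volume : Measure (Euc d)) t‖ₑ * ‖g' (x - t)‖ₑ := by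
        refine lintegral_mono fun x => ?_
        refine (enorm_integral_le_lintegral_enorm _).trans (le_of_eq ?_)
        refine lintegral_congr fun t => ?_
        simp [enorm_smul]
    _ = ∫⁻ t, ∫⁻ x in S, ‖ρ.normed (volume : Measure (Euc d)) t‖ₑ * ‖g' (x - t)‖ₑ := by
        refine lintegral_lintegral_swap ?_
        refine Measurable.aemeasurable ?_
        simp only [Function.uncurry_def]
        have := hgm.comp (measurable_fst.sub measurable_snd :
          Measurable fun p : Euc d × Euc d => p.1 - p.2)
        exact (hρc.measurable.enorm.comp measurable_snd).mul this
    _ ≤ ∫⁻ t, ‖ρ.normed (volume : Measure (Euc d)) t‖ₑ * ∫⁻ x in S', ‖g' x‖ₑ := by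
        refine lintegral_mono fun t => ?_
        rw [lintegral_const_mul' _ _ (by finiteness)]
        by_cases ht : ρ.normed (volume : Measure (Euc d)) t = 0
        · simp [ht]
        refine mul_le_mul' le_rfl ?_
        have ht' : ‖t‖ < ρ.rOut := by
          have : t ∈ Function.support (ρ.normed (volume : Measure (Euc d))) := ht
          rw [ρ.support_normed_eq] at this
          simpa using this
        rw [← lintegral_indicator hS, ← lintegral_indicator hS',
          ← lintegral_add_right_eq_self _ t]
        refine lintegral_mono fun x => ?_
        simp only [Set.indicator, add_sub_cancel_right]
        split_ifs with h1 h2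
        · exact le_rfl
        · refine absurd (Metric.mem_cthickening_of_dist_le x (x + t) _ _ h1 ?_) h2
          simpa [dist_eq_norm] using ht'.le
        · exact zero_le
        · exact le_rfl
    _ = _ := by
        have : Measurable fun t => ‖ρ.normed (volume : Measure (Euc d)) t‖ₑ := hρc.measurable.enorm
        rw [lintegral_mul_const _ this, hρ1, one_mul]

/-- Mollifications converge in `L¹` on balls. They converge almost everywhere by the Lebesgue
differentiation theorem, and their norms are controlled by those on slightly larger balls. -/
theorem tendsto_lintegral_mollify_sub {d : ℕ} {F : Type*} [NormedAddCommGroup F]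
    [NormedSpace ℝ F] [CompleteSpace F] {ρ : ℕ → ContDiffBump (0 : Euc d)}
    (hρ : Tendsto (fun k => (ρ k).rOut) atTop (𝓝 0)) (hρ2 : ∀ k, (ρ k).rOut ≤ 2 * (ρ k).rIn)
    {g : Euc d → F} (hg : LocallyIntegrable g volume) {R : ℝ} (hR : 0 ≤ R) :
    Tendsto (fun k => ∫⁻ x in Metric.closedBall 0 R, ‖mollify (ρ k) g x - g x‖ₑ) atTop (𝓝 0) := by
  have hgm := hg.aestronglyMeasurable
  have hae := ContDiffBump.ae_convolution_tendsto_right_of_locallyIntegrable hρ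
    (Eventually.of_forall hρ2) hg
  have hfin : ∀ r, ∫⁻ x in Metric.closedBall 0 r, ‖g x‖ₑ ≠ ⊤ := fun r =>
    (hg.integrableOn_isCompact (isCompact_closedBall (0 : Euc d) r)).2.ne
  have hm : ∀ k, AEStronglyMeasurable (mollify (ρ k) g) volume := fun k => by
    have h := ((ρ k).hasCompactSupport_normed (μ := volume)).continuous_convolution_left
      (ContinuousLinearMap.lsmul ℝ ℝ) (ρ k).continuous_normed hg
    exact h.aestronglyMeasurable
  have h := tendsto_lintegral_enorm_sub_pow (μ := volume.restrict (Metric.closedBall 0 R)) 1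
    (u := fun k => mollify (ρ k) g) (v := g) (fun k => (hm k).restrict) hgm.restrict
    (ae_restrict_of_ae hae) (by simpa using hfin R)
    (A := fun k => ∫⁻ x in Metric.cthickening (ρ k).rOut (Metric.closedBall 0 R), ‖g x‖ₑ)
    (fun k => by simpa using lintegral_closedBall_mollify_le (ρ k) hgm R) ?_ one_ne_zero
  · simpa using h
  · have h1 : Tendsto (fun r => (volume.withDensity fun x => ‖g x‖ₑ)
        (Metric.cthickening r (Metric.closedBall (0 : Euc d) R))) (𝓝 0)
        (𝓝 ((volume.withDensity fun x => ‖g x‖ₑ) (Metric.closedBall (0 : Euc d) R))) := by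
      refine tendsto_measure_cthickening_of_isClosed ⟨1, one_pos, ?_⟩ Metric.isClosed_closedBall
      refine ne_top_of_le_ne_top ?_ (measure_mono (t := Metric.closedBall 0 (R + 1)) ?_)
      · rw [withDensity_apply _ measurableSet_closedBall]
        exact hfin _
      · rw [cthickening_closedBall zero_le_one hR, add_comm]
    have h2 := h1.comp hρ
    simp only [Function.comp_def] at h2
    rw [withDensity_apply _ measurableSet_closedBall] at h2
    simp_rw [withDensity_apply _ Metric.isClosed_cthickening.measurableSet] at h2
    simpa using h2

/-- The gradient of the mollification is the mollification of the weak gradient. -/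
theorem HasWeakGrad.hasGradientAt_mollify {d : ℕ} {f : Euc d → ℝ} {g : Euc d → Euc d}
    (h : HasWeakGrad f g) (ρ : ContDiffBump (0 : Euc d)) (x : Euc d) :
    HasGradientAt (mollify ρ f) (mollify ρ g x) x := by
  set r : Euc d → ℝ := ρ.normed (volume : Measure (Euc d))
  have hrc : ContDiff ℝ ∞ r := ρ.contDiff_normed
  have hr1 : ContDiff ℝ 1 r := hrc.of_le (by exact_mod_cast le_top)
  have hrs : HasCompactSupport r := ρ.hasCompactSupport_normed
  have h1 := hrs.hasFDerivAt_convolution_right (ContinuousLinearMap.lsmul ℝ ℝ).flip h.1 hr1 x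
  have e0 : convolution f r (ContinuousLinearMap.lsmul ℝ ℝ).flip volume = mollify ρ f :=
    convolution_flip _
  rw [e0] at h1
  -- the weak gradient tested against `t ↦ r (x - t)`
  have hη : ContDiff ℝ ∞ fun t => r (x - t) := hrc.comp (contDiff_const.sub contDiff_id)
  have hηs : HasCompactSupport fun t => r (x - t) :=
    hrs.comp_homeomorph (Homeomorph.subLeft x)
  have h2 := h.2.2 _ hη hηs
  have hgrad : ∀ t, gradient (fun t => r (x - t)) t = -gradient r (x - t) := by
    intro t
    refine HasGradientAt.gradient ?_
    have hd := (hr1.differentiable one_ne_zero (x - t)).hasGradientAt.hasFDerivAt.comp t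
      ((hasFDerivAt_const x t).sub (hasFDerivAt_id t))
    rw [hasGradientAt_iff_hasFDerivAt]
    refine hd.congr_fderiv ?_
    ext v; simp
  rw [hasGradientAt_iff_hasFDerivAt]
  refine h1.congr_fderiv ?_
  ext v
  rw [convolution_precompR_apply _ h.1 (hrs.fderiv ℝ) (hr1.continuous_fderiv one_ne_zero),
    InnerProductSpace.toDual_apply_apply, mollify_eq_integral, h2]
  simp_rw [hgrad, smul_neg]
  rw [integral_neg, neg_neg, real_inner_comm, ← integral_inner]
  · refine integral_congr_ae (ae_of_all _ fun t => ?_)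
    simp only [ContinuousLinearMap.flip_apply, ContinuousLinearMap.lsmul_apply, smul_eq_mul,
      inner_smul_right]
    rw [mul_comm, real_inner_comm,
      ← InnerProductSpace.toDual_apply_apply (𝕜 := ℝ),
      (hr1.differentiable one_ne_zero (x - t)).hasGradientAt.hasFDerivAt.fderiv]
  · refine h.1.integrable_smul_right_of_hasCompactSupport ?_ ?_
    · exact (continuous_gradient hr1).comp (continuous_const.sub continuous_id)
    · exact (hasCompactSupport_gradient hrs).comp_homeomorph (Homeomorph.subLeft x)

/-! ### A chain rule for weak gradients -/

set_option maxHeartbeats 400000 in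
/-- Chain rule for weak gradients: `G'(f) ∇f` is the weak gradient of `G(f)` when `G` is a bounded
`C¹` function with bounded derivative. It passes to the limit from the mollifications of `f`. -/
theorem HasWeakGrad.integral_comp {d : ℕ} {f : Euc d → ℝ} {g : Euc d → Euc d}
    (h : HasWeakGrad f g) {G G' : ℝ → ℝ} (hG : ∀ s, HasDerivAt G (G' s) s) (hG' : Continuous G')
    {M : ℝ} (hM : ∀ s, |G s| ≤ M) (hM' : ∀ s, |G' s| ≤ M) {η : Euc d → ℝ} (hη : ContDiff ℝ ∞ η)
    (hc : HasCompactSupport η) :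
    ∫ x, η x • G' (f x) • g x = - ∫ x, G (f x) • gradient η x := by
  have hη1 : ContDiff ℝ 1 η := hη.of_le (by exact_mod_cast le_top)
  have hGc : Continuous G := continuous_iff_continuousAt.2 fun s => (hG s).continuousAt
  have hM0 : 0 ≤ M := (abs_nonneg _).trans (hM 0)
  set ρ : ℕ → ContDiffBump (0 : Euc d) := fun k =>
    { rIn := 1 / (k + 1 : ℝ), rOut := 2 * (1 / (k + 1 : ℝ)),
      rIn_pos := by positivity
      rIn_lt_rOut := by
        have : (0 : ℝ) < 1 / (k + 1 : ℝ) := by positivity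
        linarith } with hρdef
  have hρ : Tendsto (fun k => (ρ k).rOut) atTop (𝓝 0) := by
    have := (tendsto_one_div_add_atTop_nhds_zero_nat (𝕜 := ℝ)).const_mul 2
    simpa [hρdef] using this
  have hρ2 : ∀ k, (ρ k).rOut ≤ 2 * (ρ k).rIn := fun k => le_rfl
  have hfae := ContDiffBump.ae_convolution_tendsto_right_of_locallyIntegrable hρ
    (Eventually.of_forall hρ2) h.1
  set F : ℕ → Euc d → ℝ := fun k => mollify (ρ k) f with hF
  have hFae : ∀ᵐ x, Tendsto (fun k => F k x) atTop (𝓝 (f x)) := hfae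
  have hFgrad : ∀ k x, HasGradientAt (F k) (mollify (ρ k) g x) x := fun k x =>
    h.hasGradientAt_mollify (ρ k) x
  have hmollc : ∀ k, Continuous (mollify (ρ k) g) := fun k =>
    ((ρ k).hasCompactSupport_normed (μ := volume)).continuous_convolution_left
      (ContinuousLinearMap.lsmul ℝ ℝ) (ρ k).continuous_normed h.2.1
  have hFc : ∀ k, Continuous (F k) := fun k =>
    continuous_iff_continuousAt.2 fun x => (hFgrad k x).hasFDerivAt.continuousAt
  -- the chain rule for the mollified functions
  have hGF : ∀ k x, HasGradientAt (fun x => G (F k x)) (G' (F k x) • mollify (ρ k) g x) x := by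
    intro k x
    have h1 := (hG (F k x)).comp_hasFDerivAt x (hFgrad k x).hasFDerivAt
    rw [hasGradientAt_iff_hasFDerivAt, map_smul]
    exact h1
  have hk : ∀ k, ∫ x, η x • G' (F k x) • mollify (ρ k) g x =
      - ∫ x, G (F k x) • gradient η x := by
    intro k
    have hgr : gradient (fun x => G (F k x)) = fun x => G' (F k x) • mollify (ρ k) g x :=
      funext fun x => (hGF k x).gradient
    have hC1 : ContDiff ℝ 1 fun x => G (F k x) := by
      rw [contDiff_one_iff_fderiv]
      refine ⟨fun x => (hGF k x).hasFDerivAt.differentiableAt, ?_⟩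
      have e : fderiv ℝ (fun x => G (F k x)) = fun x =>
          InnerProductSpace.toDual ℝ (Euc d) (G' (F k x) • mollify (ρ k) g x) :=
        funext fun x => (hGF k x).hasFDerivAt.fderiv
      rw [e]
      exact (InnerProductSpace.toDual ℝ (Euc d)).continuous.comp
        ((hG'.comp (hFc k)).smul (hmollc k))
    have := hC1.locallyLipschitz.hasWeakGrad.2.2 η hη hc
    rwa [hgr] at this
  have hηgc : Continuous (gradient η) := continuous_gradient hη1
  have hηgi : Integrable (gradient η) :=
    hηgc.integrable_of_hasCompactSupport (hasCompactSupport_gradient hc)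
  have hηgint : Integrable fun x => η x • g x :=
    h.2.1.integrable_smul_left_of_hasCompactSupport hη.continuous hc
  have lim1 : Tendsto (fun k => ∫ x, G (F k x) • gradient η x) atTop
      (𝓝 (∫ x, G (f x) • gradient η x)) := by
    refine tendsto_integral_of_dominated_convergence (fun x => M * ‖gradient η x‖)
      (fun k => ((hGc.comp (hFc k)).smul hηgc).aestronglyMeasurable)
      (hηgi.norm.const_mul M) (fun k => ae_of_all _ fun x => ?_) ?_
    · rw [norm_smul]
      exact mul_le_mul_of_nonneg_right (hM _) (norm_nonneg _)
    · filter_upwards [hFae] with x hx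
      exact ((hGc.tendsto _).comp hx).smul_const _
  have lim2 : Tendsto (fun k => ∫ x, G' (F k x) • η x • g x) atTop
      (𝓝 (∫ x, G' (f x) • η x • g x)) := by
    refine tendsto_integral_of_dominated_convergence (fun x => M * ‖η x • g x‖)
      (fun k => ((hG'.comp (hFc k)).aestronglyMeasurable).smul hηgint.1)
      (hηgint.norm.const_mul M) (fun k => ae_of_all _ fun x => ?_) ?_
    · rw [norm_smul]
      exact mul_le_mul_of_nonneg_right (hM' _) (norm_nonneg _)
    · filter_upwards [hFae] with x hx
      exact ((hG'.tendsto _).comp hx).smul_const _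
  obtain ⟨C, hC⟩ := hη.continuous.bounded_above_of_compact_support hc
  obtain ⟨R, hR⟩ := hc.isCompact.isBounded.subset_closedBall (0 : Euc d)
  have hR' : tsupport η ⊆ Metric.closedBall (0 : Euc d) (max R 0) :=
    hR.trans (Metric.closedBall_subset_closedBall (le_max_left _ _))
  have lim3 : Tendsto (fun k => ∫ x, G' (F k x) • η x • (mollify (ρ k) g x - g x)) atTop
      (𝓝 0) := by
    rw [tendsto_zero_iff_enorm_tendsto_zero]
    have h0 := ENNReal.Tendsto.const_mul (a := ENNReal.ofReal (M * C))
      (tendsto_lintegral_mollify_sub hρ hρ2 h.2.1 (le_max_right R 0)) (Or.inr (by finiteness))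
    rw [mul_zero] at h0
    refine tendsto_of_tendsto_of_tendsto_of_le_of_le tendsto_const_nhds h0
      (fun _ => zero_le) fun k => ?_
    refine (enorm_integral_le_lintegral_enorm _).trans ?_
    rw [← lintegral_const_mul' _ _ (by finiteness), ← lintegral_indicator measurableSet_closedBall]
    refine lintegral_mono fun x => ?_
    by_cases hx : x ∈ Metric.closedBall (0 : Euc d) (max R 0)
    · rw [Set.indicator_of_mem hx, enorm_smul, enorm_smul, ← mul_assoc,
        ENNReal.ofReal_mul hM0]
      gcongr
      · rw [← ofReal_norm]; exact ENNReal.ofReal_le_ofReal (hM' _)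
      · rw [← ofReal_norm]; exact ENNReal.ofReal_le_ofReal (hC _)
    · rw [image_eq_zero_of_notMem_tsupport fun h => hx (hR' h)]
      simp
  have e : ∀ k, ∫ x, η x • G' (F k x) • mollify (ρ k) g x =
      (∫ x, G' (F k x) • η x • (mollify (ρ k) g x - g x)) + ∫ x, G' (F k x) • η x • g x := by
    intro k
    have i1 : Integrable fun x => G' (F k x) • η x • g x := by
      have := h.2.1.integrable_smul_left_of_hasCompactSupport
        (((hG'.comp (hFc k)).mul hη.continuous)) hc.mul_left
      refine this.congr (ae_of_all _ fun x => ?_)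
      simp [mul_smul]
    have i2 : Integrable fun x => G' (F k x) • η x • mollify (ρ k) g x := by
      have : Continuous fun x => G' (F k x) • η x • mollify (ρ k) g x :=
        (hG'.comp (hFc k)).smul (hη.continuous.smul (hmollc k))
      refine this.integrable_of_hasCompactSupport (hc.mono fun x hx h0 => hx ?_)
      simp only [h0, zero_smul, smul_zero]
    rw [← integral_add _ i1]
    · refine integral_congr_ae (ae_of_all _ fun x => ?_)
      simp only
      rw [← smul_add, ← smul_add, sub_add_cancel, smul_comm]
    · refine (i2.sub i1).congr (ae_of_all _ fun x => ?_)
      simp only [Pi.sub_apply]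
      rw [smul_sub, smul_sub]
  have lim4 : Tendsto (fun k => ∫ x, η x • G' (F k x) • mollify (ρ k) g x) atTop
      (𝓝 (∫ x, G' (f x) • η x • g x)) := by
    simp_rw [e]
    simpa using lim3.add lim2
  simp_rw [hk] at lim4
  have := tendsto_nhds_unique lim4 lim1.neg
  rw [← this]
  exact integral_congr_ae (ae_of_all _ fun x => smul_comm _ _ _)

/-! ### Second moments from Fisher information -/

/-- The function `s ↦ 1 / (e^s + δ)` serves as a bounded truncation of `e^{-s}` with bounded
derivative. -/
theorem hasDerivAt_inv_exp_add {δ : ℝ} (hδ : 0 < δ) (s : ℝ) :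
    HasDerivAt (fun s => (Real.exp s + δ)⁻¹) (-Real.exp s / (Real.exp s + δ) ^ 2) s :=
  ((Real.hasDerivAt_exp s).add_const δ).inv (by positivity)

theorem abs_deriv_inv_exp_add_le {δ : ℝ} (hδ : 0 < δ) (s : ℝ) :
    |-Real.exp s / (Real.exp s + δ) ^ 2| ≤ (Real.exp s + δ)⁻¹ := by
  rw [abs_div, abs_neg, abs_of_pos (Real.exp_pos s), abs_of_pos (by positivity), div_le_iff₀
    (by positivity), sq, ← mul_assoc, inv_mul_cancel₀ (by positivity), one_mul]
  linarith

theorem inv_exp_add_le {δ : ℝ} (hδ : 0 < δ) (s : ℝ) : (Real.exp s + δ)⁻¹ ≤ Real.exp (-s) := by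
  rw [Real.exp_neg]
  exact inv_anti₀ (Real.exp_pos s) (by linarith)

theorem inv_exp_add_le' {δ : ℝ} (hδ : 0 < δ) (s : ℝ) : (Real.exp s + δ)⁻¹ ≤ δ⁻¹ :=
  inv_anti₀ hδ (by linarith [Real.exp_pos s])

/-- A bound on the truncated second moment of `e^{-f} β` in the `i`-th coordinate, obtained by
testing the weak gradient of `1 / (e^f + δ)` against `χ(ε x) xᵢ e^{-|x|²/2}`. The right-hand side
does not depend on `ε` and `δ`. -/
theorem HasWeakGrad.lintegral_truncated_coord_sq_le {d : ℕ} {f : Euc d → ℝ} {g : Euc d → Euc d}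
    (h : HasWeakGrad f g) (hfi : Integrable (fun x => Real.exp (-f x)) (gaussBeta d))
    (hgi : Integrable (fun x => ‖g x‖ ^ 2 * Real.exp (-f x)) (gaussBeta d)) (i : Fin d)
    (χ : ContDiffBump (0 : Euc d)) {C : ℝ}
    (hC : ∀ x, ‖fderiv ℝ χ x (EuclideanSpace.single i 1) * x i‖ ≤ C) {ε δ : ℝ}
    (hδ : 0 < δ) (hε : 0 < ε) :
    ∫⁻ x, ENNReal.ofReal (1 / 2 * (χ (ε • x) * x i ^ 2 * (Real.exp (f x) + δ)⁻¹)) ∂(gaussBeta d) ≤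
      ENNReal.ofReal (∫ x, ((1 + C) * Real.exp (-f x) + 1 / 2 * (‖g x‖ ^ 2 * Real.exp (-f x)))
        ∂(gaussBeta d)) := by
  set e : Euc d := EuclideanSpace.single i 1 with he
  set E : Euc d → ℝ := fun x => Real.exp (-(‖x‖ ^ 2 / 2)) with hE
  have hχ : ContDiff ℝ ∞ (χ : Euc d → ℝ) := χ.contDiff
  have hE' : ContDiff ℝ ∞ E := by
    simp only [hE]
    exact Real.contDiff_exp.comp ((contDiff_norm_sq ℝ).div_const 2).neg
  have hχε : ContDiff ℝ ∞ fun x : Euc d => χ (ε • x) := hχ.comp (contDiff_id.const_smul ε)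
  have hxi : ContDiff ℝ ∞ fun x : Euc d => x i :=
    (EuclideanSpace.proj (𝕜 := ℝ) i).contDiff
  set η : Euc d → ℝ := fun x => χ (ε • x) * (x i * E x) with hη
  have hηs : ContDiff ℝ ∞ η := hχε.mul (hxi.mul hE')
  have hχc : HasCompactSupport fun x : Euc d => χ (ε • x) :=
    χ.hasCompactSupport.comp_homeomorph (Homeomorph.smulOfNeZero ε hε.ne')
  have hηc : HasCompactSupport η := hχc.mul_right
  -- `∂ᵢ η = (ε (∂ᵢ χ)(ε x) xᵢ + χ(ε x) (1 - xᵢ²)) e^{-|x|²/2}`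
  have hgradi : ∀ x, (gradient η x) i = ε * (fderiv ℝ χ (ε • x) e) * (x i * E x) +
      χ (ε • x) * (E x - x i ^ 2 * E x) := by
    intro x
    have h1 : HasFDerivAt (fun x : Euc d => χ (ε • x))
        ((fderiv ℝ χ (ε • x)).comp (ε • ContinuousLinearMap.id ℝ (Euc d))) x :=
      HasFDerivAt.comp (g := (χ : Euc d → ℝ)) x ((hχ.differentiable (by simp)) (ε • x)).hasFDerivAt
        ((hasFDerivAt_id x).const_smul ε)
    have h2 : HasFDerivAt (fun x : Euc d => x i) (EuclideanSpace.proj (𝕜 := ℝ) i) x :=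
      (EuclideanSpace.proj (𝕜 := ℝ) i).hasFDerivAt
    have h3 : HasFDerivAt E (E x • -(InnerProductSpace.toDual ℝ (Euc d) x)) x :=
      ((hasGradientAt_half_norm_sq x).hasFDerivAt.neg).exp
    have h4 := h1.mul (h2.mul h3)
    have h5 : (gradient η x) i = inner ℝ (gradient η x) e := by
      rw [he, EuclideanSpace.inner_single_right]; simp
    have h6 : inner ℝ (gradient η x) e = fderiv ℝ η x e := by
      rw [← InnerProductSpace.toDual_apply_apply (𝕜 := ℝ),
        ((hηs.differentiable (by simp)) x).hasGradientAt.hasFDerivAt.fderiv]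
    rw [h5, h6, show fderiv ℝ η x = _ from h4.fderiv]
    have h7 : inner ℝ x e = x i := by rw [he, EuclideanSpace.inner_single_right]; simp
    have h8 : e i = 1 := by simp [he]
    simp [h7, h8]
    ring
  set G : ℝ → ℝ := fun s => (Real.exp s + δ)⁻¹ with hG
  set G' : ℝ → ℝ := fun s => -Real.exp s / (Real.exp s + δ) ^ 2 with hG'
  have hGpos : ∀ s, 0 < G s := fun s => by simp only [hG]; positivity
  have hGc : Continuous G := by
    simp only [hG]
    exact (Real.continuous_exp.add continuous_const).inv₀ fun s =>
      (by positivity : 0 < Real.exp s + δ).ne'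
  have hG'c : Continuous G' := by
    simp only [hG']
    exact Real.continuous_exp.neg.div ((Real.continuous_exp.add continuous_const).pow 2)
      fun s => (by positivity : 0 < (Real.exp s + δ) ^ 2).ne'
  have hGM : ∀ s, |G s| ≤ δ⁻¹ := fun s => by
    rw [abs_of_pos (hGpos s)]; exact inv_exp_add_le' hδ s
  have hG'G : ∀ s, |G' s| ≤ G s := abs_deriv_inv_exp_add_le hδ
  have hG'M : ∀ s, |G' s| ≤ δ⁻¹ := fun s => (hG'G s).trans (inv_exp_add_le' hδ s)
  have key : ∫ x, η x • G' (f x) • g x = - ∫ x, G (f x) • gradient η x :=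
    h.integral_comp (hasDerivAt_inv_exp_add hδ) hG'c hGM hG'M hηs hηc
  have hη1 : ContDiff ℝ 1 η := hηs.of_le (by exact_mod_cast le_top)
  have hfm : AEStronglyMeasurable f volume := h.1.aestronglyMeasurable
  have i1 : Integrable fun x => η x • G' (f x) • g x := by
    have h1 : Integrable fun x => η x • g x :=
      h.2.1.integrable_smul_left_of_hasCompactSupport hηs.continuous hηc
    refine (h1.bdd_smul δ⁻¹ (hG'c.comp_aestronglyMeasurable hfm)
      (ae_of_all _ fun x => hG'M (f x))).congr (ae_of_all _ fun x => ?_)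
    exact smul_comm (G' (f x)) (η x) (g x)
  have i2 : Integrable fun x => G (f x) • gradient η x := by
    have h1 : Integrable (gradient η) :=
      (continuous_gradient hη1).integrable_of_hasCompactSupport (hasCompactSupport_gradient hηc)
    exact h1.bdd_smul δ⁻¹ (hGc.comp_aestronglyMeasurable hfm)
      (ae_of_all _ fun x => hGM (f x))
  have i12 : Integrable fun x => η x • G' (f x) • g x + G (f x) • gradient η x := i1.add i2
  -- `B` is the integrand with respect to `β`
  set B : Euc d → ℝ := fun x => χ (ε • x) * x i * (G' (f x) * (g x) i) +
    G (f x) * (ε * (fderiv ℝ χ (ε • x) e) * x i + χ (ε • x) * (1 - x i ^ 2)) with hB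
  have hA : ∀ x, E x * B x = EuclideanSpace.proj (𝕜 := ℝ) i
      (η x • G' (f x) • g x + G (f x) • gradient η x) := by
    intro x
    simp only [hB, PiLp.proj_apply, PiLp.add_apply, PiLp.smul_apply, smul_eq_mul, hgradi]
    ring
  have hAi : Integrable fun x => E x * B x := by
    simp_rw [hA]
    exact (EuclideanSpace.proj (𝕜 := ℝ) i).integrable_comp i12
  have hA0 : ∫ x, E x * B x = 0 := by
    simp_rw [hA]
    rw [ContinuousLinearMap.integral_comp_comm _ i12, integral_add i1 i2, key]
    simp
  have hZ : 0 < (2 * Real.pi) ^ (-(d / 2 : ℝ)) := Real.rpow_pos_of_pos (by positivity) _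
  set Z : ℝ := (2 * Real.pi) ^ (-(d / 2 : ℝ))
  have hdens : gaussBeta d = volume.withDensity fun x => ENNReal.ofReal (Z * E x) :=
    gaussBeta_eq_withDensity d
  have hEm : Measurable fun x => ENNReal.ofReal (Z * E x) :=
    (hE'.continuous.measurable.const_mul Z).ennreal_ofReal
  have hconv : ∀ x, (ENNReal.ofReal (Z * E x)).toReal • B x = Z * (E x * B x) := by
    intro x
    rw [ENNReal.toReal_ofReal (by positivity), smul_eq_mul, mul_assoc]
  have hBi : Integrable B (gaussBeta d) := by
    rw [hdens, integrable_withDensity_iff_integrable_smul' hEm (by simp)]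
    simp_rw [hconv]
    exact hAi.const_mul Z
  have hB0 : ∫ x, B x ∂(gaussBeta d) = 0 := by
    rw [hdens, integral_withDensity_eq_integral_toReal_smul hEm (by simp)]
    simp_rw [hconv]
    rw [integral_const_mul, hA0, mul_zero]
  have hrhs : Integrable (fun x => (1 + C) * Real.exp (-f x) +
      1 / 2 * (‖g x‖ ^ 2 * Real.exp (-f x))) (gaussBeta d) :=
    (hfi.const_mul _).add (hgi.const_mul _)
  have hpt : ∀ x, 1 / 2 * (χ (ε • x) * x i ^ 2 * (Real.exp (f x) + δ)⁻¹) ≤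
      (1 + C) * Real.exp (-f x) + 1 / 2 * (‖g x‖ ^ 2 * Real.exp (-f x)) - B x := by
    intro x
    have hχ0 : 0 ≤ χ (ε • x) := χ.nonneg
    have hχ1 : χ (ε • x) ≤ 1 := χ.le_one
    have hGe : G (f x) ≤ Real.exp (-f x) := inv_exp_add_le hδ _
    have hGp := hGpos (f x)
    have hgi : (g x) i ^ 2 ≤ ‖g x‖ ^ 2 := by
      rw [sq_le_sq, abs_norm]
      exact PiLp.norm_apply_le (g x) i
    -- Young's inequality absorbs half of the second moment into the left-hand side
    have t1 : x i * (G' (f x) * (g x) i) ≤ G (f x) * (1 / 2 * x i ^ 2 + 1 / 2 * (g x) i ^ 2) := by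
      have a1 : x i * (G' (f x) * (g x) i) ≤ |G' (f x)| * (|x i| * |(g x) i|) := by
        rw [← abs_mul, ← abs_mul]
        refine (le_abs_self _).trans (le_of_eq ?_)
        congr 1; ring
      have a2 : |x i| * |(g x) i| ≤ 1 / 2 * x i ^ 2 + 1 / 2 * (g x) i ^ 2 := by
        rw [← sq_abs (x i), ← sq_abs ((g x) i)]
        nlinarith [sq_nonneg (|x i| - |(g x) i|)]
      exact a1.trans (mul_le_mul (hG'G _) a2 (by positivity) hGp.le)
    have t2 : ε * (fderiv ℝ χ (ε • x) e) * x i ≤ C := by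
      have := hC (ε • x)
      rw [Real.norm_eq_abs] at this
      refine le_trans (le_of_eq ?_) ((le_abs_self _).trans this)
      rw [PiLp.smul_apply, smul_eq_mul]; ring
    have t3 : χ (ε • x) * (x i * (G' (f x) * (g x) i)) ≤
        χ (ε • x) * (G (f x) * (1 / 2 * x i ^ 2 + 1 / 2 * (g x) i ^ 2)) :=
      mul_le_mul_of_nonneg_left t1 hχ0
    have t4 : G (f x) * (ε * (fderiv ℝ χ (ε • x) e) * x i) ≤ C * Real.exp (-f x) := by
      have hC0 : 0 ≤ C := (norm_nonneg _).trans (hC 0)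
      calc _ ≤ G (f x) * C := mul_le_mul_of_nonneg_left t2 hGp.le
        _ ≤ Real.exp (-f x) * C := mul_le_mul_of_nonneg_right hGe hC0
        _ = _ := mul_comm _ _
    have t5 : χ (ε • x) * G (f x) ≤ Real.exp (-f x) := by
      calc _ ≤ 1 * G (f x) := mul_le_mul_of_nonneg_right hχ1 hGp.le
        _ ≤ _ := by rw [one_mul]; exact hGe
    have t6 : (χ (ε • x) * G (f x)) * (g x) i ^ 2 ≤ ‖g x‖ ^ 2 * Real.exp (-f x) := by
      calc _ ≤ Real.exp (-f x) * ‖g x‖ ^ 2 :=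
            mul_le_mul t5 hgi (sq_nonneg _) (Real.exp_pos _).le
        _ = _ := mul_comm _ _
    simp only [hB]
    change 1 / 2 * (χ (ε • x) * x i ^ 2 * G (f x)) ≤ _
    nlinarith
  calc _ ≤ ∫⁻ x, ENNReal.ofReal ((1 + C) * Real.exp (-f x) +
          1 / 2 * (‖g x‖ ^ 2 * Real.exp (-f x)) - B x) ∂(gaussBeta d) :=
        lintegral_mono fun x => ENNReal.ofReal_le_ofReal (hpt x)
    _ = ENNReal.ofReal (∫ x, ((1 + C) * Real.exp (-f x) +
          1 / 2 * (‖g x‖ ^ 2 * Real.exp (-f x)) - B x) ∂(gaussBeta d)) := by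
        refine (ofReal_integral_eq_lintegral_ofReal (hrhs.sub hBi) ?_).symm
        refine ae_of_all _ fun x => le_trans ?_ (hpt x)
        have : 0 ≤ χ (ε • x) := χ.nonneg
        simp only [Pi.zero_apply]
        positivity
    _ = _ := by rw [integral_sub hrhs hBi, hB0, sub_zero]

/-- Finiteness of the Fisher information of `e^{-f} β` implies finiteness of its second moment. -/
theorem HasWeakGrad.lintegral_norm_sq_mul_exp_ne_top {d : ℕ} {f : Euc d → ℝ} {g : Euc d → Euc d}
    (h : HasWeakGrad f g) (hfi : Integrable (fun x => Real.exp (-f x)) (gaussBeta d))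
    (hgi : Integrable (fun x => ‖g x‖ ^ 2 * Real.exp (-f x)) (gaussBeta d)) :
    ∫⁻ x, ‖x‖ₑ ^ 2 * ENNReal.ofReal (Real.exp (-f x)) ∂(gaussBeta d) ≠ ⊤ := by
  have hfm : AEMeasurable f (gaussBeta d) :=
    h.1.aestronglyMeasurable.aemeasurable.mono_ac (gaussBeta_absolutelyContinuous d)
  have hcoord : ∀ i : Fin d,
      ∫⁻ x, ENNReal.ofReal (1 / 2 * (x i ^ 2 * Real.exp (-f x))) ∂(gaussBeta d) ≠ ⊤ := by
    intro i
    set χ : ContDiffBump (0 : Euc d) := ⟨1, 2, one_pos, one_lt_two⟩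
    have hχ1 : ContDiff ℝ 1 (χ : Euc d → ℝ) := χ.contDiff
    obtain ⟨C, hC⟩ : ∃ C, ∀ x : Euc d,
        ‖fderiv ℝ χ x (EuclideanSpace.single i 1) * x i‖ ≤ C := by
      have hc : Continuous fun x : Euc d => fderiv ℝ χ x (EuclideanSpace.single i 1) * x i := by
        have := hχ1.continuous_fderiv one_ne_zero
        fun_prop
      refine hc.bounded_above_of_compact_support ?_
      exact ((χ.hasCompactSupport.fderiv_apply ℝ _)).mul_right
    set u : ℕ → ℝ := fun k => 1 / (k + 1 : ℝ) with hu
    have hupos : ∀ k, 0 < u k := fun k => by simp only [hu]; positivity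
    have hulim : Tendsto u atTop (𝓝 0) := tendsto_one_div_add_atTop_nhds_zero_nat
    set K : ℝ≥0∞ := ENNReal.ofReal (∫ x, ((1 + C) * Real.exp (-f x) +
      1 / 2 * (‖g x‖ ^ 2 * Real.exp (-f x))) ∂(gaussBeta d)) with hK
    set F : ℕ → Euc d → ℝ≥0∞ := fun k x =>
      ENNReal.ofReal (1 / 2 * (χ (u k • x) * x i ^ 2 * (Real.exp (f x) + u k)⁻¹)) with hF
    have hb : ∀ k, ∫⁻ x, F k x ∂(gaussBeta d) ≤ K := fun k =>
      h.lintegral_truncated_coord_sq_le hfi hgi i χ hC (hupos k) (hupos k)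
    have hlim : ∀ x : Euc d, Tendsto (fun k => F k x) atTop
        (𝓝 (ENNReal.ofReal (1 / 2 * (x i ^ 2 * Real.exp (-f x))))) := by
      intro x
      refine (ENNReal.continuous_ofReal.tendsto _).comp (Tendsto.const_mul _ ?_)
      have l1 : Tendsto (fun k => χ (u k • x)) atTop (𝓝 1) := by
        have h1 : Tendsto (fun k => u k • x) atTop (𝓝 0) := by
          simpa using hulim.smul_const x
        have h2 := (χ.continuous.tendsto 0).comp h1
        have h3 : χ 0 = 1 := χ.one_of_mem_closedBall (by simp [χ])
        rwa [h3] at h2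
      have l2 : Tendsto (fun k => (Real.exp (f x) + u k)⁻¹) atTop (𝓝 (Real.exp (-f x))) := by
        rw [Real.exp_neg]
        have h1 := (hulim.const_add (Real.exp (f x)))
        rw [add_zero] at h1
        exact h1.inv₀ (Real.exp_pos _).ne'
      simpa using (l1.mul_const (x i ^ 2)).mul l2
    have hFm : ∀ k, AEMeasurable (F k) (gaussBeta d) := fun k => by
      have hχm : Measurable fun x : Euc d => χ (u k • x) :=
        (χ.continuous.comp (continuous_const_smul (u k))).measurable
      have hxm : AEMeasurable (fun x : Euc d => x i ^ 2) (gaussBeta d) := by fun_prop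
      exact (((hχm.aemeasurable.mul hxm).mul ((hfm.exp.add_const (u k)).inv)).const_mul
        (1 / 2)).ennreal_ofReal
    have hfat := lintegral_liminf_le' (u := atTop) hFm
    simp_rw [(hlim _).liminf_eq] at hfat
    refine ne_top_of_le_ne_top (b := K) ENNReal.ofReal_ne_top (hfat.trans ?_)
    refine (liminf_le_liminf (Eventually.of_forall hb)).trans ?_
    rw [liminf_const]
  have e : ∀ x : Euc d, ‖x‖ₑ ^ 2 * ENNReal.ofReal (Real.exp (-f x)) =
      ENNReal.ofReal 2 * ∑ i, ENNReal.ofReal (1 / 2 * (x i ^ 2 * Real.exp (-f x))) := by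
    intro x
    rw [← ofReal_norm, ← ENNReal.ofReal_pow (norm_nonneg _), ← ENNReal.ofReal_mul (by positivity),
      ← ENNReal.ofReal_sum_of_nonneg (fun i _ => by positivity), EuclideanSpace.norm_sq_eq,
      ← ENNReal.ofReal_mul (by norm_num), ← Finset.mul_sum,
      ← Finset.sum_mul]
    congr 1
    simp only [Real.norm_eq_abs, sq_abs]
    ring
  simp_rw [e]
  rw [lintegral_const_mul' _ _ (by finiteness), lintegral_finsetSum' _ (fun i _ => by fun_prop)]
  exact ENNReal.mul_ne_top (by finiteness) (ENNReal.sum_ne_top.2 fun i _ => hcoord i)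

/-! ### Moments and duality for optimal plans -/

theorem MeasureTheory.MemLp.integrable_inner_real {α E : Type*} {m : MeasurableSpace α}
    {μ : Measure α} [NormedAddCommGroup E] [InnerProductSpace ℝ E] {u v : α → E}
    (hu : MemLp u 2 μ) (hv : MemLp v 2 μ) : Integrable (fun x => (inner ℝ (u x) (v x) : ℝ)) μ := by
  rw [← memLp_one_iff_integrable]
  refine hu.of_bilin (fun x y => (inner ℝ x y : ℝ)) 1 hv (hu.1.inner hv.1) (ae_of_all _ fun x => ?_)
  rw [one_mul]
  exact abs_real_inner_le_norm (u x) (v x)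

theorem MeasureTheory.MeasurePreserving.integral_comp_of_aestronglyMeasurable {α β : Type*}
    [MeasurableSpace α] [MeasurableSpace β] {μ : Measure α} {ρ : Measure β} {w : α → β}
    {F : β → ℝ} (hw : MeasurePreserving w μ ρ) (hF : AEStronglyMeasurable F ρ) :
    ∫ q, F (w q) ∂μ = ∫ x, F x ∂ρ := by
  rw [← hw.map_eq] at hF ⊢
  rw [integral_map hw.measurable.aemeasurable hF]

theorem lintegral_enorm_inner_le {α E : Type*} {m : MeasurableSpace α}
    {μ : Measure α} [NormedAddCommGroup E] [InnerProductSpace ℝ E] {u v : α → E}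
    (hu : AEStronglyMeasurable u μ) (hv : AEStronglyMeasurable v μ) :
    ∫⁻ x, ‖(inner ℝ (u x) (v x) : ℝ)‖ₑ ∂μ ≤ eLpNorm u 2 μ * eLpNorm v 2 μ := by
  have h := eLpNorm_le_eLpNorm_mul_eLpNorm'_of_norm (p := 2) (q := 2) (r := 1) hu hv
    (fun x y => (inner ℝ x y : ℝ)) 1 (ae_of_all _ fun x => by
      simpa using abs_real_inner_le_norm (u x) (v x))
  rwa [eLpNorm_one_eq_lintegral_enorm, ENNReal.coe_one, one_mul] at h

theorem transportCost_eq {d : ℕ} (γ : Measure (Euc d × Euc d)) :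
    transportCost γ = eLpNorm (fun p => p.1 - p.2) 2 γ ^ 2 := (eLpNorm_two_sq _).symm

section OptimalPair

variable {d : ℕ} {ν : Measure (Euc d)} {a b : Euc d → ℝ} {γ : Measure (Euc d × Euc d)}

theorem IsOptimalPlan.measurePreserving_fst {μ : Measure (Euc d)} (h : IsOptimalPlan μ ν γ) :
    MeasurePreserving Prod.fst γ μ := ⟨measurable_fst, h.1.1⟩

theorem IsOptimalPlan.measurePreserving_snd {μ : Measure (Euc d)} (h : IsOptimalPlan μ ν γ) :
    MeasurePreserving Prod.snd γ ν := ⟨measurable_snd, h.1.2⟩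

namespace IsConvexPair

theorem ae_gradient_fst' (hp : IsConvexPair a b γ) (ho : IsOptimalPlan (gaussBeta d) ν γ) :
    ∀ᵐ p ∂γ, DifferentiableAt ℝ a p.1 ∧ gradient a p.1 = p.2 :=
  hp.ae_gradient_fst (ho.1.1 ▸ gaussBeta_absolutelyContinuous d)

theorem ae_gradient_snd' (hp : IsConvexPair a b γ) (ho : IsOptimalPlan (gaussBeta d) ν γ)
    (hν : ν ≪ volume) : ∀ᵐ p ∂γ, DifferentiableAt ℝ b p.2 ∧ gradient b p.2 = p.1 :=
  hp.ae_gradient_snd (ho.1.2 ▸ hν)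

/-- `∇a` transports `β` to `ν`; in particular second moments agree. -/
theorem lintegral_gradient_fst (hp : IsConvexPair a b γ) (ho : IsOptimalPlan (gaussBeta d) ν γ) :
    ∫⁻ x, ‖gradient a x‖ₑ ^ 2 ∂(gaussBeta d) = ∫⁻ y, ‖y‖ₑ ^ 2 ∂ν := by
  have hm : Measurable fun x => ‖gradient a x‖ₑ ^ 2 := (measurable_gradient a).enorm.pow_const 2
  rw [← ho.measurePreserving_fst.lintegral_comp hm,
    ← ho.measurePreserving_snd.lintegral_comp (measurable_enorm.pow_const 2)]
  refine lintegral_congr_ae ?_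
  filter_upwards [hp.ae_gradient_fst' ho] with p hp
  rw [hp.2]

theorem lintegral_gradient_snd (hp : IsConvexPair a b γ) (ho : IsOptimalPlan (gaussBeta d) ν γ)
    (hν : ν ≪ volume) :
    ∫⁻ y, ‖gradient b y‖ₑ ^ 2 ∂ν = ∫⁻ x : Euc d, ‖x‖ₑ ^ 2 ∂(gaussBeta d) := by
  have hm : Measurable fun x => ‖gradient b x‖ₑ ^ 2 := (measurable_gradient b).enorm.pow_const 2
  rw [← ho.measurePreserving_snd.lintegral_comp hm,
    ← ho.measurePreserving_fst.lintegral_comp (measurable_enorm.pow_const 2)]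
  refine lintegral_congr_ae ?_
  filter_upwards [hp.ae_gradient_snd' ho hν] with p hp
  rw [hp.2]

theorem memLp_gradient_fst (hp : IsConvexPair a b γ) (ho : IsOptimalPlan (gaussBeta d) ν γ)
    (hν : MemLp (fun y => y) 2 ν) : MemLp (gradient a) 2 (gaussBeta d) := by
  rw [memLp_two_iff_lintegral (measurable_gradient a).aestronglyMeasurable,
    hp.lintegral_gradient_fst ho]
  exact (memLp_two_iff_lintegral hν.1).1 hν

theorem memLp_gradient_snd (hp : IsConvexPair a b γ) (ho : IsOptimalPlan (gaussBeta d) ν γ)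
    (hν : ν ≪ volume) : MemLp (gradient b) 2 ν := by
  rw [memLp_two_iff_lintegral (measurable_gradient b).aestronglyMeasurable,
    hp.lintegral_gradient_snd ho hν]
  exact lintegral_enorm_sq_gaussBeta_ne_top d

theorem memLp_fst (hp : IsConvexPair a b γ) (ho : IsOptimalPlan (gaussBeta d) ν γ)
    (hν : MemLp (fun y => y) 2 ν) : MemLp a 2 (gaussBeta d) :=
  hp.convex_fst.locallyLipschitz.memLp_two_of_gradient (hp.memLp_gradient_fst ho hν)

theorem integrable_inner (ho : IsOptimalPlan (gaussBeta d) ν γ)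
    (hν : MemLp (fun y => y) 2 ν) : Integrable (fun p => (inner ℝ p.1 p.2 : ℝ)) γ :=
  ((memLp_id_gaussBeta d).comp_measurePreserving
    ho.measurePreserving_fst).integrable_inner_real
      (hν.comp_measurePreserving ho.measurePreserving_snd)

theorem integrable_fst (hp : IsConvexPair a b γ) (ho : IsOptimalPlan (gaussBeta d) ν γ)
    (hν : MemLp (fun y => y) 2 ν) : Integrable a (gaussBeta d) :=
  (hp.memLp_fst ho hν).integrable one_le_two

theorem integrable_snd (hp : IsConvexPair a b γ) (ho : IsOptimalPlan (gaussBeta d) ν γ)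
    (hν : MemLp (fun y => y) 2 ν) : Integrable b ν := by
  have h1 : Integrable (fun p => (inner ℝ p.1 p.2 : ℝ) - a p.1) γ :=
    (integrable_inner ho hν).sub
      ((ho.measurePreserving_fst.integrable_comp (hp.integrable_fst ho hν).1).2
        (hp.integrable_fst ho hν))
  have h2 : Integrable (b ∘ Prod.snd) γ := by
    refine h1.congr ?_
    filter_upwards [hp.ae_eq] with p hp
    simp only [Function.comp_apply]
    linarith
  exact (ho.measurePreserving_snd.integrable_comp hp.continuous_snd.aestronglyMeasurable).1 h2

theorem integral_add_integral (hp : IsConvexPair a b γ) (ho : IsOptimalPlan (gaussBeta d) ν γ)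
    (hν : MemLp (fun y => y) 2 ν) :
    ∫ x, a x ∂(gaussBeta d) + ∫ y, b y ∂ν = ∫ p, (inner ℝ p.1 p.2 : ℝ) ∂γ := by
  have ha := hp.integrable_fst ho hν
  have hb := hp.integrable_snd ho hν
  have ia : Integrable (fun p => a p.1) γ := (ho.measurePreserving_fst.integrable_comp ha.1).2 ha
  have ib : Integrable (fun p => b p.2) γ := (ho.measurePreserving_snd.integrable_comp hb.1).2 hb
  rw [← ho.measurePreserving_fst.integral_comp_of_aestronglyMeasurable ha.1,
    ← ho.measurePreserving_snd.integral_comp_of_aestronglyMeasurable hb.1, ← integral_add ia ib]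
  exact integral_congr_ae hp.ae_eq

end IsConvexPair

/-- Expansion of the square in the transport cost between fixed marginals. -/
theorem integral_inner_eq_sub_sq {Ω : Type*} [MeasurableSpace Ω] {P : Measure Ω}
    {u v : Ω → Euc d} (hu : MemLp u 2 P) (hv : MemLp v 2 P) :
    2 * ∫ q, (inner ℝ (u q) (v q) : ℝ) ∂P = ∫ q, ‖u q‖ ^ 2 ∂P + ∫ q, ‖v q‖ ^ 2 ∂P -
      (eLpNorm (fun q => u q - v q) 2 P).toReal ^ 2 := by
  have hs : Integrable (fun q => ‖u q - v q‖ ^ 2) P := (hu.sub hv).integrable_norm_pow two_ne_zero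
  have hu2 : Integrable (fun q => ‖u q‖ ^ 2) P := hu.integrable_norm_pow two_ne_zero
  have hv2 : Integrable (fun q => ‖v q‖ ^ 2) P := hv.integrable_norm_pow two_ne_zero
  have h1 := integral_norm_sq_eq (hu.sub hv).1
  simp only [Pi.sub_apply] at h1
  have hadd : Integrable (fun q => ‖u q‖ ^ 2 + ‖v q‖ ^ 2) P := hu2.add hv2
  change _ = _ - (eLpNorm (u - v) 2 P).toReal ^ 2
  rw [← h1, ← integral_const_mul, ← integral_add hu2 hv2, ← integral_sub hadd hs]
  refine integral_congr_ae (ae_of_all _ fun q => ?_)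
  simp only
  have := norm_sub_sq_real (u q) (v q)
  linarith

/-- The duality gap integrated along an arbitrary coupling `(u, v)` of `β` and `ν` is half the
excess of the cost of `(u, v)` over the optimal cost. -/
theorem integral_sub_inner_eq {Ω : Type*} [MeasurableSpace Ω] {P : Measure Ω}
    {u v : Ω → Euc d} (hu : MeasurePreserving u P (gaussBeta d)) (hv : MeasurePreserving v P ν)
    (hp : IsConvexPair a b γ) (ho : IsOptimalPlan (gaussBeta d) ν γ)
    (hν : MemLp (fun y => y) 2 ν) :
    Integrable (fun q => a (u q) + b (v q) - inner ℝ (u q) (v q)) P ∧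
    2 * ∫ q, (a (u q) + b (v q) - inner ℝ (u q) (v q)) ∂P =
      (eLpNorm (fun q => u q - v q) 2 P).toReal ^ 2 -
        (eLpNorm (fun p => p.1 - p.2) 2 γ).toReal ^ 2 := by
  have ha := hp.integrable_fst ho hν
  have hb := hp.integrable_snd ho hν
  have ia : Integrable (fun q => a (u q)) P := (hu.integrable_comp ha.1).2 ha
  have ib : Integrable (fun q => b (v q)) P := (hv.integrable_comp hb.1).2 hb
  have mu : MemLp u 2 P := (memLp_id_gaussBeta d).comp_measurePreserving hu
  have mv : MemLp v 2 P := hν.comp_measurePreserving hv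
  have ii := mu.integrable_inner_real mv
  refine ⟨(ia.add ib).sub ii, ?_⟩
  have m1 : MemLp (fun p : Euc d × Euc d => p.1) 2 γ :=
    (memLp_id_gaussBeta d).comp_measurePreserving ho.measurePreserving_fst
  have m2 : MemLp (fun p : Euc d × Euc d => p.2) 2 γ :=
    hν.comp_measurePreserving ho.measurePreserving_snd
  have e1 := integral_inner_eq_sub_sq mu mv
  have e2 := integral_inner_eq_sub_sq m1 m2
  have e3 := hp.integral_add_integral ho hν
  have hsq : AEStronglyMeasurable (fun x : Euc d => ‖x‖ ^ 2) (gaussBeta d) :=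
    (by fun_prop : Continuous fun x : Euc d => ‖x‖ ^ 2).aestronglyMeasurable
  have hsq' : AEStronglyMeasurable (fun x : Euc d => ‖x‖ ^ 2) ν :=
    (by fun_prop : Continuous fun x : Euc d => ‖x‖ ^ 2).aestronglyMeasurable
  have iab : Integrable (fun q => a (u q) + b (v q)) P := ia.add ib
  rw [integral_sub iab ii, integral_add ia ib, hu.integral_comp_of_aestronglyMeasurable ha.1,
    hv.integral_comp_of_aestronglyMeasurable hb.1]
  rw [hu.integral_comp_of_aestronglyMeasurable hsq,
    hv.integral_comp_of_aestronglyMeasurable hsq'] at e1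
  rw [ho.measurePreserving_fst.integral_comp_of_aestronglyMeasurable hsq,
    ho.measurePreserving_snd.integral_comp_of_aestronglyMeasurable hsq'] at e2
  linarith

end OptimalPair

/-! ### Stability of transport maps under Ornstein–Uhlenbeck regularisation -/

section OrnsteinUhlenbeckLaw

variable {d : ℕ} {ν : Measure (Euc d)}

/-- The law of `e^{-t} Y + √(1 - e^{-2t}) Z`, where `Y ∼ ν` and `Z ∼ β` are independent. -/
noncomputable def ouLaw (ν : Measure (Euc d)) (t : ℝ) : Measure (Euc d) :=
  (ν.prod (gaussBeta d)).map (ouMap t)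

/-- The `L²` distance between `Y` and `e^{-t} Y + √(1 - e^{-2t}) Z`. -/
noncomputable def ouDist (ν : Measure (Euc d)) (t : ℝ) : ℝ≥0∞ :=
  eLpNorm (fun p => ouMap t p - p.1) 2 (ν.prod (gaussBeta d))

theorem measurePreserving_ouMap (ν : Measure (Euc d)) (t : ℝ) :
    MeasurePreserving (ouMap t) (ν.prod (gaussBeta d)) (ouLaw ν t) :=
  ⟨measurable_ouMap t, rfl⟩

theorem memLp_fst_prod [IsProbabilityMeasure ν] (hν : MemLp (fun y => y) 2 ν) :
    MemLp (fun p : Euc d × Euc d => p.1) 2 (ν.prod (gaussBeta d)) :=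
  hν.comp_measurePreserving measurePreserving_fst

theorem memLp_snd_prod [IsProbabilityMeasure ν] :
    MemLp (fun p : Euc d × Euc d => p.2) 2 (ν.prod (gaussBeta d)) :=
  (memLp_id_gaussBeta d).comp_measurePreserving measurePreserving_snd

theorem memLp_ouMap [IsProbabilityMeasure ν] (hν : MemLp (fun y => y) 2 ν) (t : ℝ) :
    MemLp (ouMap t) 2 (ν.prod (gaussBeta d)) := by
  have h1 : MemLp (fun p : Euc d × Euc d => Real.exp (-t) • p.1) 2 (ν.prod (gaussBeta d)) :=
    (memLp_fst_prod hν).const_smul (Real.exp (-t))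
  have h2 : MemLp (fun p : Euc d × Euc d => Real.sqrt (1 - Real.exp (-2 * t)) • p.2) 2
      (ν.prod (gaussBeta d)) := memLp_snd_prod.const_smul (Real.sqrt (1 - Real.exp (-2 * t)))
  exact h1.add h2

theorem memLp_ouLaw [IsProbabilityMeasure ν] (hν : MemLp (fun y => y) 2 ν) (t : ℝ) :
    MemLp (fun y => y) 2 (ouLaw ν t) :=
  (memLp_map_measure_iff (by fun_prop) (measurable_ouMap t).aemeasurable).2 (memLp_ouMap hν t)

theorem ouDist_ne_top [IsProbabilityMeasure ν] (hν : MemLp (fun y => y) 2 ν) (t : ℝ) :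
    ouDist ν t ≠ ⊤ := ((memLp_ouMap hν t).sub (memLp_fst_prod hν)).eLpNorm_ne_top

theorem tendsto_ouDist [IsProbabilityMeasure ν] (hν : MemLp (fun y => y) 2 ν) {t : ℕ → ℝ}
    (ht : Tendsto t atTop (𝓝 0)) : Tendsto (fun n => ouDist ν (t n)) atTop (𝓝 0) := by
  set P := ν.prod (gaussBeta d)
  have h1 : ∀ s, ouDist ν s ≤ ‖Real.exp (-s) - 1‖ₑ * eLpNorm (fun p : Euc d × Euc d => p.1) 2 P +
      ‖Real.sqrt (1 - Real.exp (-2 * s))‖ₑ * eLpNorm (fun p : Euc d × Euc d => p.2) 2 P := by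
    intro s
    have e : (fun p : Euc d × Euc d => ouMap s p - p.1) =
        (Real.exp (-s) - 1) • (fun p : Euc d × Euc d => p.1) +
          Real.sqrt (1 - Real.exp (-2 * s)) • (fun p : Euc d × Euc d => p.2) := by
      funext p
      simp only [ouMap, Pi.add_apply, Pi.smul_apply]
      module
    rw [ouDist, e, ← eLpNorm_const_smul, ← eLpNorm_const_smul]
    exact eLpNorm_add_le (by fun_prop) (by fun_prop) one_le_two
  have c1 : Continuous fun s : ℝ => ‖Real.exp (-s) - 1‖ₑ := by fun_prop
  have c2 : Continuous fun s : ℝ => ‖Real.sqrt (1 - Real.exp (-2 * s))‖ₑ := by fun_prop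
  have l1 := ENNReal.Tendsto.mul_const ((c1.tendsto 0).comp ht)
    (Or.inr (memLp_fst_prod hν).eLpNorm_ne_top)
  have l2 := ENNReal.Tendsto.mul_const ((c2.tendsto 0).comp ht)
    (Or.inr (memLp_snd_prod (ν := ν)).eLpNorm_ne_top)
  have l3 := l1.add l2
  simp only [neg_zero, Real.exp_zero, sub_self, enorm_zero, mul_zero, Real.sqrt_zero, zero_mul,
    add_zero] at l3
  exact tendsto_of_tendsto_of_tendsto_of_le_of_le tendsto_const_nhds l3 (fun _ => zero_le)
    fun n => h1 (t n)

/-- The optimal cost between `β` and `ν` exceeds the one between `β` and the law `ouLaw ν t` by at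
most the distance `ouDist ν t`: glue a plan for the latter with the canonical coupling. -/
theorem IsOptimalPlan.eLpNorm_le_add_ouDist [IsProbabilityMeasure ν]
    {γ γ' : Measure (Euc d × Euc d)} (ho : IsOptimalPlan (gaussBeta d) ν γ) {t : ℝ}
    (ho' : IsOptimalPlan (gaussBeta d) (ouLaw ν t) γ') :
    eLpNorm (fun p => p.1 - p.2) 2 γ ≤ eLpNorm (fun p => p.1 - p.2) 2 γ' + ouDist ν t := by
  have hγ' := ho'.isProbabilityMeasure
  have hm := measurable_ouMap (d := d) t
  set η : Measure (Euc d × Euc d) := (ν.prod (gaussBeta d)).map fun p => (ouMap t p, p.1) with hη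
  have hηm : Measurable fun p : Euc d × Euc d => (ouMap t p, p.1) := by fun_prop
  have : IsProbabilityMeasure η := Measure.isProbabilityMeasure_map hηm.aemeasurable
  have hmatch : γ'.map Prod.snd = η.map Prod.fst := by
    rw [ho'.1.2, hη, Measure.map_map measurable_fst hηm]; rfl
  obtain ⟨π, hπ, h1, h2⟩ := exists_glued_plan hmatch
  have m1 : Measurable fun q : (Euc d × Euc d) × Euc d => (q.1.1, q.2) := by fun_prop
  have m2 : Measurable fun q : (Euc d × Euc d) × Euc d => (q.1.2, q.2) := by fun_prop
  have hmem : π.map (fun q => (q.1.1, q.2)) ∈ couplings (gaussBeta d) ν := by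
    constructor
    · rw [Measure.map_map measurable_fst m1, ← ho'.1.1, ← h1,
        Measure.map_map measurable_fst measurable_fst]
      rfl
    · have e : η.map Prod.snd = ν := by
        rw [hη, Measure.map_map measurable_snd hηm]
        exact (MeasureTheory.measurePreserving_fst (μ := ν) (ν := gaussBeta d)).map_eq
      rw [Measure.map_map measurable_snd m1, ← e, ← h2, Measure.map_map measurable_snd m2]
      rfl
  have hle := ho.2 _ hmem
  rw [transportCost_eq, transportCost_eq, ENNReal.pow_le_pow_left_iff two_ne_zero] at hle
  refine hle.trans ?_
  rw [eLpNorm_map_measure (by fun_prop) m1.aemeasurable]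
  have e1 : eLpNorm (fun p : Euc d × Euc d => p.1 - p.2) 2 γ' =
      eLpNorm (fun q : (Euc d × Euc d) × Euc d => q.1.1 - q.1.2) 2 π := by
    rw [← h1, eLpNorm_map_measure (by fun_prop) measurable_fst.aemeasurable]; rfl
  have e2 : ouDist ν t = eLpNorm (fun q : (Euc d × Euc d) × Euc d => q.1.2 - q.2) 2 π := by
    have : ouDist ν t = eLpNorm (fun p : Euc d × Euc d => p.1 - p.2) 2 η := by
      rw [hη, eLpNorm_map_measure (by fun_prop) hηm.aemeasurable]; rfl
    rw [this, ← h2, eLpNorm_map_measure (by fun_prop) m2.aemeasurable]; rfl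
  rw [e1, e2]
  refine le_trans (le_of_eq ?_) (eLpNorm_add_le (by fun_prop) (by fun_prop) one_le_two)
  congr 1
  funext q
  simp

end OrnsteinUhlenbeckLaw

/-- Convex potentials and optimal plans between `β` and the regularised measures `ouLaw ν (t n)`,
along a sequence of times tending to `0`. -/
structure IsOUFamily {d : ℕ} (ν : Measure (Euc d)) (t : ℕ → ℝ) (a b : ℕ → Euc d → ℝ)
    (γ : ℕ → Measure (Euc d × Euc d)) : Prop where
  tendsto : Tendsto t atTop (𝓝 0)
  pair : ∀ n, IsConvexPair (a n) (b n) (γ n)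
  optimal : ∀ n, IsOptimalPlan (gaussBeta d) (ouLaw ν (t n)) (γ n)
  ac : ∀ n, ouLaw ν (t n) ≪ volume

/-- The duality gap of the potentials `(a, b)` at the point `(x, e^{-t} y + √(1 - e^{-2t}) z)`. -/
noncomputable def ouGap {d : ℕ} (t : ℝ) (a b : Euc d → ℝ) (q : (Euc d × Euc d) × Euc d) : ℝ :=
  a q.1.1 + b (ouMap t (q.1.2, q.2)) - inner ℝ q.1.1 (ouMap t (q.1.2, q.2))

section Stability

variable {d : ℕ} {ν : Measure (Euc d)} {a b : Euc d → ℝ}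
  {γ : Measure (Euc d × Euc d)} {t : ℕ → ℝ} {an bn : ℕ → Euc d → ℝ}
  {γn : ℕ → Measure (Euc d × Euc d)}

theorem IsOUFamily.comp (F : IsOUFamily ν t an bn γn) {ns : ℕ → ℕ} (hns : Tendsto ns atTop atTop) :
    IsOUFamily ν (t ∘ ns) (an ∘ ns) (bn ∘ ns) (γn ∘ ns) :=
  ⟨F.tendsto.comp hns, fun _ => F.pair _, fun _ => F.optimal _, fun _ => F.ac _⟩

theorem IsOptimalPlan.measurePreserving_prod (ho : IsOptimalPlan (gaussBeta d) ν γ) :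
    MeasurePreserving (fun q : (Euc d × Euc d) × Euc d => (q.1.2, q.2))
      (γ.prod (gaussBeta d)) (ν.prod (gaussBeta d)) := by
  have := ho.isProbabilityMeasure
  exact ho.measurePreserving_snd.prod (MeasurePreserving.id _)

theorem IsOptimalPlan.measurePreserving_prod_fst (ho : IsOptimalPlan (gaussBeta d) ν γ) :
    MeasurePreserving (fun q : (Euc d × Euc d) × Euc d => q.1.1)
      (γ.prod (gaussBeta d)) (gaussBeta d) := by
  have := ho.isProbabilityMeasure
  exact ho.measurePreserving_fst.comp MeasureTheory.measurePreserving_fst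

theorem ouGap_nonneg {t : ℝ} (hp : IsConvexPair a b γ) (q : (Euc d × Euc d) × Euc d) :
    0 ≤ ouGap t a b q := by
  have := hp.inner_le q.1.1 (ouMap t (q.1.2, q.2))
  simp only [ouGap]; linarith

theorem measurable_ouGap {t : ℝ} (hp : IsConvexPair a b γ) : Measurable (ouGap t a b) := by
  have h1 := hp.continuous_fst
  have h2 := hp.continuous_snd
  have h3 := continuous_ouMap (d := d) t
  exact (by unfold ouGap; fun_prop : Continuous (ouGap t a b)).measurable

/-- Where the duality gap tends to `0`, the maps `∇aₙ` and `∇bₙ` converge almost everywhere. -/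
theorem IsOUFamily.ae_tendsto_gradient (F : IsOUFamily ν t an bn γn) (hp : IsConvexPair a b γ)
    (ho : IsOptimalPlan (gaussBeta d) ν γ) (hν : ν ≪ volume) (hν' : volume ≪ ν)
    (hD : ∀ᵐ q ∂(γ.prod (gaussBeta d)),
      Tendsto (fun n => ouGap (t n) (an n) (bn n) q) atTop (𝓝 0)) :
    (∀ᵐ x ∂(gaussBeta d), Tendsto (fun n => gradient (an n) x) atTop (𝓝 (gradient a x))) ∧
    ∀ᵐ p ∂(ν.prod (gaussBeta d)),
      Tendsto (fun n => gradient (bn n) (ouMap (t n) p)) atTop (𝓝 (gradient b p.1)) := by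
  have hγ := ho.isProbabilityMeasure
  set P := γ.prod (gaussBeta d)
  have hgood : ∀ᵐ q ∂P, a q.1.1 + b q.1.2 = inner ℝ q.1.1 q.1.2 ∧
      Tendsto (fun n => ouGap (t n) (an n) (bn n) q) atTop (𝓝 0) :=
    ((measurePreserving_fst (μ := γ) (ν := gaussBeta d)).quasiMeasurePreserving.ae hp.ae_eq).and hD
  -- points with vanishing gap are dense in both variables
  have hex : ∀ (μ : Measure (Euc d)) (f : (Euc d × Euc d) × Euc d → Euc d),
      MeasurePreserving f P μ → volume ≪ μ → ∀ U : Set (Euc d), IsOpen U → U.Nonempty →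
      ∃ q, f q ∈ U ∧ a q.1.1 + b q.1.2 = inner ℝ q.1.1 q.1.2 ∧
        Tendsto (fun n => ouGap (t n) (an n) (bn n) q) atTop (𝓝 0) := by
    intro μ f hf hμ U hU hne
    have h1 : P (f ⁻¹' U) ≠ 0 := by
      rw [hf.measure_preimage hU.measurableSet.nullMeasurableSet]
      exact fun h => (hU.measure_pos volume hne).ne' (hμ h)
    have h2 : ∃ᵐ q ∂P, f q ∈ U := frequently_ae_iff.2 h1
    exact (h2.and_eventually hgood).exists
  have hw : ∀ q : (Euc d × Euc d) × Euc d,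
      Tendsto (fun n => ouMap (t n) (q.1.2, q.2)) atTop (𝓝 q.1.2) := fun q =>
    tendsto_ouMap F.tendsto (q.1.2, q.2)
  constructor
  · have h1 : ∀ᵐ x ∂(gaussBeta d), DifferentiableAt ℝ a x :=
      (gaussBeta_absolutelyContinuous d).ae_le
        hp.convex_fst.locallyLipschitz.ae_differentiableAt_real
    have h2 : ∀ᵐ x ∂(gaussBeta d), ∀ n, DifferentiableAt ℝ (an n) x ∧
        an n x + bn n (gradient (an n) x) = inner ℝ x (gradient (an n) x) := by
      rw [ae_all_iff]
      intro n
      have := (F.pair n).ae_fst ((F.optimal n).1.1 ▸ gaussBeta_absolutelyContinuous d)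
      rwa [(F.optimal n).1.1] at this
    filter_upwards [h1, h2] with x hx hxn
    refine tendsto_of_subgradient_bounds hx.hasGradientAt fun U hU hne => ?_
    obtain ⟨q, hqU, hq, hqD⟩ := hex _ _ ho.measurePreserving_prod_fst
      (absolutelyContinuous_gaussBeta d) U hU hne
    refine ⟨q.1.1, hqU, q.1.2, fun z => ?_, fun _ => q.1.1 - x,
      fun n => inner ℝ (q.1.1 - x) (ouMap (t n) (q.1.2, q.2)) + ouGap (t n) (an n) (bn n) q,
      tendsto_const_nhds, ?_, fun n => ?_⟩
    · have := hp.inner_le z q.1.2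
      rw [inner_sub_left]
      linarith
    · simpa using ((tendsto_const_nhds (x := q.1.1 - x)).inner (hw q)).add hqD
    · have e1 := (F.pair n).inner_le q.1.1 (gradient (an n) x)
      have e2 := (F.pair n).inner_le x (ouMap (t n) (q.1.2, q.2))
      have e3 := (hxn n).2
      simp only [ouGap, inner_sub_left]
      linarith
  · have hbn : ∀ᵐ p ∂(ν.prod (gaussBeta d)), DifferentiableAt ℝ b p.1 :=
      (measurePreserving_fst (μ := ν) (ν := gaussBeta d)).quasiMeasurePreserving.ae
        (hν.ae_le hp.convex_snd.locallyLipschitz.ae_differentiableAt_real)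
    have h2 : ∀ᵐ p ∂(ν.prod (gaussBeta d)), ∀ n,
        an n (gradient (bn n) (ouMap (t n) p)) + bn n (ouMap (t n) p) =
          inner ℝ (gradient (bn n) (ouMap (t n) p)) (ouMap (t n) p) := by
      rw [ae_all_iff]
      intro n
      have h := (F.pair n).ae_snd ((F.optimal n).1.2 ▸ F.ac n)
      rw [(F.optimal n).1.2] at h
      filter_upwards [(measurePreserving_ouMap ν (t n)).quasiMeasurePreserving.ae h] with p hp
      exact hp.2
    have hsnd : MeasurePreserving (fun q : (Euc d × Euc d) × Euc d => q.1.2) P ν :=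
      ho.measurePreserving_snd.comp measurePreserving_fst
    filter_upwards [hbn, h2] with p hpb hpn
    refine tendsto_of_subgradient_bounds hpb.hasGradientAt fun U hU hne => ?_
    obtain ⟨q, hqU, hq, hqD⟩ := hex _ _ hsnd hν' U hU hne
    have hwp := tendsto_ouMap F.tendsto p
    refine ⟨q.1.2, hqU, q.1.1, fun z => ?_,
      fun n => ouMap (t n) (q.1.2, q.2) - ouMap (t n) p,
      fun n => inner ℝ (ouMap (t n) (q.1.2, q.2) - ouMap (t n) p) q.1.1 +
        ouGap (t n) (an n) (bn n) q,
      (hw q).sub hwp, ?_, fun n => ?_⟩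
    · have := hp.inner_le q.1.1 z
      rw [inner_sub_left, real_inner_comm, real_inner_comm _ q.1.2]
      linarith
    · simpa using (((hw q).sub hwp).inner (tendsto_const_nhds (x := q.1.1))).add hqD
    · have e1 := (F.pair n).inner_le (gradient (bn n) (ouMap (t n) p)) (ouMap (t n) (q.1.2, q.2))
      have e2 := (F.pair n).inner_le q.1.1 (ouMap (t n) p)
      have e3 := hpn n
      have c1 := real_inner_comm (ouMap (t n) (q.1.2, q.2)) (gradient (bn n) (ouMap (t n) p))
      have c2 := real_inner_comm (ouMap (t n) p) (gradient (bn n) (ouMap (t n) p))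
      have c3 := real_inner_comm (ouMap (t n) (q.1.2, q.2)) q.1.1
      have c4 := real_inner_comm (ouMap (t n) p) q.1.1
      simp only [ouGap, inner_sub_left]
      linarith

variable [IsProbabilityMeasure ν]

/-- The optimal cost is stable under regularisation, hence the duality gap of the regularised
potentials tends to `0` in `L¹`. -/
theorem IsOUFamily.tendsto_lintegral_ouGap (F : IsOUFamily ν t an bn γn)
    (ho : IsOptimalPlan (gaussBeta d) ν γ) (hν : MemLp (fun y => y) 2 ν) :
    Tendsto (fun n => ∫⁻ q, ‖ouGap (t n) (an n) (bn n) q‖ₑ ∂(γ.prod (gaussBeta d))) atTop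
      (𝓝 0) := by
  set P := γ.prod (gaussBeta d)
  have hγ := ho.isProbabilityMeasure
  have mu := ho.measurePreserving_prod_fst
  have mv : ∀ s, MeasurePreserving (fun q : (Euc d × Euc d) × Euc d => ouMap s (q.1.2, q.2)) P
      (ouLaw ν s) := fun s => (measurePreserving_ouMap ν s).comp ho.measurePreserving_prod
  have mxy : MemLp (fun p : Euc d × Euc d => p.1 - p.2) 2 γ :=
    ((memLp_id_gaussBeta d).comp_measurePreserving ho.measurePreserving_fst).sub
      (hν.comp_measurePreserving ho.measurePreserving_snd)
  set C : ℝ := (eLpNorm (fun p : Euc d × Euc d => p.1 - p.2) 2 γ).toReal with hC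
  have hbound : ∀ n, ∫⁻ q, ‖ouGap (t n) (an n) (bn n) q‖ₑ ∂P ≤
      ENNReal.ofReal (2 * (ouDist ν (t n)).toReal * (C + (ouDist ν (t n)).toReal)) := by
    intro n
    obtain ⟨hi, heq⟩ := integral_sub_inner_eq mu (mv (t n)) (F.pair n) (F.optimal n)
      (memLp_ouLaw hν (t n))
    have e0 : ∫⁻ q, ‖ouGap (t n) (an n) (bn n) q‖ₑ ∂P =
        ENNReal.ofReal (∫ q, ouGap (t n) (an n) (bn n) q ∂P) := by
      refine Eq.trans ?_ (ofReal_integral_eq_lintegral_ofReal hi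
        (ae_of_all _ (ouGap_nonneg (F.pair n)))).symm
      exact lintegral_congr fun q => Real.enorm_of_nonneg (ouGap_nonneg (F.pair n) q)
    rw [e0]
    refine ENNReal.ofReal_le_ofReal ?_
    set δ := (ouDist ν (t n)).toReal with hδ
    have hδ0 : 0 ≤ δ := ENNReal.toReal_nonneg
    have hδt := ouDist_ne_top hν (t n)
    have mxyn : MemLp (fun p : Euc d × Euc d => p.1 - p.2) 2 (γn n) :=
      ((memLp_id_gaussBeta d).comp_measurePreserving (F.optimal n).measurePreserving_fst).sub
        ((memLp_ouLaw hν (t n)).comp_measurePreserving (F.optimal n).measurePreserving_snd)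
    set Cn : ℝ := (eLpNorm (fun p : Euc d × Euc d => p.1 - p.2) 2 (γn n)).toReal with hCn
    have h1 : C ≤ Cn + δ := by
      rw [hC, hCn, hδ, ← ENNReal.toReal_add mxyn.eLpNorm_ne_top hδt]
      exact ENNReal.toReal_mono (by have := mxyn.eLpNorm_ne_top; finiteness)
        (ho.eLpNorm_le_add_ouDist (F.optimal n))
    set A : ℝ := (eLpNorm (fun q : (Euc d × Euc d) × Euc d =>
      q.1.1 - ouMap (t n) (q.1.2, q.2)) 2 P).toReal with hA
    have h2 : A ≤ C + δ := by
      rw [hA, hC, hδ, ← ENNReal.toReal_add mxy.eLpNorm_ne_top hδt]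
      refine ENNReal.toReal_mono (by have := mxy.eLpNorm_ne_top; finiteness) ?_
      have e1 : eLpNorm (fun p : Euc d × Euc d => p.1 - p.2) 2 γ =
          eLpNorm (fun q : (Euc d × Euc d) × Euc d => q.1.1 - q.1.2) 2 P :=
        (eLpNorm_comp_measurePreserving (g := fun p : Euc d × Euc d => p.1 - p.2)
          (by fun_prop) (measurePreserving_fst (μ := γ) (ν := gaussBeta d))).symm
      have e2 : ouDist ν (t n) = eLpNorm (fun q : (Euc d × Euc d) × Euc d =>
          ouMap (t n) (q.1.2, q.2) - q.1.2) 2 P :=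
        (eLpNorm_comp_measurePreserving (g := fun p : Euc d × Euc d => ouMap (t n) p - p.1)
          (by have := continuous_ouMap (d := d) (t n); fun_prop) ho.measurePreserving_prod).symm
      have hcm := continuous_ouMap (d := d) (t n)
      rw [e1, e2]
      refine le_trans (le_of_eq ?_) (eLpNorm_sub_le (by fun_prop) (by fun_prop) one_le_two)
      congr 1
      funext q
      simp only [Pi.sub_apply]
      abel
    have hA0 : 0 ≤ A := ENNReal.toReal_nonneg
    have hC0 : 0 ≤ C := ENNReal.toReal_nonneg
    have hCn0 : 0 ≤ Cn := ENNReal.toReal_nonneg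
    change ∫ q, (an n q.1.1 + bn n (ouMap (t n) (q.1.2, q.2)) -
      inner ℝ q.1.1 (ouMap (t n) (q.1.2, q.2))) ∂P ≤ _
    have h3 : A ^ 2 - Cn ^ 2 ≤ 4 * δ * (C + δ) := by
      rcases le_total A Cn with h | h
      · have : A ^ 2 ≤ Cn ^ 2 := by gcongr
        nlinarith [mul_nonneg hδ0 hC0]
      · nlinarith [mul_nonneg hδ0 hC0, mul_nonneg (sub_nonneg.2 h) hδ0]
    linarith
  have hlim : Tendsto (fun n => ENNReal.ofReal
      (2 * (ouDist ν (t n)).toReal * (C + (ouDist ν (t n)).toReal))) atTop (𝓝 0) := by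
    have h1 : Tendsto (fun n => (ouDist ν (t n)).toReal) atTop (𝓝 0) := by
      have := (ENNReal.tendsto_toReal ENNReal.zero_ne_top).comp (tendsto_ouDist hν F.tendsto)
      simpa [Function.comp_def] using this
    have h2 := ((h1.const_mul 2).mul (h1.const_add C))
    have h3 := (ENNReal.continuous_ofReal.tendsto _).comp h2
    simpa [Function.comp_def] using h3
  exact tendsto_of_tendsto_of_tendsto_of_le_of_le tendsto_const_nhds hlim (fun _ => zero_le) hbound

/-- Along a subsequence, the transport maps of the regularised problems converge in `L²`. -/
theorem IsOUFamily.exists_subseq_tendsto (F : IsOUFamily ν t an bn γn) (hp : IsConvexPair a b γ)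
    (ho : IsOptimalPlan (gaussBeta d) ν γ) (hν : ν ≪ volume) (hν' : volume ≪ ν)
    (hν2 : MemLp (fun y => y) 2 ν) :
    ∃ ms : ℕ → ℕ,
      Tendsto (fun k => ∫⁻ x, ‖gradient (an (ms k)) x - gradient a x‖ₑ ^ 2 ∂(gaussBeta d))
        atTop (𝓝 0) ∧
      Tendsto (fun k => ∫⁻ p, ‖gradient (bn (ms k)) (ouMap (t (ms k)) p) - gradient b p.1‖ₑ ^ 2
        ∂(ν.prod (gaussBeta d))) atTop (𝓝 0) := by
  have hγ := ho.isProbabilityMeasure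
  have h1 : TendstoInMeasure (γ.prod (gaussBeta d)) (fun n => ouGap (t n) (an n) (bn n))
      atTop 0 := by
    refine tendstoInMeasure_of_tendsto_eLpNorm (p := 1) one_ne_zero
      (fun n => (measurable_ouGap (F.pair n)).aestronglyMeasurable) aestronglyMeasurable_zero ?_
    simp_rw [sub_zero, eLpNorm_one_eq_lintegral_enorm]
    exact F.tendsto_lintegral_ouGap ho hν2
  obtain ⟨ms, hms, hD⟩ := h1.exists_seq_tendsto_ae
  have F' := F.comp hms.tendsto_atTop
  obtain ⟨hT, hS⟩ := F'.ae_tendsto_gradient hp ho hν hν' hD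
  refine ⟨ms, ?_, ?_⟩
  · have hfin := (memLp_two_iff_lintegral (hp.memLp_gradient_fst ho hν2).1).1
      (hp.memLp_gradient_fst ho hν2)
    refine tendsto_lintegral_enorm_sub_pow 2 (fun n => (measurable_gradient _).aestronglyMeasurable)
      (measurable_gradient _).aestronglyMeasurable hT hfin
      (A := fun k => (eLpNorm (fun y => y) 2 ν + ouDist ν (t (ms k))) ^ 2) (fun k => ?_) ?_
      two_ne_zero
    · rw [(F.pair (ms k)).lintegral_gradient_fst (F.optimal (ms k)), ← eLpNorm_two_sq, ouLaw,
        eLpNorm_map_measure (by fun_prop) (measurable_ouMap _).aemeasurable]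
      gcongr
      have e : eLpNorm (fun y => y) 2 ν =
          eLpNorm (fun p : Euc d × Euc d => p.1) 2 (ν.prod (gaussBeta d)) :=
        (eLpNorm_comp_measurePreserving (g := fun y : Euc d => y) (by fun_prop)
          (measurePreserving_fst (μ := ν) (ν := gaussBeta d))).symm
      have hcm := continuous_ouMap (d := d) (t (ms k))
      rw [e, ouDist]
      refine le_trans (le_of_eq ?_) (eLpNorm_add_le (by fun_prop) (by fun_prop) one_le_two)
      congr 1
      funext p
      simp
    · rw [hp.lintegral_gradient_fst ho, ← eLpNorm_two_sq]
      have := (tendsto_ouDist hν2 F'.tendsto).const_add (eLpNorm (fun y => y) 2 ν)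
      rw [add_zero] at this
      exact ((ENNReal.continuous_pow 2).tendsto _).comp this
  · have hmb : Measurable fun y => ‖gradient b y‖ₑ ^ 2 := (measurable_gradient b).enorm.pow_const 2
    have e0 : ∫⁻ p, ‖gradient b p.1‖ₑ ^ 2 ∂(ν.prod (gaussBeta d)) =
        ∫⁻ x : Euc d, ‖x‖ₑ ^ 2 ∂(gaussBeta d) := by
      rw [(measurePreserving_fst (μ := ν) (ν := gaussBeta d)).lintegral_comp hmb,
        hp.lintegral_gradient_snd ho hν]
    refine tendsto_lintegral_enorm_sub_pow 2
      (fun n => ((measurable_gradient _).comp (measurable_ouMap _)).aestronglyMeasurable)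
      ((measurable_gradient _).comp measurable_fst).aestronglyMeasurable hS
      (by rw [e0]; exact lintegral_enorm_sq_gaussBeta_ne_top d)
      (A := fun _ => ∫⁻ x : Euc d, ‖x‖ₑ ^ 2 ∂(gaussBeta d)) (fun k => ?_) ?_ two_ne_zero
    · have hm : Measurable fun y => ‖gradient (bn (ms k)) y‖ₑ ^ 2 :=
        (measurable_gradient _).enorm.pow_const 2
      rw [(measurePreserving_ouMap ν (t (ms k))).lintegral_comp hm,
        (F.pair (ms k)).lintegral_gradient_snd (F.optimal (ms k)) (F.ac (ms k))]
    · rw [e0]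
      exact tendsto_const_nhds

/-- The whole sequence of forward transport maps converges in `L²`, since the family is stable under
passing to subsequences. -/
theorem IsOUFamily.tendsto_gradient_fst (F : IsOUFamily ν t an bn γn) (hp : IsConvexPair a b γ)
    (ho : IsOptimalPlan (gaussBeta d) ν γ) (hν : ν ≪ volume) (hν' : volume ≪ ν)
    (hν2 : MemLp (fun y => y) 2 ν) :
    Tendsto (fun n => ∫⁻ x, ‖gradient (an n) x - gradient a x‖ₑ ^ 2 ∂(gaussBeta d))
      atTop (𝓝 0) := by
  refine tendsto_of_subseq_tendsto fun ns hns => ?_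
  obtain ⟨ms, h, -⟩ := (F.comp hns).exists_subseq_tendsto hp ho hν hν' hν2
  exact ⟨ms, h⟩

theorem IsOUFamily.tendsto_gradient_snd (F : IsOUFamily ν t an bn γn) (hp : IsConvexPair a b γ)
    (ho : IsOptimalPlan (gaussBeta d) ν γ) (hν : ν ≪ volume) (hν' : volume ≪ ν)
    (hν2 : MemLp (fun y => y) 2 ν) :
    Tendsto (fun n => ∫⁻ p, ‖gradient (bn n) (ouMap (t n) p) - gradient b p.1‖ₑ ^ 2
      ∂(ν.prod (gaussBeta d))) atTop (𝓝 0) := by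
  refine tendsto_of_subseq_tendsto fun ns hns => ?_
  obtain ⟨ms, -, h⟩ := (F.comp hns).exists_subseq_tendsto hp ho hν hν' hν2
  exact ⟨ms, h⟩

end Stability

/-! ### Convergence of the potentials -/

section SemigroupBounds

/-- Integrating out one variable against a probability measure is a contraction in `L^p`. -/
theorem eLpNorm_integral_prod_le {α β E : Type*} [MeasurableSpace α] [MeasurableSpace β]
    {μ : Measure α} {ρ : Measure β} [SFinite μ] [IsProbabilityMeasure ρ] [NormedAddCommGroup E]
    [NormedSpace ℝ E] {F : α × β → E} (hF : AEStronglyMeasurable F (μ.prod ρ)) {p : ℝ≥0∞}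
    (hp : 1 ≤ p) (hp' : p ≠ ⊤) :
    eLpNorm (fun x => ∫ y, F (x, y) ∂ρ) p μ ≤ eLpNorm F p (μ.prod ρ) := by
  have hp0 : p ≠ 0 := (zero_lt_one.trans_le hp).ne'
  have hpr : 0 < p.toReal := ENNReal.toReal_pos hp0 hp'
  rw [eLpNorm_eq_lintegral_rpow_enorm_toReal hp0 hp',
    eLpNorm_eq_lintegral_rpow_enorm_toReal hp0 hp',
    lintegral_prod _ (hF.enorm.pow_const _)]
  gcongr ?_ ^ _
  refine lintegral_mono_ae ?_
  filter_upwards [hF.prodMk_left] with x hx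
  have h1 : ‖∫ y, F (x, y) ∂ρ‖ₑ ≤ eLpNorm (fun y => F (x, y)) p ρ := by
    refine (enorm_integral_le_lintegral_enorm _).trans ?_
    rw [← eLpNorm_one_eq_lintegral_enorm]
    exact eLpNorm_le_eLpNorm_of_exponent_le hp hx
  calc ‖∫ y, F (x, y) ∂ρ‖ₑ ^ p.toReal ≤ eLpNorm (fun y => F (x, y)) p ρ ^ p.toReal := by gcongr
    _ = _ := by
      rw [eLpNorm_eq_lintegral_rpow_enorm_toReal hp0 hp', ← ENNReal.rpow_mul,
        one_div_mul_cancel hpr.ne', ENNReal.rpow_one]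

variable {d : ℕ} {ν : Measure (Euc d)} [IsProbabilityMeasure ν] {E : Type*} [NormedAddCommGroup E]
  {g : Euc d → E} {t : ℝ} {p : ℝ≥0∞}

theorem ae_integrable_mehler (hg : MemLp g p (ouLaw ν t)) (hp : 1 ≤ p) :
    ∀ᵐ y ∂ν, Integrable (mehler t g y) (gaussBeta d) :=
  ((hg.comp_measurePreserving (measurePreserving_ouMap ν t)).integrable hp).prod_right_ae

variable [NormedSpace ℝ E]

theorem memLp_ouSemigroup (hg : MemLp g p (ouLaw ν t)) (hp : 1 ≤ p) (hp' : p ≠ ⊤) :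
    MemLp (ouSemigroup t g) p ν := by
  have h := hg.comp_measurePreserving (measurePreserving_ouMap ν t)
  exact ⟨h.1.integral_prod_right', (eLpNorm_integral_prod_le h.1 hp hp').trans_lt h.2⟩

theorem eLpNorm_ouSemigroup_sub_le [CompleteSpace E] (hg : MemLp g p (ouLaw ν t)) {h : Euc d → E}
    (hh : AEStronglyMeasurable h ν) (hp : 1 ≤ p) (hp' : p ≠ ⊤) :
    eLpNorm (ouSemigroup t g - h) p ν ≤
      eLpNorm (fun q => g (ouMap t q) - h q.1) p (ν.prod (gaussBeta d)) := by
  have hG := hg.comp_measurePreserving (measurePreserving_ouMap ν t)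
  refine le_trans (le_of_eq (eLpNorm_congr_ae ?_)) (eLpNorm_integral_prod_le
    (hG.1.sub hh.comp_fst) hp hp')
  filter_upwards [ae_integrable_mehler hg hp] with y hy
  have e : ∫ z, (g (ouMap t (y, z)) - h y) ∂(gaussBeta d) = ouSemigroup t g y - h y := by
    rw [integral_sub (f := fun z => g (ouMap t (y, z))) hy (integrable_const _)]
    simp [ouSemigroup, mehler_eq]
  exact e.symm

end SemigroupBounds

section Potentials

variable {d : ℕ} {ν : Measure (Euc d)} {a b : Euc d → ℝ} {γ : Measure (Euc d × Euc d)}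
  {φ ψ : Euc d → ℝ}

theorem gradient_fun_sub_of_differentiableAt {x : Euc d} (ha : DifferentiableAt ℝ a x)
    (hb : DifferentiableAt ℝ b x) :
    gradient (fun x => a x - b x) x = gradient a x - gradient b x := by
  refine HasGradientAt.gradient ?_
  rw [hasGradientAt_iff_hasFDerivAt, map_sub]
  exact ha.hasGradientAt.hasFDerivAt.sub hb.hasGradientAt.hasFDerivAt

theorem weakGrad_sub_half_norm_sq (ha : ConvexOn ℝ Set.univ a)
    (hφ : φ =ᵐ[volume] fun x => a x - ‖x‖ ^ 2 / 2) :
    HasWeakGrad φ (weakGrad φ) ∧ weakGrad φ =ᵐ[volume] fun x => gradient a x - x := by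
  obtain ⟨h1, h2⟩ := weakGrad_of_ae_eq (ha.locallyLipschitz.sub locallyLipschitz_half_norm_sq) hφ
  refine ⟨h1, ?_⟩
  filter_upwards [h2, ha.locallyLipschitz.ae_differentiableAt_real] with x hx hd
  rw [hx]
  exact gradient_sub_half_norm_sq hd

/-- The forward potential belongs to `𝔻_{2,1}` when the target has finite second moment. -/
theorem IsConvexPair.memD21 (hp : IsConvexPair a b γ) (ho : IsOptimalPlan (gaussBeta d) ν γ)
    (hν : MemLp (fun y => y) 2 ν) (hφ : φ =ᵐ[gaussBeta d] fun x => a x - ‖x‖ ^ 2 / 2) :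
    MemD21 φ := by
  have hβ := gaussBeta_absolutelyContinuous d
  obtain ⟨h1, h2⟩ := weakGrad_sub_half_norm_sq hp.convex_fst
    ((absolutelyContinuous_gaussBeta d).ae_le hφ)
  have hL : LocallyLipschitz fun x => a x - ‖x‖ ^ 2 / 2 :=
    hp.convex_fst.locallyLipschitz.sub locallyLipschitz_half_norm_sq
  have h3 : MemLp (fun x => gradient a x - x) 2 (gaussBeta d) :=
    (hp.memLp_gradient_fst ho hν).sub (memLp_id_gaussBeta d)
  refine ⟨(memLp_congr_ae hφ).2 (hL.memLp_two_of_gradient ?_), h1,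
    (memLp_congr_ae (hβ.ae_le h2)).2 h3⟩
  refine (memLp_congr_ae (hβ.ae_le ?_)).2 h3
  filter_upwards [hp.convex_fst.locallyLipschitz.ae_differentiableAt_real] with x hd
  exact gradient_sub_half_norm_sq hd

theorem integrable_sub_half_norm_sq (hb : Integrable b ν) (hν : MemLp (fun y => y) 2 ν) :
    Integrable (fun y => b y - ‖y‖ ^ 2 / 2) ν :=
  hb.sub ((hν.integrable_norm_pow two_ne_zero).div_const 2)

end Potentials

section Convergence

variable {d : ℕ} {ν : Measure (Euc d)} [IsProbabilityMeasure ν] {a b : Euc d → ℝ}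
  {γ : Measure (Euc d × Euc d)} {t : ℕ → ℝ} {an bn : ℕ → Euc d → ℝ}
  {γn : ℕ → Measure (Euc d × Euc d)}

/-- Under the normalisation of the additive constants, the Poincaré inequality turns convergence
of the gradients into convergence of the forward potentials. -/
theorem IsOUFamily.tendsto_potential (F : IsOUFamily ν t an bn γn) (hp : IsConvexPair a b γ)
    (ho : IsOptimalPlan (gaussBeta d) ν γ) (hν : ν ≪ volume) (hν' : volume ≪ ν)
    (hν2 : MemLp (fun y => y) 2 ν)
    (h0 : ∀ n, ∫ x, (an n x - a x) ∂(gaussBeta d) = 0) :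
    Tendsto (fun n => eLpNorm (fun x => an n x - a x) 2 (gaussBeta d)) atTop (𝓝 0) := by
  rw [tendsto_eLpNorm_two_iff]
  have hlim := ENNReal.Tendsto.const_mul (a := ENNReal.ofReal (Real.pi / 2) ^ 2 *
    (∫⁻ y : Euc d, ‖y‖ₑ ^ 2 ∂(gaussBeta d))) (F.tendsto_gradient_fst hp ho hν hν' hν2)
    (Or.inr (by have := lintegral_enorm_sq_gaussBeta_ne_top d; finiteness))
  rw [mul_zero] at hlim
  refine tendsto_of_tendsto_of_tendsto_of_le_of_le tendsto_const_nhds hlim (fun _ => zero_le)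
    fun n => ?_
  have hL : LocallyLipschitz fun x => an n x - a x :=
    (F.pair n).convex_fst.locallyLipschitz.sub hp.convex_fst.locallyLipschitz
  have hi : Integrable (fun x => an n x - a x) (gaussBeta d) :=
    ((F.pair n).integrable_fst (F.optimal n) (memLp_ouLaw hν2 (t n))).sub
      (hp.integrable_fst ho hν2)
  refine (hL.lintegral_sq_le_of_integral_eq_zero hi (h0 n)).trans (le_of_eq ?_)
  congr 1
  refine lintegral_congr_ae ((gaussBeta_absolutelyContinuous d).ae_le ?_)
  filter_upwards [(F.pair n).convex_fst.locallyLipschitz.ae_differentiableAt_real,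
    hp.convex_fst.locallyLipschitz.ae_differentiableAt_real] with x h1 h2
  rw [gradient_fun_sub_of_differentiableAt h1 h2]

/-- `L¹` convergence of the backward potentials along the coupling. At a point `(x, y, z)` of
`γ ⊗ β`, with `w = e^{-t} y + √(1 - e^{-2t}) z`, one has
`ψₙ(w) - ψ(y) = gap - (φₙ - φ)(x) + ⟪w - y, x - y⟫ - |w - y|² / 2`. -/
theorem IsOUFamily.tendsto_backward_potential (F : IsOUFamily ν t an bn γn)
    (hp : IsConvexPair a b γ) (ho : IsOptimalPlan (gaussBeta d) ν γ)
    (hν2 : MemLp (fun y => y) 2 ν)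
    (hA : Tendsto (fun n => eLpNorm (fun x => an n x - a x) 2 (gaussBeta d)) atTop (𝓝 0)) :
    Tendsto (fun n => ∫⁻ p, ‖(bn n (ouMap (t n) p) - ‖ouMap (t n) p‖ ^ 2 / 2) -
      (b p.1 - ‖p.1‖ ^ 2 / 2)‖ₑ ∂(ν.prod (gaussBeta d))) atTop (𝓝 0) := by
  have hγ := ho.isProbabilityMeasure
  set P := γ.prod (gaussBeta d)
  have mxy : MemLp (fun p : Euc d × Euc d => p.1 - p.2) 2 γ :=
    ((memLp_id_gaussBeta d).comp_measurePreserving ho.measurePreserving_fst).sub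
      (hν2.comp_measurePreserving ho.measurePreserving_snd)
  set C := eLpNorm (fun p : Euc d × Euc d => p.1 - p.2) 2 γ with hC
  have hδ := tendsto_ouDist hν2 F.tendsto
  have hlim : Tendsto (fun n => (∫⁻ q, ‖ouGap (t n) (an n) (bn n) q‖ₑ ∂P +
      eLpNorm (fun x => an n x - a x) 2 (gaussBeta d)) +
      (ouDist ν (t n) * C + ouDist ν (t n) ^ 2)) atTop (𝓝 0) := by
    have h1 := ENNReal.Tendsto.mul_const hδ (Or.inr mxy.eLpNorm_ne_top)
    have h2 := ((ENNReal.continuous_pow 2).tendsto _).comp hδ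
    simpa [Function.comp_def] using ((F.tendsto_lintegral_ouGap ho hν2).add hA).add (h1.add h2)
  refine tendsto_of_tendsto_of_tendsto_of_le_of_le tendsto_const_nhds hlim (fun _ => zero_le)
    fun n => ?_
  have cb := hp.continuous_snd
  have ca := hp.continuous_fst
  have cbn := (F.pair n).continuous_snd
  have can := (F.pair n).continuous_fst
  have cm := continuous_ouMap (d := d) (t n)
  have e1 : ouDist ν (t n) = eLpNorm (fun q : (Euc d × Euc d) × Euc d =>
      ouMap (t n) (q.1.2, q.2) - q.1.2) 2 P :=
    (eLpNorm_comp_measurePreserving (g := fun p : Euc d × Euc d => ouMap (t n) p - p.1)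
      (by fun_prop) ho.measurePreserving_prod).symm
  have e2 : C = eLpNorm (fun q : (Euc d × Euc d) × Euc d => q.1.1 - q.1.2) 2 P :=
    (eLpNorm_comp_measurePreserving (g := fun p : Euc d × Euc d => p.1 - p.2)
      (by fun_prop) (measurePreserving_fst (μ := γ) (ν := gaussBeta d))).symm
  have e3 : ∫⁻ q, ‖an n q.1.1 - a q.1.1‖ₑ ∂P ≤
      eLpNorm (fun x => an n x - a x) 2 (gaussBeta d) := by
    have hm : Measurable fun x => ‖an n x - a x‖ₑ :=
      (by fun_prop : Continuous fun x => ‖an n x - a x‖ₑ).measurable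
    rw [ho.measurePreserving_prod_fst.lintegral_comp hm, ← eLpNorm_one_eq_lintegral_enorm]
    exact eLpNorm_le_eLpNorm_of_exponent_le one_le_two (by fun_prop)
  have hmF : Measurable fun p : Euc d × Euc d => ‖(bn n (ouMap (t n) p) -
      ‖ouMap (t n) p‖ ^ 2 / 2) - (b p.1 - ‖p.1‖ ^ 2 / 2)‖ₑ :=
    (by fun_prop : Continuous fun p : Euc d × Euc d => ‖(bn n (ouMap (t n) p) -
      ‖ouMap (t n) p‖ ^ 2 / 2) - (b p.1 - ‖p.1‖ ^ 2 / 2)‖ₑ).measurable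
  have hm1 : Measurable fun q => ‖ouGap (t n) (an n) (bn n) q‖ₑ :=
    (measurable_ouGap (F.pair n)).enorm
  have hm2 : Measurable fun q : (Euc d × Euc d) × Euc d => ‖an n q.1.1 - a q.1.1‖ₑ :=
    (by fun_prop : Continuous fun q : (Euc d × Euc d) × Euc d =>
      ‖an n q.1.1 - a q.1.1‖ₑ).measurable
  have hm3 : Measurable fun q : (Euc d × Euc d) × Euc d =>
      ‖(inner ℝ (ouMap (t n) (q.1.2, q.2) - q.1.2) (q.1.1 - q.1.2) : ℝ)‖ₑ :=
    (by fun_prop : Continuous fun q : (Euc d × Euc d) × Euc d =>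
      ‖(inner ℝ (ouMap (t n) (q.1.2, q.2) - q.1.2) (q.1.1 - q.1.2) : ℝ)‖ₑ).measurable
  rw [← ho.measurePreserving_prod.lintegral_comp hmF]
  calc _ ≤ ∫⁻ q, ((‖ouGap (t n) (an n) (bn n) q‖ₑ + ‖an n q.1.1 - a q.1.1‖ₑ) +
        (‖(inner ℝ (ouMap (t n) (q.1.2, q.2) - q.1.2) (q.1.1 - q.1.2) : ℝ)‖ₑ +
          ‖ouMap (t n) (q.1.2, q.2) - q.1.2‖ₑ ^ 2)) ∂P := by
        refine lintegral_mono_ae ?_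
        filter_upwards [(measurePreserving_fst (μ := γ)
          (ν := gaussBeta d)).quasiMeasurePreserving.ae hp.ae_eq] with q hq
        set w := ouMap (t n) (q.1.2, q.2) with hw
        have hid : (bn n w - ‖w‖ ^ 2 / 2) - (b q.1.2 - ‖q.1.2‖ ^ 2 / 2) =
            (ouGap (t n) (an n) (bn n) q - (an n q.1.1 - a q.1.1)) +
              (inner ℝ (w - q.1.2) (q.1.1 - q.1.2) - ‖w - q.1.2‖ ^ 2 / 2) := by
          have s := norm_sub_sq_real w q.1.2
          have c1 := real_inner_comm w q.1.1
          have c2 := real_inner_comm q.1.2 q.1.1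
          have c3 := real_inner_self_eq_norm_sq q.1.2
          simp only [ouGap, ← hw, inner_sub_left, inner_sub_right]
          linarith
        rw [hid]
        have hhalf : ‖‖w - q.1.2‖ ^ 2 / 2‖ₑ ≤ ‖w - q.1.2‖ₑ ^ 2 := by
          rw [Real.enorm_of_nonneg (by positivity), ← ofReal_norm, ← ENNReal.ofReal_pow
            (norm_nonneg _)]
          exact ENNReal.ofReal_le_ofReal (half_le_self (by positivity))
        refine (enorm_add_le _ _).trans (add_le_add enorm_sub_le (enorm_sub_le.trans ?_))
        gcongr
    _ = (∫⁻ q, ‖ouGap (t n) (an n) (bn n) q‖ₑ ∂P + ∫⁻ q, ‖an n q.1.1 - a q.1.1‖ₑ ∂P) +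
        (∫⁻ q, ‖(inner ℝ (ouMap (t n) (q.1.2, q.2) - q.1.2) (q.1.1 - q.1.2) : ℝ)‖ₑ ∂P +
          ∫⁻ q, ‖ouMap (t n) (q.1.2, q.2) - q.1.2‖ₑ ^ 2 ∂P) := by
        rw [lintegral_add_left (by exact hm1.add hm2), lintegral_add_left hm1,
          lintegral_add_left hm3]
    _ ≤ _ := by
        rw [e1, e2, eLpNorm_two_sq]
        gcongr
        exact lintegral_enorm_inner_le (by fun_prop) (by fun_prop)

end Convergence

section Gibbs

variable {d : ℕ} {c : ℝ} {f : Euc d → ℝ}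

theorem gibbsMeasure_absolutelyContinuous (c : ℝ) (f : Euc d → ℝ) :
    gibbsMeasure c f ≪ volume :=
  (withDensity_absolutelyContinuous _ _).trans (gaussBeta_absolutelyContinuous d)

theorem absolutelyContinuous_gibbsMeasure (hc : 0 < c) (hf : AEMeasurable f (gaussBeta d)) :
    volume ≪ gibbsMeasure c f := by
  refine (absolutelyContinuous_gaussBeta d).trans
    (withDensity_absolutelyContinuous' (by fun_prop) (ae_of_all _ fun x => ?_))
  rw [Ne, ENNReal.ofReal_eq_zero, not_le]
  positivity

/-- If the normalising integral diverges then `c = 0` by convention, and the Gibbs measure is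
trivial; an optimal plan from `β` excludes this. -/
theorem IsOptimalPlan.integrable_exp_neg {γ : Measure (Euc d × Euc d)}
    (hc : c = (∫ x, Real.exp (-f x) ∂(gaussBeta d))⁻¹)
    (ho : IsOptimalPlan (gaussBeta d) (gibbsMeasure c f) γ) :
    IsProbabilityMeasure (gibbsMeasure c f) ∧ 0 < c ∧
      Integrable (fun x => Real.exp (-f x)) (gaussBeta d) := by
  have hγ := ho.isProbabilityMeasure
  have hP : IsProbabilityMeasure (gibbsMeasure c f) := by
    rw [← ho.1.2]
    exact Measure.isProbabilityMeasure_map measurable_snd.aemeasurable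
  have hc0 : c ≠ 0 := by
    rintro rfl
    have : gibbsMeasure 0 f = 0 := by simp [gibbsMeasure]
    exact IsProbabilityMeasure.ne_zero (gibbsMeasure 0 f) this
  have hI : ∫ x, Real.exp (-f x) ∂(gaussBeta d) ≠ 0 := fun h => hc0 (by rw [hc, h, inv_zero])
  refine ⟨hP, hc0.symm.lt_of_le ?_, ?_⟩
  · rw [hc]
    exact inv_nonneg.2 (integral_nonneg fun x => (Real.exp_pos _).le)
  · by_contra h
    exact hI (integral_undef h)

theorem memLp_id_gibbsMeasure {g : Euc d → Euc d} (h : HasWeakGrad f g) (hc : 0 < c)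
    (hfi : Integrable (fun x => Real.exp (-f x)) (gaussBeta d))
    (hgi : Integrable (fun x => ‖g x‖ ^ 2 * Real.exp (-f x)) (gaussBeta d)) :
    MemLp (fun y => y) 2 (gibbsMeasure c f) := by
  have hfm : AEMeasurable f (gaussBeta d) :=
    h.1.aestronglyMeasurable.aemeasurable.mono_ac (gaussBeta_absolutelyContinuous d)
  rw [memLp_two_iff_lintegral (by fun_prop), gibbsMeasure, lintegral_withDensity_eq_lintegral_mul₀
    (by fun_prop) (by fun_prop)]
  have e : ∀ x : Euc d, ((fun x : Euc d => ENNReal.ofReal (c * Real.exp (-f x))) *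
      fun x : Euc d => ‖x‖ₑ ^ 2 : Euc d → ℝ≥0∞) x =
      ENNReal.ofReal c * (‖x‖ₑ ^ 2 * ENNReal.ofReal (Real.exp (-f x))) := by
    intro x
    rw [Pi.mul_apply, ENNReal.ofReal_mul hc.le]
    ring
  rw [lintegral_congr e, lintegral_const_mul' _ _ ENNReal.ofReal_ne_top]
  have := h.lintegral_norm_sq_mul_exp_ne_top hfi hgi
  finiteness

end Gibbs

/-! ### The semigroup applied to the backward potentials -/

section PotentialConvergence

variable {d : ℕ} {ν : Measure (Euc d)} [IsProbabilityMeasure ν] {a b : Euc d → ℝ}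
  {γ : Measure (Euc d × Euc d)} {t : ℕ → ℝ} {an bn : ℕ → Euc d → ℝ}
  {γn : ℕ → Measure (Euc d × Euc d)} {φ ψ : Euc d → ℝ} {φn ψn : ℕ → Euc d → ℝ}

theorem IsOUFamily.tendsto_d21Norm (F : IsOUFamily ν t an bn γn) (hp : IsConvexPair a b γ)
    (ho : IsOptimalPlan (gaussBeta d) ν γ) (hν : ν ≪ volume) (hν' : volume ≪ ν)
    (hν2 : MemLp (fun y => y) 2 ν)
    (hφ : φ =ᵐ[gaussBeta d] fun x => a x - ‖x‖ ^ 2 / 2)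
    (hφn : ∀ n, φn n =ᵐ[gaussBeta d] fun x => an n x - ‖x‖ ^ 2 / 2)
    (hA : Tendsto (fun n => eLpNorm (fun x => an n x - a x) 2 (gaussBeta d)) atTop (𝓝 0)) :
    Tendsto (fun n => d21Norm (φn n - φ)) atTop (𝓝 0) := by
  have hG := tendsto_eLpNorm_two_iff.2 (F.tendsto_gradient_fst hp ho hν hν' hν2)
  have h := hA.add hG
  rw [add_zero] at h
  refine h.congr fun n => ?_
  have hdiff : φn n - φ =ᵐ[gaussBeta d] fun x => an n x - a x := by
    filter_upwards [hφ, hφn n] with x h1 h2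
    rw [Pi.sub_apply, h1, h2]
    ring
  have hL : LocallyLipschitz fun x => an n x - a x :=
    (F.pair n).convex_fst.locallyLipschitz.sub hp.convex_fst.locallyLipschitz
  rw [d21Norm, eLpNorm_congr_ae hdiff]
  congr 1
  refine eLpNorm_congr_ae ((gaussBeta_absolutelyContinuous d).ae_le ?_)
  filter_upwards [(weakGrad_of_ae_eq hL ((absolutelyContinuous_gaussBeta d).ae_le hdiff)).2,
    (F.pair n).convex_fst.locallyLipschitz.ae_differentiableAt_real,
    hp.convex_fst.locallyLipschitz.ae_differentiableAt_real] with x hx h1 h2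
  rw [hx, gradient_fun_sub_of_differentiableAt h1 h2]

theorem IsOUFamily.tendsto_ouSemigroup_potential (F : IsOUFamily ν t an bn γn)
    (hp : IsConvexPair a b γ) (ho : IsOptimalPlan (gaussBeta d) ν γ)
    (hν2 : MemLp (fun y => y) 2 ν)
    (hψ : ψ =ᵐ[ν] fun y => b y - ‖y‖ ^ 2 / 2)
    (hψn : ∀ n, ψn n =ᵐ[ouLaw ν (t n)] fun y => bn n y - ‖y‖ ^ 2 / 2)
    (hψn1 : ∀ n, MemLp (ψn n) 1 (ouLaw ν (t n)))
    (hA : Tendsto (fun n => eLpNorm (fun x => an n x - a x) 2 (gaussBeta d)) atTop (𝓝 0)) :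
    Tendsto (fun n => eLpNorm (ouSemigroup (t n) (ψn n) - ψ) 1 ν) atTop (𝓝 0) := by
  have hcb := hp.continuous_snd
  have hψm : AEStronglyMeasurable ψ ν := AEStronglyMeasurable.congr
    (by fun_prop : Continuous fun y => b y - ‖y‖ ^ 2 / 2).aestronglyMeasurable hψ.symm
  refine tendsto_of_tendsto_of_tendsto_of_le_of_le tendsto_const_nhds
    (F.tendsto_backward_potential hp ho hν2 hA) (fun _ => zero_le) fun n => ?_
  refine (eLpNorm_ouSemigroup_sub_le (hψn1 n) hψm le_rfl ENNReal.one_ne_top).trans (le_of_eq ?_)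
  rw [eLpNorm_one_eq_lintegral_enorm]
  refine lintegral_congr_ae ?_
  filter_upwards [measurePreserving_fst.quasiMeasurePreserving.ae hψ,
    (measurePreserving_ouMap ν (t n)).quasiMeasurePreserving.ae (hψn n)] with p h1 h2
  rw [h1, h2]

theorem IsOUFamily.tendsto_ouSemigroup_weakGrad (F : IsOUFamily ν t an bn γn)
    (hp : IsConvexPair a b γ) (ho : IsOptimalPlan (gaussBeta d) ν γ) (hν : ν ≪ volume)
    (hν' : volume ≪ ν) (hν2 : MemLp (fun y => y) 2 ν) {G : Euc d → Euc d} {Gn : ℕ → Euc d → Euc d}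
    (hG : G =ᵐ[volume] fun y => gradient b y - y)
    (hGn : ∀ n, Gn n =ᵐ[volume] fun y => gradient (bn n) y - y)
    (hGn2 : ∀ n, MemLp (Gn n) 2 (ouLaw ν (t n))) :
    Tendsto (fun n => eLpNorm (ouSemigroup (t n) (Gn n) - G) 2 ν) atTop (𝓝 0) := by
  have hlim := (tendsto_eLpNorm_two_iff.2 (F.tendsto_gradient_snd hp ho hν hν' hν2)).add
    (tendsto_ouDist hν2 F.tendsto)
  rw [add_zero] at hlim
  have hmb := measurable_gradient b
  have hGm : AEStronglyMeasurable G ν := AEStronglyMeasurable.congr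
    (by fun_prop : Measurable fun y => gradient b y - y).aestronglyMeasurable
    (EventuallyEq.symm (hν.ae_le hG))
  refine tendsto_of_tendsto_of_tendsto_of_le_of_le tendsto_const_nhds hlim (fun _ => zero_le)
    fun n => ?_
  have hmbn := measurable_gradient (bn n)
  have hmo := measurable_ouMap (d := d) (t n)
  refine (eLpNorm_ouSemigroup_sub_le (hGn2 n) hGm one_le_two ENNReal.ofNat_ne_top).trans ?_
  rw [ouDist]
  refine le_trans (le_of_eq (eLpNorm_congr_ae ?_)) (eLpNorm_sub_le
    (by fun_prop : Measurable fun p : Euc d × Euc d =>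
      gradient (bn n) (ouMap (t n) p) - gradient b p.1).aestronglyMeasurable
    (by fun_prop : Measurable fun p : Euc d × Euc d => ouMap (t n) p - p.1).aestronglyMeasurable
    one_le_two)
  filter_upwards [measurePreserving_fst.quasiMeasurePreserving.ae (hν.ae_le hG),
    (measurePreserving_ouMap ν (t n)).quasiMeasurePreserving.ae ((F.ac n).ae_le (hGn n))]
    with p h1 h2
  rw [h1, h2, Pi.sub_apply]
  abel

end PotentialConvergence

/-- A function `h` with `e^{-h} = Q_t e^{-f}` inherits measurability from the semigroup. -/
theorem aemeasurable_of_exp_neg_eq_ouSemigroup {d : ℕ} {t : ℝ} (ht : 0 ≤ t) {f h : Euc d → ℝ}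
    (hf : AEMeasurable f (gaussBeta d))
    (hh : ∀ᵐ x ∂(gaussBeta d), Real.exp (-h x) = ouSemigroup t (fun z => Real.exp (-f z)) x) :
    AEMeasurable h (gaussBeta d) := by
  have hmp : MeasurePreserving (ouMap (d := d) t) ((gaussBeta d).prod (gaussBeta d))
      (gaussBeta d) := ⟨measurable_ouMap t, map_rotation_fst (exp_sq_add_sqrt_sq ht)⟩
  have h1 : AEStronglyMeasurable (fun z => Real.exp (-f z)) (gaussBeta d) :=
    (by fun_prop : AEMeasurable (fun z => Real.exp (-f z)) (gaussBeta d)).aestronglyMeasurable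
  have h2 : AEMeasurable (ouSemigroup t fun z => Real.exp (-f z)) (gaussBeta d) :=
    (h1.comp_measurePreserving hmp).integral_prod_right'.aemeasurable
  refine (Real.measurable_log.comp_aemeasurable h2).neg.congr ?_
  filter_upwards [hh] with x hx
  rw [Pi.neg_apply, Function.comp_apply, ← hx, Real.log_exp, neg_neg]

/-- The backward potential is integrable, and its weak gradient is square integrable. -/
theorem IsConvexPair.memLp_backward {d : ℕ} {ν : Measure (Euc d)} {a b ψ : Euc d → ℝ}
    {γ : Measure (Euc d × Euc d)} (hp : IsConvexPair a b γ)
    (ho : IsOptimalPlan (gaussBeta d) ν γ) (hν : ν ≪ volume) (hν' : volume ≪ ν)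
    (hν2 : MemLp (fun y => y) 2 ν) [IsFiniteMeasure ν]
    (hψ : ψ =ᵐ[ν] fun y => b y - ‖y‖ ^ 2 / 2) :
    MemLp ψ 1 ν ∧ HasWeakGrad ψ (weakGrad ψ) ∧ MemLp (weakGrad ψ) 2 ν ∧
      weakGrad ψ =ᵐ[volume] fun y => gradient b y - y := by
  obtain ⟨h1, h2⟩ := weakGrad_sub_half_norm_sq hp.convex_snd (hν'.ae_le hψ)
  exact ⟨memLp_one_iff_integrable.2 ((integrable_congr hψ).2
    (integrable_sub_half_norm_sq (hp.integrable_snd ho hν2) hν2)), h1,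
    (memLp_congr_ae (hν.ae_le h2)).2 ((hp.memLp_gradient_snd ho hν).sub hν2), h2⟩

theorem lemma2 (d : ℕ) (f : Euc d → ℝ) (hf : MemD21 f)
    (hfI : Integrable (fun x => ‖weakGrad f x‖ ^ 2 * Real.exp (-f x)) (gaussBeta d))
    (c : ℝ) (hc : c = (∫ x, Real.exp (-f x) ∂(gaussBeta d))⁻¹)
    (fn : ℕ → Euc d → ℝ)
    (hfn : ∀ n, 1 ≤ n → ∀ᵐ x ∂(gaussBeta d),
      Real.exp (-fn n x) = ouSemigroup (1 / (n : ℝ)) (fun z => Real.exp (-f z)) x)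
    (φ ψ : Euc d → ℝ) (hφψ : IsMongePotentials (gaussBeta d) (gibbsMeasure c f) φ ψ)
    (φn ψn : ℕ → Euc d → ℝ)
    (hφψn : ∀ n, 1 ≤ n →
      IsMongePotentials (gaussBeta d) (gibbsMeasure c (fn n)) (φn n) (ψn n))
    (hφ0 : ∫ x, φ x ∂(gaussBeta d) = 0)
    (hφn0 : ∀ n, 1 ≤ n → ∫ x, φn n x ∂(gaussBeta d) = 0) :
    -- `φ_n → φ` in `𝔻_{2,1}`
    (MemD21 φ ∧ (∀ n, 1 ≤ n → MemD21 (φn n)) ∧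
      Tendsto (fun n => d21Norm (φn n - φ)) atTop (𝓝 0)) ∧
    -- `Q_{1/n} ψ_n → ψ` in `L¹(ν)`
    (MemLp ψ 1 (gibbsMeasure c f) ∧
      (∀ n : ℕ, 1 ≤ n →
        (∀ᵐ y ∂(gibbsMeasure c f), Integrable (mehler (1 / (n : ℝ)) (ψn n) y) (gaussBeta d)) ∧
        MemLp (ouSemigroup (1 / (n : ℝ)) (ψn n)) 1 (gibbsMeasure c f)) ∧
      Tendsto (fun n : ℕ => eLpNorm (ouSemigroup (1 / (n : ℝ)) (ψn n) - ψ) 1 (gibbsMeasure c f))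
        atTop (𝓝 0)) ∧
    -- `Q_{1/n} ∇ψ_n → ∇ψ` in `L²(ν, ℝ^d)`
    (HasWeakGrad ψ (weakGrad ψ) ∧ MemLp (weakGrad ψ) 2 (gibbsMeasure c f) ∧
      (∀ n : ℕ, 1 ≤ n →
        HasWeakGrad (ψn n) (weakGrad (ψn n)) ∧
        (∀ᵐ y ∂(gibbsMeasure c f),
          Integrable (mehler (1 / (n : ℝ)) (weakGrad (ψn n)) y) (gaussBeta d)) ∧
        MemLp (ouSemigroup (1 / (n : ℝ)) (weakGrad (ψn n))) 2 (gibbsMeasure c f)) ∧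
      Tendsto (fun n : ℕ =>
          eLpNorm (ouSemigroup (1 / (n : ℝ)) (weakGrad (ψn n)) - weakGrad ψ) 2 (gibbsMeasure c f))
        atTop (𝓝 0)) := by
  obtain ⟨a, b, γ, hp, ho, hφ, hψ⟩ := hφψ.exists_isConvexPair
  obtain ⟨hprob, hc0, hfi⟩ := ho.integrable_exp_neg hc
  have hfm := hf.1.1.aemeasurable
  have hν := gibbsMeasure_absolutelyContinuous c f
  have hν' := absolutelyContinuous_gibbsMeasure hc0 hfm
  have hν2 := memLp_id_gibbsMeasure hf.2.1 hc0 hfi hfI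
  -- the regularised measures are the laws of the Ornstein–Uhlenbeck process started from `ν`
  have hlaw : ∀ n, 1 ≤ n → gibbsMeasure c (fn n) = ouLaw (gibbsMeasure c f) (1 / (n : ℝ)) :=
    fun n hn => gibbsMeasure_eq_map_ouMap (by positivity) hc0 hfm hfi (hfn n hn)
  set ν := gibbsMeasure c f
  have hac : ∀ n : ℕ, 1 ≤ n → ouLaw ν (1 / (n : ℝ)) ≪ volume := fun n hn => by
    rw [← hlaw n hn]; exact gibbsMeasure_absolutelyContinuous _ _
  have hpn : ∀ n : ℕ, 1 ≤ n → IsMongePotentials (gaussBeta d)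
      (ouLaw ν (1 / (n : ℝ))) (φn n) (ψn n) :=
    fun n hn => hlaw n hn ▸ hφψn n hn
  have hac' : ∀ n : ℕ, 1 ≤ n → volume ≪ ouLaw ν (1 / (n : ℝ)) := fun n hn => by
    rw [← hlaw n hn]
    exact absolutelyContinuous_gibbsMeasure hc0
      (aemeasurable_of_exp_neg_eq_ouSemigroup (by positivity) hfm (hfn n hn))
  have hprobn : ∀ s, IsProbabilityMeasure (ouLaw ν s) := fun s =>
    Measure.isProbabilityMeasure_map (measurable_ouMap s).aemeasurable
  choose! an bn γn hpair hopt hφn hψn using fun n hn => (hpn n hn).exists_isConvexPair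
  have hb := hp.memLp_backward ho hν hν' hν2 hψ
  have hbn := fun n hn => (hpair n hn).memLp_backward (hopt n hn) (hac n hn) (hac' n hn)
    (memLp_ouLaw hν2 _) (hψn n hn)
  have hD := hp.memD21 ho hν2 hφ
  have hDn : ∀ n, 1 ≤ n → MemD21 (φn n) := fun n hn =>
    (hpair n hn).memD21 (hopt n hn) (memLp_ouLaw hν2 _) (hφn n hn)
  have F : IsOUFamily ν (fun k => 1 / ((k + 1 : ℕ) : ℝ)) (fun k => an (k + 1))
      (fun k => bn (k + 1)) (fun k => γn (k + 1)) := by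
    refine ⟨?_, fun k => hpair _ k.succ_pos, fun k => hopt _ k.succ_pos, fun k => hac _ k.succ_pos⟩
    exact (tendsto_add_atTop_iff_nat (f := fun n : ℕ => 1 / (n : ℝ)) 1).2
      tendsto_one_div_atTop_nhds_zero_nat
  have h0 : ∀ k : ℕ, ∫ x, (an (k + 1) x - a x) ∂(gaussBeta d) = 0 := by
    intro k
    have e : (fun x => an (k + 1) x - a x) =ᵐ[gaussBeta d] fun x => φn (k + 1) x - φ x := by
      filter_upwards [hφ, hφn (k + 1) k.succ_pos] with x h1 h2
      rw [h1, h2]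
      ring
    rw [integral_congr_ae e, integral_sub ((hDn _ k.succ_pos).1.integrable one_le_two)
      (hD.1.integrable one_le_two), hφ0, hφn0 _ k.succ_pos, sub_zero]
  have hA := F.tendsto_potential hp ho hν hν' hν2 h0
  refine ⟨⟨hD, hDn, ?_⟩, ⟨hb.1, fun n hn => ⟨?_, ?_⟩, ?_⟩,
    hb.2.1, hb.2.2.1, fun n hn => ⟨(hbn n hn).2.1, ?_, ?_⟩, ?_⟩
  · rw [← tendsto_add_atTop_iff_nat 1]
    exact F.tendsto_d21Norm hp ho hν hν' hν2 hφ (fun k => hφn _ k.succ_pos) hA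
  · exact ae_integrable_mehler (hbn n hn).1 le_rfl
  · exact memLp_ouSemigroup (hbn n hn).1 le_rfl ENNReal.one_ne_top
  · rw [← tendsto_add_atTop_iff_nat 1]
    exact F.tendsto_ouSemigroup_potential hp ho hν2 hψ (fun k => hψn _ k.succ_pos)
      (fun k => (hbn _ k.succ_pos).1) hA
  · exact ae_integrable_mehler (hbn n hn).2.2.1 one_le_two
  · exact memLp_ouSemigroup (hbn n hn).2.2.1 one_le_two ENNReal.ofNat_ne_top
  · rw [← tendsto_add_atTop_iff_nat 1]
    exact F.tendsto_ouSemigroup_weakGrad hp ho hν hν' hν2 hb.2.2.2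
      (fun k => (hbn _ k.succ_pos).2.2.2) (fun k => (hbn _ k.succ_pos).2.2.1)
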